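/- \textbf{Definitions.} For $m\ge 0$ let the grid of depth $m$ be the subdivision of the unit cube $[0,1]^3$ into $8^m$ equal closed cubical cells of edge length $2^{-m}$. A \emph{rule} consists of an order $O_1,\dots,O_8$ of the eight octants of the cube (the cells of the grid of depth $1$) and, for each $i$, a symmetry $g_i$ of the cube (one of its $48$ rotations and reflections) and a choice whether or not to reverse. A rule defines recursively an order of the cells of the grid of depth $m$, for every $m$: for $m=0$ there is only one cell; for depth $m+1$ the octants are visited in the order $O_1,\dots,O_8$, and within $O_i$ the cells are visited in the order of depth $m$, reversed if so chosen for $i$, transformed by $g_i$ and scaled to $O_i$. The family of these orders is the \emph{scanning order} defined by the rule. It is \emph{vertex-continuous} if at every depth any two consecutive cells share at least one vertex. A \emph{three-dimensional mono-Hilbert curve} is a vertex-continuous scanning order that is defined by a single rule; two curves are the same if their scanning orders are the same, even if they come from different rules. The \emph{entrance gate} (\emph{exit gate}) of a curve is the point to which its first (last) cells shrink as the depth tends to infinity. Curves are counted modulo rotation, reflection and reversal. A curve is of type A, B, C, D, E or F if, after a suitable rotation, reflection and/or reversal, its (entrance gate, exit gate) is, respectively, A: $(0,0,0),(1,0,0)$;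 B: $(0,0,0),(0,1,1)$; C: $(0,0,0),(1,\tfrac12,0)$; D: $(0,0,0),(1,\tfrac12,\tfrac12)$; E: $(\tfrac13,0,0),(1,\tfrac13,1)$; F: $(0,\tfrac13,\tfrac13),(\tfrac23,\tfrac13,0)$. A \emph{connection scheme} of a given type is a sequence $p_0,O_1,p_1,O_2,\dots,O_8,p_8$ of points and octants, in which every octant occurs exactly once, $p_0$ and $p_8$ are the entrance gate and the exit gate listed for the type, and for each $i$ the triple $(O_i,p_{i-1},p_i)$ is the image of the unit cube with its entrance gate and exit gate, or of the unit cube with these two gates exchanged, under a symmetry of the cube followed by scaling to $O_i$. It is \emph{symmetric} if some symmetry of the cube maps it to its own reversal. A curve \emph{matches} the scheme if it visits the octants in the order $O_1,\dots,O_8$, and the first and last cells it visits within $O_i$ shrink to $p_{i-1}$ and $p_i$, for each $i$. \textbf{Theorem.} (1) Modulo rotation, reflection and reversal there are exactly $10\,694\,807$ three-dimensional mono-Hilbert curves. (2) Each of them is of exactly one of the types A--F, and the numbers of curves of these types are A: $1\,552\,544$; B: $9\,138\,464$; C: $2\,758$; D: $1\,024$; E: $16$; F: $1$. (3) Modulo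 rotation, reflection and reversal, the numbers of connection schemes of these types are A: $29$; B: $149$; C: $2\,758$; D: $4$; E: $16$; F: $1$. (4) The number of mono-Hilbert curves, modulo rotation, reflection and reversal, that match a given connection scheme is $2^{16}=65\,536$ for each asymmetric scheme and $16+30\,720$ for each symmetric scheme of type A or B; it is $2^8=256$ for each scheme of type D, and $1$ for each scheme of type C, E or F. -/

import Mathlib

namespace MonoHilbert

/-! ## Rotations and reflections of the unit cube -/

/-- A symmetry (rotation or reflection) of the unit cube `[0,1]³`, as a signed permutation of the
coordinate axes: coordinate `k` of the image is coordinate `perm k` of the argument, reflected in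
the middle of the cube if `flip k` holds.  All 48 symmetries of the cube arise in exactly one way. -/
structure CubeSym where
  perm : Equiv.Perm (Fin 3)
  flip : Fin 3 → Bool

namespace CubeSym

/-- The action on coordinate triples, where `refl` is the reflection of a single coordinate. -/
def act {α : Type} (refl : α → α) (g : CubeSym) (x : Fin 3 → α) : Fin 3 → α :=
  fun k => if g.flip k then refl (x (g.perm k)) else x (g.perm k)

/-- The action on the points of the unit cube. -/
noncomputable def onPoint (g : CubeSym) (x : Fin 3 → ℝ) : Fin 3 → ℝ :=
  g.act (fun t => 1 - t) x

/-- The action on the octants of the unit cube (see `Octant`). -/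
def onOctant (g : CubeSym) (o : Fin 3 → Bool) : Fin 3 → Bool :=
  g.act (fun t => !t) o

/-- The action on the cells of the grid of `2 ^ m × 2 ^ m × 2 ^ m` cells (see `cube`). -/
def onCell (m : ℕ) (g : CubeSym) (c : Fin 3 → ℤ) : Fin 3 → ℤ :=
  g.act (fun t => 2 ^ m - 1 - t) c

/-- The identity. -/
def one : CubeSym := ⟨Equiv.refl _, fun _ => false⟩

/-- The composition `g ∘ h`. -/
def comp (g h : CubeSym) : CubeSym :=
  ⟨g.perm.trans h.perm, fun k => xor (g.flip k) (h.flip (g.perm k))⟩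

/-- The inverse. -/
def inv (g : CubeSym) : CubeSym :=
  ⟨g.perm.symm, fun k => g.flip (g.perm.symm k)⟩

theorem act_one {α : Type} (refl : α → α) (x : Fin 3 → α) : one.act refl x = x := by
  funext k
  simp [act, one]

theorem act_comp {α : Type} (refl : α → α) (hr : ∀ t, refl (refl t) = t) (g h : CubeSym)
    (x : Fin 3 → α) : (g.comp h).act refl x = g.act refl (h.act refl x) := by
  funext k
  cases h1 : g.flip k <;> cases h2 : h.flip (g.perm k) <;> simp [act, comp, h1, h2, hr]

theorem inv_act {α : Type} (refl : α → α) (hr : ∀ t, refl (refl t) = t) (g : CubeSym)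
    (x : Fin 3 → α) : g.inv.act refl (g.act refl x) = x := by
  funext k
  cases h1 : g.flip (g.perm.symm k) <;> simp [act, inv, h1, hr]

end CubeSym

/-! ## Scanning orders -/

/-- The cell with integer coordinates `c` of the grid of depth `m`, that is, the grid that divides
the unit cube into `8 ^ m` cells of edge length `2⁻ᵐ`. -/
def cube (m : ℕ) (c : Fin 3 → ℤ) : Set (Fin 3 → ℝ) :=
  {x | ∀ k, (c k : ℝ) / 2 ^ m ≤ x k ∧ x k ≤ ((c k : ℝ) + 1) / 2 ^ m}

/-- The grid point with integer coordinates `v` is a vertex of the cell with coordinates `c`. -/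
def IsVertex (v c : Fin 3 → ℤ) : Prop := ∀ k, v k = c k ∨ v k = c k + 1

/-- Two cells of the same grid share at least one vertex. -/
def ShareVertex (c d : Fin 3 → ℤ) : Prop := ∃ v, IsVertex v c ∧ IsVertex v d

/-- An octant of the unit cube: in direction `k` it is the half `[1/2,1]` if `o k` is true, and the
half `[0,1/2]` otherwise. -/
abbrev Octant := Fin 3 → Bool

/-- A scanning order lists, for each depth `m`, the cells of the grid of depth `m` in the order in
which they are visited. -/
abbrev ScanningOrder := ℕ → List (Fin 3 → ℤ)

/-- A rule system that consists of a single rule: the order in which the octants are visited, and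
for each octant the rotation or reflection, and possibly the reversal, with which the rule itself
is applied in that octant. -/
structure Rule where
  octant : Fin 8 ≃ Octant
  sym : Fin 8 → CubeSym
  rev : Fin 8 → Bool

/-- The cell of the grid of depth `m + 1` that has coordinates `c` in the grid of depth `m` of the
octant `o`. -/
def inOctant (m : ℕ) (o : Octant) (c : Fin 3 → ℤ) : Fin 3 → ℤ :=
  fun k => (if o k then 2 ^ m else 0) + c k

/-- A scanning order (at a single depth), reversed if `r` is true. -/
def reverseIf (r : Bool) (l : List (Fin 3 → ℤ)) : List (Fin 3 → ℤ) :=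
  if r then l.reverse else l

/-- The scanning order defined by a rule, by recursive expansion of the rule. -/
def Rule.order (R : Rule) : ScanningOrder
  | 0 => [fun _ => 0]
  | m + 1 => (List.finRange 8).flatMap fun i =>
      (reverseIf (R.rev i) (R.order m)).map fun c =>
        inOctant m (R.octant i) ((R.sym i).onCell m c)

namespace ScanningOrder

/-- A scanning order is vertex-continuous if for any two cells visited consecutively, and any
refinement of these cells, the last subcell in the former cell shares a vertex with the first subcell
in the latter cell.  Since these subcells are visited consecutively themselves, this means that
consecutive cells share a vertex at every depth. -/
def VertexContinuous (S : ScanningOrder) : Prop :=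
  ∀ m, (S m).IsChain ShareVertex

/-- The point `x` is the entrance gate: the point to which the first cells visited shrink. -/
def IsEntranceGate (S : ScanningOrder) (x : Fin 3 → ℝ) : Prop :=
  ∀ m, ∃ c, (S m).head? = some c ∧ x ∈ cube m c

/-- The point `x` is the exit gate: the point to which the last cells visited shrink. -/
def IsExitGate (S : ScanningOrder) (x : Fin 3 → ℝ) : Prop :=
  ∀ m, ∃ c, (S m).getLast? = some c ∧ x ∈ cube m c

/-- The scanning order, rotated or reflected by `g`, and reversed if `r` is true. -/
def transform (g : CubeSym) (r : Bool) (S : ScanningOrder) : ScanningOrder :=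
  fun m => (reverseIf r (S m)).map (g.onCell m)

theorem transform_one (S : ScanningOrder) : S.transform CubeSym.one false = S := by
  funext m
  have h : CubeSym.onCell m CubeSym.one = id := funext fun c => CubeSym.act_one _ c
  simp [transform, reverseIf, h]

theorem transform_inv (g : CubeSym) (r : Bool) (S : ScanningOrder) :
    (S.transform g r).transform g.inv r = S := by
  funext m
  have h : CubeSym.onCell m g.inv ∘ CubeSym.onCell m g = id :=
    funext fun c => CubeSym.inv_act _ (fun t => by ring) g c
  cases r <;> simp [transform, reverseIf, h]

theorem transform_comp (g h : CubeSym) (r r' : Bool) (S : ScanningOrder) :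
    (S.transform h r).transform g r' = S.transform (g.comp h) (xor r r') := by
  funext m
  have e : CubeSym.onCell m g ∘ CubeSym.onCell m h = CubeSym.onCell m (g.comp h) :=
    funext fun c => (CubeSym.act_comp _ (fun t => by ring) g h c).symm
  cases r <;> cases r' <;> simp [transform, reverseIf, e]

end ScanningOrder

/-! ## Mono-Hilbert curves -/

/-- A (three-dimensional) mono-Hilbert curve, identified with its scanning order: a vertex-continuous
scanning order that can be defined by a single rule. -/
def MonoHilbertCurve : Type :=
  {S : ScanningOrder // (∃ R : Rule, S = R.order) ∧ S.VertexContinuous}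

/-- Equality modulo rotation, reflection and reversal. -/
instance curveSetoid : Setoid MonoHilbertCurve where
  r C D := ∃ g r, D.1 = C.1.transform g r
  iseqv :=
    { refl := fun C => ⟨CubeSym.one, false, (ScanningOrder.transform_one C.1).symm⟩
      symm := by
        rintro C D ⟨g, r, h⟩
        exact ⟨g.inv, r, by rw [h, ScanningOrder.transform_inv]⟩
      trans := by
        rintro C D E ⟨g, r, h⟩ ⟨g', r', h'⟩
        exact ⟨g'.comp g, xor r r', by rw [h', h, ScanningOrder.transform_comp]⟩ }

/-- Mono-Hilbert curves modulo rotation, reflection and reversal. -/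
abbrev CurveClass : Type := Quotient curveSetoid

/-- The types of curves, according to the locations of their gates. -/
inductive GateType
  | A | B | C | D | E | F

/-- The entrance gate of curves of a given type. -/
noncomputable def GateType.entrance : GateType → Fin 3 → ℝ
  | A => ![0, 0, 0]
  | B => ![0, 0, 0]
  | C => ![0, 0, 0]
  | D => ![0, 0, 0]
  | E => ![1 / 3, 0, 0]
  | F => ![0, 1 / 3, 1 / 3]

/-- The exit gate of curves of a given type. -/
noncomputable def GateType.exit : GateType → Fin 3 → ℝ
  | A => ![1, 0, 0]
  | B => ![0, 1, 1]
  | C => ![1, 1 / 2, 0]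
  | D => ![1, 1 / 2, 1 / 2]
  | E => ![1, 1 / 3, 1]
  | F => ![2 / 3, 1 / 3, 0]

/-- A curve, modulo rotation, reflection and reversal, is of type `t` if one of its
representatives has its entrance gate and its exit gate at the locations prescribed by `t`. -/
def CurveClass.HasType (q : CurveClass) (t : GateType) : Prop :=
  ∃ C : MonoHilbertCurve, (⟦C⟧ : CurveClass) = q ∧
    C.1.IsEntranceGate t.entrance ∧ C.1.IsExitGate t.exit

/-- The number of mono-Hilbert curves of type `t`, modulo rotation, reflection and reversal. -/
noncomputable def numCurves (t : GateType) : ℕ := Nat.card {q : CurveClass // q.HasType t}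

/-! ## Connection schemes -/

/-- The image of the point `x` of the unit cube under the scaling of the unit cube to octant `o`. -/
noncomputable def scaleTo (o : Octant) (x : Fin 3 → ℝ) : Fin 3 → ℝ :=
  fun k => (x k + if o k then 1 else 0) / 2

/-- A connection scheme of type `t`: a sequence of, alternatingly, gates and octants, that starts
with the entrance gate and ends with the exit gate of the unit cube, such that every octant with its
own entrance gate and exit gate is an image of the unit cube with its gates, possibly rotated,
reflected and reversed. -/
structure ConnectionScheme (t : GateType) where
  octant : Fin 8 ≃ Octant
  gate : Fin 9 → Fin 3 → ℝ
  gate_first : gate 0 = t.entrance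
  gate_last : gate 8 = t.exit
  link : ∀ i : Fin 8, ∃ g : CubeSym,
    (gate i.castSucc = scaleTo (octant i) (g.onPoint t.entrance) ∧
      gate i.succ = scaleTo (octant i) (g.onPoint t.exit)) ∨
    (gate i.castSucc = scaleTo (octant i) (g.onPoint t.exit) ∧
      gate i.succ = scaleTo (octant i) (g.onPoint t.entrance))

/-- The index `i`, counted from the other end if `r` is true. -/
def revIf {n : ℕ} (r : Bool) (i : Fin n) : Fin n := if r then i.rev else i

namespace ConnectionScheme

/-- The scheme `s'` is the scheme `s`, rotated or reflected by `g`, and reversed if `r` is true. -/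
def IsImage {t : GateType} (g : CubeSym) (r : Bool) (s s' : ConnectionScheme t) : Prop :=
  (∀ i, s'.octant i = g.onOctant (s.octant (revIf r i))) ∧
    ∀ j, s'.gate j = g.onPoint (s.gate (revIf r j))

/-- A scheme is symmetric if it equals a rotated or reflected copy of its own reversal. -/
def IsSymmetric {t : GateType} (s : ConnectionScheme t) : Prop :=
  ∃ g, IsImage g true s s

/-- Equality of connection schemes modulo rotation, reflection and reversal. -/
instance setoid (t : GateType) : Setoid (ConnectionScheme t) where
  r s s' := ∃ g r, IsImage g r s s'
  iseqv :=
    { refl := fun s => ⟨CubeSym.one, false, fun i => (CubeSym.act_one _ _).symm,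
        fun j => (CubeSym.act_one _ _).symm⟩
      symm := by
        rintro s s' ⟨g, r, h1, h2⟩
        refine ⟨g.inv, r, fun i => ?_, fun j => ?_⟩
        · rw [h1]
          have e : revIf r (revIf r i) = i := by cases r <;> simp [revIf]
          rw [e]
          exact (CubeSym.inv_act _ (fun t => by simp) g _).symm
        · rw [h2]
          have e : revIf r (revIf r j) = j := by cases r <;> simp [revIf]
          rw [e]
          exact (CubeSym.inv_act _ (fun t => by ring) g _).symm
      trans := by
        rintro s s' s'' ⟨g, r, h1, h2⟩ ⟨g', r', h1', h2'⟩
        refine ⟨g'.comp g, xor r r', fun i => ?_, fun j => ?_⟩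
        · rw [h1', h1]
          have e : revIf r (revIf r' i) = revIf (xor r r') i := by
            cases r <;> cases r' <;> simp [revIf]
          rw [e]
          exact (CubeSym.act_comp _ (fun t => by simp) g' g _).symm
        · rw [h2', h2]
          have e : revIf r (revIf r' j) = revIf (xor r r') j := by
            cases r <;> cases r' <;> simp [revIf]
          rw [e]
          exact (CubeSym.act_comp _ (fun t => by ring) g' g _).symm }

end ConnectionScheme

/-- The number of connection schemes of type `t`, modulo rotation, reflection and reversal. -/
noncomputable def numSchemes (t : GateType) : ℕ :=
  Nat.card (Quotient (ConnectionScheme.setoid t))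

/-- A scanning order matches a connection scheme if it visits the octants in the order given by the
scheme, and the first and the last cells visited within each octant shrink to the entrance and the
exit gate of that octant in the scheme. -/
def ScanningOrder.Matches {t : GateType} (S : ScanningOrder) (s : ConnectionScheme t) : Prop :=
  ∀ i : Fin 8, (S 1)[(i : ℕ)]? = some (inOctant 0 (s.octant i) fun _ => 0) ∧
    ∀ m, (∃ c, (S (m + 1))[(i : ℕ) * 8 ^ m]? = some c ∧ s.gate i.castSucc ∈ cube (m + 1) c) ∧
      ∃ c, (S (m + 1))[((i : ℕ) + 1) * 8 ^ m - 1]? = some c ∧ s.gate i.succ ∈ cube (m + 1) c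

/-- The number of mono-Hilbert curves, modulo rotation, reflection and reversal, that match a given
connection scheme. -/
noncomputable def ConnectionScheme.numCurves {t : GateType} (s : ConnectionScheme t) : ℕ :=
  Nat.card {q : CurveClass // ∃ C : MonoHilbertCurve, (⟦C⟧ : CurveClass) = q ∧ C.1.Matches s}

end MonoHilbert

/-! The pair of gates of a rule is the unique fixed point of a contraction: the first and the last
octant contain scaled copies of the same pair. Vertex-continuity at all depths is therefore a finite
condition, `Rule.Linked`: the exit gate of each octant is the entrance gate of the next one
(`Rule.vertexContinuous_iff`). Cells that share vertices at every depth shrink to the same point,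
and cells of one grid that contain a common point share a vertex.

Possible gates. The second octant shares both its gates with other octants, so both gates of a curve
lie on the boundary of the cube. Depending on the reversals in the two end octants, and after
reversing the curve if necessary, either one gate satisfies an equation `2 * y = o + g y`, or the
entrance gate satisfies `4 * y = o + g y`, for a symmetry `g` and an octant `o`; the other gate
satisfies an equation of the first kind itself or is obtained from this one by scaling and a
symmetry. Normalise `y` to have increasing coordinates, the first of which is zero. Zeros propagate
along a cycle of the axis permutation, so any other cycle has length at most two and gives
denominators that divide 3, 5, 15 or 17. One further halving can occur, so all candidates lie in the
grid of size 510 = 2 · 3 · 5 · 17. For every candidate pair, a search for walks through distinct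
octants leaves only the six types (`Rule.Linked.isTyped`).

Curves per scheme. A rule fits a scheme iff its motion in each octant carries the gates of the type
to the gates in the scheme. If `n` motions preserve the gates of the type, there are `n ^ 8` such
rules. Two of them define the same order iff in each octant their motions differ by a motion that
fixes the order, and that motion then also fixes the scheme. A motion without reversal that fixes a
scheme fixes all octants and is trivial, so an asymmetric scheme has `n ^ 8` classes of curves. A
symmetric scheme has exactly one nontrivial motion `a` to itself, an involution. The order is
invariant under `a` iff the choices in opposite octants agree up to `a`; this holds for `(2 * n) ^
4` rules, which fall into classes of `2 ^ 8` because each choice may be multiplied by `a`. All other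
rules fall into classes of two, a rule and its reversal. For `n = 4` this gives 16 + 30720.

Number of schemes. Schemes are walks of eight steps in a finite graph of gates and octants and are
counted by evaluation. The motions that preserve the gates act on them, with orbits of `n`
asymmetric or `n / 2` symmetric schemes. As each curve class of a type determines one class of
schemes, `numCurves` is a sum over the classes of schemes. -/

namespace MonoHilbert

/-! ## Computing with points of a finite grid -/

/-- Triples of natural numbers: integer coordinates of the points of a grid. -/
abbrev Trip := ℕ × ℕ × ℕ

/-- The coordinate with index `k` of a triple. -/
def sel (k : ℕ) (t : Trip) : ℕ :=
  Nat.casesOn k t.1 fun k => Nat.casesOn k t.2.1 fun _ => t.2.2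

/-- A symmetry of the cube, given by the values of its permutation and its flips. -/
abbrev SymCode := Trip × (Bool × Bool × Bool)

def permCodes : List Trip :=
  [(0, 1, 2), (0, 2, 1), (1, 0, 2), (1, 2, 0), (2, 0, 1), (2, 1, 0)]

def flipCodes : List (Bool × Bool × Bool) :=
  [false, true].flatMap fun a => [false, true].flatMap fun b => [false, true].map fun c => (a, b, c)

/-- All 48 symmetries of the cube. -/
def symCodes : List SymCode := permCodes.flatMap fun p => flipCodes.map fun f => (p, f)

/-- Reflection of a coordinate in a grid of size `D`. -/
def flipIf (D : ℕ) (f : Bool) (a : ℕ) : ℕ := cond f (Nat.sub D a) a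

/-- The action of a symmetry on the points of a grid of size `D`. -/
def SymCode.apply (D : ℕ) (c : SymCode) (t : Trip) : Trip :=
  (flipIf D c.2.1 (sel c.1.1 t), flipIf D c.2.2.1 (sel c.1.2.1 t),
    flipIf D c.2.2.2 (sel c.1.2.2 t))

/-- A triple of numbers below 4096, as a single number. -/
def pack (t : Trip) : ℕ :=
  Nat.add t.1 (Nat.add (Nat.mul 4096 t.2.1) (Nat.mul 16777216 t.2.2))

def unpack (c : ℕ) : Trip :=
  (Nat.mod c 4096, Nat.mod (Nat.div c 4096) 4096, Nat.div c 16777216)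

/-- The size of the grid that contains all gates that have to be considered. -/
abbrev gridSize : ℕ := 510

/-- The packed images of a pair of points under all symmetries. -/
def images (e x : Trip) : List (ℕ × ℕ) :=
  symCodes.map fun c => (pack (c.apply gridSize e), pack (c.apply gridSize x))

/-- Membership in a list of numbers. -/
noncomputable def memNat (a : ℕ) (l : List ℕ) : Bool :=
  List.rec false (fun b _ ih => Bool.rec ih true (Nat.beq a b)) l

/-- The points that are paired with `u` in the list `ims`, without duplicates. -/
noncomputable def partners (ims : List (ℕ × ℕ)) (u : ℕ) : List ℕ :=
  List.rec [] (fun a _ ih => Bool.rec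
    (Bool.rec ih (Bool.rec (a.1 :: ih) ih (memNat a.1 ih)) (Nat.beq a.2 u))
    (Bool.rec (a.2 :: ih) ih (memNat a.2 ih)) (Nat.beq a.1 u)) ims

/-- The offset of an octant with index `k` in the refined grid, packed. -/
def octOffset (k : ℕ) : ℕ :=
  Nat.mul gridSize (pack (Nat.mod k 2, Nat.mod (Nat.div k 2) 2, Nat.div k 4))

/-- All coordinates of the packed triple are at most `gridSize`. -/
def inGrid (c : ℕ) : Bool :=
  Nat.ble (Nat.mod c 4096) gridSize && (Nat.ble (Nat.mod (Nat.div c 4096) 4096) gridSize &&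
    Nat.ble (Nat.div c 16777216) gridSize)

/-- The octants that contain a point as one gate, with the point that is the other gate. -/
noncomputable def neighbors (ims : List (ℕ × ℕ)) (p : ℕ) : List (ℕ × ℕ) :=
  [0, 1, 2, 3, 4, 5, 6, 7].flatMap fun k =>
    Bool.rec [] ((partners ims (Nat.sub p (octOffset k))).map fun v => (k, Nat.add v (octOffset k)))
      (Nat.ble (octOffset k) p && inGrid (Nat.sub p (octOffset k)))

/-- Search trees of numbers. -/
inductive Tree
  | leaf
  | node (k : ℕ) (l r : Tree)

def Tree.ofList : ℕ → List ℕ → Tree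
  | 0, _ => .leaf
  | n + 1, l => match l.drop (l.length / 2) with
    | [] => .leaf
    | k :: r => .node k (ofList n (l.take (l.length / 2))) (ofList n r)

/-- The function `f`, in a form that makes the evaluation of its values at the nodes of the tree
`t` happen only once. -/
noncomputable def memo {α : Type} (f : ℕ → α) (t : Tree) : ℕ → α := fun p =>
  Tree.rec (f p)
    (fun k _ _ il ir => Bool.rec (Bool.rec ir il (Nat.ble p k)) (f k) (Nat.beq p k)) t

/-- All walks of `n` steps from `p` to a point that satisfies `target`, in which no octant is
visited twice, the octants in `vis` are not visited at all, and the last octant is in `fin`. -/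
noncomputable def walks (ad : ℕ → List (ℕ × ℕ)) (fin : ℕ) (target : ℕ → Bool) (n : ℕ) :
    ℕ → ℕ → List (List (ℕ × ℕ)) :=
  Nat.rec (fun _ p => Bool.rec [] [[]] (target p)) (fun n ih vis p =>
    List.rec [] (fun s _ acc =>
      Bool.rec acc (((ih (Nat.lor vis (Nat.pow 2 s.1)) s.2).map fun w => s :: w) ++ acc)
        (Bool.rec false (Bool.rec
            (Bool.rec true false (Nat.beq (Nat.land fin (Nat.lor vis (Nat.pow 2 s.1))) fin))
            true (Nat.beq n 0))
          (Nat.beq (Nat.land vis (Nat.pow 2 s.1)) 0)))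
      (ad p)) n

/-- The number of walks. -/
noncomputable def walkCount (ad : ℕ → List (ℕ × ℕ)) (fin : ℕ) (target : ℕ → Bool) (n : ℕ) :
    ℕ → ℕ → ℕ :=
  Nat.rec (fun _ p => Bool.rec 0 1 (target p)) (fun n ih vis p =>
    List.rec 0 (fun s _ acc =>
      Bool.rec acc (Nat.add (ih (Nat.lor vis (Nat.pow 2 s.1)) s.2) acc)
        (Bool.rec false (Bool.rec
            (Bool.rec true false (Nat.beq (Nat.land fin (Nat.lor vis (Nat.pow 2 s.1))) fin))
            true (Nat.beq n 0))
          (Nat.beq (Nat.land vis (Nat.pow 2 s.1)) 0)))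
      (ad p)) n

/-- The octants that have the point `x` as a gate. -/
noncomputable def finalOctants (ims : List (ℕ × ℕ)) (x : ℕ) : ℕ :=
  (neighbors ims x).foldr (fun s m => Nat.lor (Nat.pow 2 s.1) m) 0

end MonoHilbert

namespace MonoHilbert

/-! ## The search for pairs of gates -/

/-- The pairs of gates of the six types, in the grid. -/
def GateType.trips : GateType → Trip × Trip
  | A => ((0, 0, 0), (510, 0, 0))
  | B => ((0, 0, 0), (0, 510, 510))
  | C => ((0, 0, 0), (510, 255, 0))
  | D => ((0, 0, 0), (510, 255, 255))
  | E => ((170, 0, 0), (510, 170, 510))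
  | F => ((0, 170, 170), (340, 170, 0))

def typePairs : List (Trip × Trip) :=
  [GateType.A, .B, .C, .D, .E, .F].map GateType.trips

/-- Pairs of points that are not the gates of any curve although walks of length five exist. -/
def spuriousPairs : List (Trip × Trip) :=
  [((0, 0, 0), (0, 0, 255)),
    ((0, 0, 0), (0, 170, 510)),
    ((0, 0, 0), (0, 255, 255)),
    ((0, 0, 0), (0, 340, 510)),
    ((0, 0, 0), (102, 204, 510)),
    ((0, 0, 0), (170, 340, 510)),
    ((0, 0, 0), (204, 408, 510)),
    ((0, 0, 0), (255, 510, 510)),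
    ((0, 0, 0), (306, 408, 510)),
    ((0, 0, 0), (340, 340, 510)),
    ((0, 0, 0), (340, 510, 510)),
    ((0, 0, 85), (170, 510, 0)),
    ((0, 0, 85), (170, 510, 510)),
    ((0, 0, 102), (204, 510, 0)),
    ((0, 0, 102), (204, 510, 510)),
    ((0, 0, 102), (306, 510, 510)),
    ((0, 0, 170), (0, 170, 510)),
    ((0, 0, 170), (85, 255, 510)),
    ((0, 0, 170), (170, 255, 0)),
    ((0, 0, 170), (170, 340, 0)),
    ((0, 0, 170), (255, 340, 0)),
    ((0, 0, 170), (255, 425, 510)),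
    ((0, 0, 170), (340, 510, 510)),
    ((0, 102, 204), (102, 306, 0)),
    ((0, 102, 204), (306, 510, 408)),
    ((0, 170, 170), (170, 340, 510))]

/-- A triple of coordinates in increasing order. -/
def Trip.sorted (t : Trip) : Bool := Nat.ble t.1 t.2.1 && Nat.ble t.2.1 t.2.2

/-- The pair of points `e`, `x`, given as packed triples, is an image of the pair `a`. -/
noncomputable def isImageOf (e x : ℕ) (a : Trip × Trip) : Bool :=
  (images a.1 a.2).any fun b => (Nat.beq b.1 e && Nat.beq b.2 x) || (Nat.beq b.2 e && Nat.beq b.1 x)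

/-- The pair of points is an image of a known pair, or there are no walks of length five. -/
noncomputable def pairOK (e x : Trip) : Bool :=
  (walks (neighbors (images e x)) 255 (fun _ => true) 5 0 (Nat.mul 2 (pack e))).isEmpty ||
    (typePairs ++ spuriousPairs).any (isImageOf (pack e) (pack x))

/-- Points `y` with coordinates in increasing order, the first of which is zero, that satisfy an
equation `2 * y = g y` for a symmetry `g`. -/
def halfFixed : List Trip := [(0, 0, 0), (0, 0, 170), (0, 170, 170), (0, 102, 204)]

/-- Points `y` with coordinates in increasing order, the first of which is zero, that satisfy an
equation `4 * y = o + g y` for a symmetry `g` and an octant `o`. -/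
def quarterFixed : List Trip :=
  [(0, 0, 0), (0, 0, 102), (0, 0, 170), (0, 0, 204), (0, 30, 120), (0, 34, 136), (0, 60, 240),
    (0, 68, 238), (0, 90, 150), (0, 102, 102), (0, 102, 170), (0, 102, 204), (0, 170, 170),
    (0, 170, 204), (0, 180, 210), (0, 204, 204)]

def Trip.beq (s t : Trip) : Bool := Nat.beq s.1 t.1 && (Nat.beq s.2.1 t.2.1 && Nat.beq s.2.2 t.2.2)

/-- The images of a point under the symmetries in a list, without duplicates. -/
noncomputable def orbitOf (t : Trip) (l : List SymCode) : List Trip :=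
  List.rec []
    (fun c _ ih => Bool.rec (c.apply gridSize t :: ih) ih (ih.any (c.apply gridSize t).beq)) l

/-- The images of a point under all symmetries, without duplicates. -/
noncomputable def orbit (t : Trip) : List Trip := orbitOf t symCodes

def Trip.half (t : Trip) : Trip := (Nat.div t.1 2, Nat.div t.2.1 2, Nat.div t.2.2 2)

def Trip.double (t : Trip) : Trip := (Nat.mul t.1 2, Nat.mul t.2.1 2, Nat.mul t.2.2 2)

/-- The case in which neither end octant is reversed: each gate is fixed by a contraction of its
own, so the exit gate is any image of a point of `halfFixed`. -/
noncomputable def checkHalfHalf (v : Trip) : Bool :=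
  halfFixed.all fun w => (orbit w).all fun x => pairOK v x

/-- The case in which only the first octant is reversed: the exit gate `x` is an image of `v`, and
twice the entrance gate is another image `y`. Comparing `y.half.double` with `y` verifies that
halving does not leave the grid. -/
noncomputable def checkDoubleHalf (v : Trip) : Bool :=
  (orbit v).all fun y => !y.sorted ||
    (y.half.double.beq y && (orbit v).all fun x => pairOK y.half x)

/-- The case in which both end octants are reversed: the entrance gate `v` solves the equation with
factor 4, and the exit gate is an image of its double. -/
noncomputable def checkQuarter (v : Trip) : Bool :=
  (orbit v.double).all fun x => pairOK v x

/-- The complete search, through all eight octants and ending in `x`. Doubling a code passes from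
the grid of size 510 to the refined grid of size 1020, which contains the gates of the octants. -/
noncomputable def noWalks (e x : Trip) : Bool :=
  (walks (neighbors (images e x)) (finalOctants (images e x) (Nat.mul 2 (pack x)))
    (Nat.beq (Nat.mul 2 (pack x))) 8 0 (Nat.mul 2 (pack e))).isEmpty

end MonoHilbert

namespace MonoHilbert

/-! ## Motions: symmetries of the cube with an optional reversal -/

namespace CubeSym

theorem ext' {g h : CubeSym} (h1 : ∀ k, g.perm k = h.perm k) (h2 : ∀ k, g.flip k = h.flip k) :
    g = h := by
  cases g
  cases h
  simp only [CubeSym.mk.injEq]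
  exact ⟨Equiv.ext h1, funext h2⟩

instance : Mul CubeSym := ⟨comp⟩
instance : One CubeSym := ⟨one⟩
instance : Inv CubeSym := ⟨inv⟩

instance : Group CubeSym :=
  Group.ofLeftAxioms
    (fun a b c => ext' (fun _ => rfl) fun k => by
      change xor (xor _ _) _ = xor _ (xor _ _)
      rw [Bool.xor_assoc]
      rfl)
    (fun a => ext' (fun _ => rfl) fun k => Bool.false_xor _)
    (fun a => ext' (fun k => a.perm.apply_symm_apply k) fun k => Bool.xor_self _)

theorem mul_act {α : Type} {refl : α → α} (hr : ∀ t, refl (refl t) = t) (g h : CubeSym)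
    (x : Fin 3 → α) : (g * h).act refl x = g.act refl (h.act refl x) :=
  act_comp refl hr g h x

theorem one_act {α : Type} (refl : α → α) (x : Fin 3 → α) : (1 : CubeSym).act refl x = x :=
  act_one refl x

theorem mul_onPoint (g h : CubeSym) (x : Fin 3 → ℝ) :
    (g * h).onPoint x = g.onPoint (h.onPoint x) :=
  mul_act (fun t => by ring) g h x

theorem one_onPoint (x : Fin 3 → ℝ) : (1 : CubeSym).onPoint x = x := one_act _ x

theorem mul_onOctant (g h : CubeSym) (x : Octant) :
    (g * h).onOctant x = g.onOctant (h.onOctant x) :=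
  mul_act (fun t => by simp) g h x

theorem one_onOctant (x : Octant) : (1 : CubeSym).onOctant x = x := one_act _ x

theorem mul_onCell (m : ℕ) (g h : CubeSym) (x : Fin 3 → ℤ) :
    (g * h).onCell m x = g.onCell m (h.onCell m x) :=
  mul_act (fun t => by ring) g h x

theorem one_onCell (m : ℕ) (x : Fin 3 → ℤ) : (1 : CubeSym).onCell m x = x := one_act _ x

theorem onPoint_injective (g : CubeSym) : Function.Injective g.onPoint := fun x y h => by
  have := congrArg g⁻¹.onPoint h
  simpa only [← mul_onPoint, inv_mul_cancel, one_onPoint] using this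

/-- The action on the octants, as a permutation. -/
def octantEquiv (g : CubeSym) : Octant ≃ Octant where
  toFun := g.onOctant
  invFun := g⁻¹.onOctant
  left_inv x := by rw [← mul_onOctant, inv_mul_cancel, one_onOctant]
  right_inv x := by rw [← mul_onOctant, mul_inv_cancel, one_onOctant]

/-- A symmetry that fixes all octants is the identity. -/
theorem eq_one_of_onOctant {g : CubeSym} (h : ∀ o, g.onOctant o = o) : g = 1 := by
  have hf : ∀ k, g.flip k = false := fun k => by
    have := congrFun (h fun _ => false) k
    simpa [onOctant, act] using this
  refine ext' (fun k => ?_) hf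
  have := congrFun (h fun j => decide (j = k)) k
  simp only [onOctant, act, hf, Bool.false_eq_true, if_false, decide_true,
    decide_eq_true_eq] at this
  exact this

end CubeSym

/-- A symmetry of the cube with an optional reversal of the order. -/
@[ext]
structure Motion where
  sym : CubeSym
  rev : Bool

namespace Motion

instance : Mul Motion := ⟨fun a b => ⟨a.sym * b.sym, xor a.rev b.rev⟩⟩
instance : One Motion := ⟨⟨1, false⟩⟩
instance : Inv Motion := ⟨fun a => ⟨a.sym⁻¹, a.rev⟩⟩

@[simp] theorem mul_sym (a b : Motion) : (a * b).sym = a.sym * b.sym := rfl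
@[simp] theorem mul_rev (a b : Motion) : (a * b).rev = xor a.rev b.rev := rfl
@[simp] theorem one_sym : (1 : Motion).sym = 1 := rfl
@[simp] theorem one_rev : (1 : Motion).rev = false := rfl
@[simp] theorem inv_sym (a : Motion) : (a⁻¹).sym = a.sym⁻¹ := rfl
@[simp] theorem inv_rev (a : Motion) : (a⁻¹).rev = a.rev := rfl

instance : Group Motion :=
  Group.ofLeftAxioms
    (fun a b c => Motion.ext (by simp [mul_assoc]) (by simp))
    (fun a => Motion.ext (by simp) (by simp))
    (fun a => Motion.ext (by simp) (by simp))

/-- The action on the orders of the cells of the grid of depth `m`. -/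
def onList (τ : Motion) (m : ℕ) (l : List (Fin 3 → ℤ)) : List (Fin 3 → ℤ) :=
  (reverseIf τ.rev l).map (τ.sym.onCell m)

theorem mul_onList (a b : Motion) (m : ℕ) (l : List (Fin 3 → ℤ)) :
    (a * b).onList m l = a.onList m (b.onList m l) := by
  have e : CubeSym.onCell m (a.sym * b.sym) = CubeSym.onCell m a.sym ∘ CubeSym.onCell m b.sym :=
    funext fun c => CubeSym.mul_onCell m _ _ c
  cases h1 : a.rev <;> cases h2 : b.rev <;> simp [onList, reverseIf, h1, h2, e]

theorem one_onList (m : ℕ) (l : List (Fin 3 → ℤ)) : (1 : Motion).onList m l = l := by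
  have e : CubeSym.onCell m 1 = id := funext fun c => CubeSym.one_onCell m c
  simp [onList, reverseIf, e]

theorem onList_length (τ : Motion) (m : ℕ) (l : List (Fin 3 → ℤ)) :
    (τ.onList m l).length = l.length := by
  cases h : τ.rev <;> simp [onList, reverseIf, h]

/-- The action on scanning orders. -/
def onOrder (τ : Motion) (S : ScanningOrder) : ScanningOrder := fun m => τ.onList m (S m)

theorem mul_onOrder (a b : Motion) (S : ScanningOrder) :
    (a * b).onOrder S = a.onOrder (b.onOrder S) := funext fun m => mul_onList a b m (S m)

theorem one_onOrder (S : ScanningOrder) : (1 : Motion).onOrder S = S :=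
  funext fun m => one_onList m (S m)

theorem inv_onOrder_onOrder (τ : Motion) (S : ScanningOrder) : τ⁻¹.onOrder (τ.onOrder S) = S := by
  rw [← mul_onOrder, inv_mul_cancel, one_onOrder]

end Motion

theorem revIf_revIf {n : ℕ} (r s : Bool) (i : Fin n) : revIf r (revIf s i) = revIf (xor s r) i := by
  cases r <;> cases s <;> simp [revIf]

theorem revIf_self {n : ℕ} (r : Bool) (i : Fin n) : revIf r (revIf r i) = i := by
  cases r <;> simp [revIf]

def revIfEquiv {n : ℕ} (r : Bool) : Fin n ≃ Fin n where
  toFun := revIf r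
  invFun := revIf r
  left_inv := revIf_self r
  right_inv := revIf_self r

/-! ### Rules: their blocks, their ambiguity, and conjugation by motions -/

namespace Rule

/-- The motion with which a rule is applied in its octant with index `i`. -/
def motion (R : Rule) (i : Fin 8) : Motion := ⟨R.sym i, R.rev i⟩

theorem ext' {R R' : Rule} (h1 : ∀ i, R.octant i = R'.octant i)
    (h2 : ∀ i, R.motion i = R'.motion i) : R = R' := by
  cases R
  cases R'
  simp only [Rule.mk.injEq]
  exact ⟨Equiv.ext h1, funext fun i => congrArg Motion.sym (h2 i),
    funext fun i => congrArg Motion.rev (h2 i)⟩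

/-- The part of the order defined by a rule that lies in the octant with index `i`. -/
def block (R : Rule) (m : ℕ) (i : Fin 8) : List (Fin 3 → ℤ) :=
  ((R.motion i).onList m (R.order m)).map (inOctant m (R.octant i))

theorem order_succ (R : Rule) (m : ℕ) :
    R.order (m + 1) = (List.finRange 8).flatMap (R.block m) := by
  rw [order]
  congr 1
  funext i
  simp [block, Motion.onList, motion, Function.comp_def]

theorem length_order (R : Rule) (m : ℕ) : (R.order m).length = 8 ^ m := by
  induction m with
  | zero => rfl
  | succ m ih =>
    rw [order_succ, List.length_flatMap]
    simp [block, Motion.onList_length, ih]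
    ring

theorem length_block (R : Rule) (m : ℕ) (i : Fin 8) : (R.block m i).length = 8 ^ m := by
  simp [block, Motion.onList_length, length_order]

end Rule

theorem getElem?_flatMap_finRange {α : Type} {N : ℕ} {n : ℕ} (f : Fin n → List α)
    (hf : ∀ i, (f i).length = N) (i : Fin n) {j : ℕ} (hj : j < N) :
    ((List.finRange n).flatMap f)[(i : ℕ) * N + j]? = (f i)[j]? := by
  induction n with
  | zero => exact i.elim0
  | succ n ih =>
    rw [List.finRange_succ, List.flatMap_cons, List.flatMap_map]
    refine Fin.cases ?_ (fun i => ?_) i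
    · rw [List.getElem?_append_left (by simpa [hf] using hj)]
      simp
    · rw [List.getElem?_append_right (by simp [hf, Nat.succ_mul]; omega)]
      rw [← ih (fun i => f i.succ) (fun i => hf _) i, hf]
      congr 1
      simp [Nat.succ_mul]
      omega

theorem flatMap_finRange_injective {α : Type} {N : ℕ} {n : ℕ} {f g : Fin n → List α}
    (hf : ∀ i, (f i).length = N) (hg : ∀ i, (g i).length = N)
    (h : (List.finRange n).flatMap f = (List.finRange n).flatMap g) (i : Fin n) : f i = g i := by
  apply List.ext_getElem?
  intro j
  by_cases hj : j < N
  · rw [← getElem?_flatMap_finRange f hf i hj, h, getElem?_flatMap_finRange g hg i hj]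
  · rw [List.getElem?_eq_none (by rw [hf]; omega), List.getElem?_eq_none (by rw [hg]; omega)]

theorem inOctant_injective (m : ℕ) (o : Octant) : Function.Injective (inOctant m o) := by
  intro c d h
  funext k
  have := congrFun h k
  simpa [inOctant] using this

theorem inOctant_zero_injective {o o' : Octant}
    (h : inOctant 0 o (fun _ => 0) = inOctant 0 o' fun _ => 0) : o = o' := by
  funext k
  have := congrFun h k
  cases h1 : o k <;> cases h2 : o' k <;> simp [inOctant, h1, h2] at this ⊢

namespace Rule

theorem block_zero (R : Rule) (i : Fin 8) : R.block 0 i = [inOctant 0 (R.octant i) fun _ => 0] := by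
  have : CubeSym.onCell 0 (R.sym i) (fun _ => 0) = fun _ => 0 := by
    funext k
    simp [CubeSym.onCell, CubeSym.act]
  cases h : R.rev i <;> simp [block, Motion.onList, motion, order, reverseIf, h, this]

theorem octant_eq_of_order_eq {R R' : Rule} (h : R.order = R'.order) : R.octant = R'.octant := by
  refine Equiv.ext fun i => inOctant_zero_injective ?_
  have h1 := congrFun h 1
  rw [order_succ, order_succ] at h1
  have := flatMap_finRange_injective (length_block R 0) (length_block R' 0) h1 i
  simpa [block_zero] using this

/-- All blocks have length `8 ^ m`, so equal orders are equal block by block. Only the effect of the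
motions on the order is determined, not the motions themselves; this is how different rules can
define one curve. -/
theorem motion_onOrder_eq_of_order_eq {R R' : Rule} (h : R.order = R'.order) (i : Fin 8) :
    (R.motion i).onOrder R.order = (R'.motion i).onOrder R.order := by
  funext m
  have h1 := congrFun h (m + 1)
  rw [order_succ, order_succ] at h1
  have := flatMap_finRange_injective (length_block R m) (length_block R' m) h1 i
  rw [block, block, octant_eq_of_order_eq h] at this
  have := List.map_injective_iff.2 (inOctant_injective m _) this
  rw [← h] at this
  exact this

/-- Induction on the depth: the induction hypothesis replaces the order of `R'` in each block by
that of `R`, on which the two motions agree. -/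
theorem order_eq_of_motion_onOrder_eq {R R' : Rule} (ho : R.octant = R'.octant)
    (h : ∀ i, (R.motion i).onOrder R.order = (R'.motion i).onOrder R.order) :
    R.order = R'.order := by
  funext m
  induction m with
  | zero => rfl
  | succ m ih =>
    rw [order_succ, order_succ]
    congr 1
    funext i
    rw [block, block, ho, ← ih]
    congr 1
    exact congrFun (h i) m

/-- The rule, rotated or reflected and possibly reversed. -/
def move (τ : Motion) (R : Rule) : Rule where
  octant := (revIfEquiv τ.rev).trans (R.octant.trans τ.sym.octantEquiv)
  sym i := τ.sym * R.sym (revIf τ.rev i) * τ.sym⁻¹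
  rev i := R.rev (revIf τ.rev i)

theorem move_octant (τ : Motion) (R : Rule) (i : Fin 8) :
    (R.move τ).octant i = τ.sym.onOctant (R.octant (revIf τ.rev i)) := rfl

theorem move_motion (τ : Motion) (R : Rule) (i : Fin 8) :
    (R.move τ).motion i = τ * R.motion (revIf τ.rev i) * τ⁻¹ := by
  refine Motion.ext rfl ?_
  cases h : τ.rev <;> simp [motion, move, h]

end Rule

theorem onCell_inOctant (g : CubeSym) (m : ℕ) (o : Octant) (c : Fin 3 → ℤ) :
    g.onCell (m + 1) (inOctant m o c) = inOctant m (g.onOctant o) (g.onCell m c) := by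
  funext k
  cases h1 : g.flip k <;> cases h2 : o (g.perm k) <;>
    simp [CubeSym.onCell, CubeSym.onOctant, CubeSym.act, inOctant, h1, h2, pow_succ] <;> ring

theorem reverseIf_flatMap_finRange {n : ℕ} (r : Bool) (f : Fin n → List (Fin 3 → ℤ)) :
    reverseIf r ((List.finRange n).flatMap f) =
      (List.finRange n).flatMap fun i => reverseIf r (f (revIf r i)) := by
  cases r
  · simp [reverseIf, revIf]
  · simp [reverseIf, revIf, List.reverse_flatMap, List.finRange_reverse, List.flatMap_map,
      Function.comp_def]

/-- The conjugating factor `τ⁻¹` undoes the motion that the induction hypothesis puts on the smaller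
order, and the other factor `τ` moves the block as a whole. Hence transformed curves are again
defined by a rule. -/
theorem Rule.order_move (τ : Motion) (R : Rule) : (R.move τ).order = τ.onOrder R.order := by
  funext m
  induction m with
  | zero =>
    have : CubeSym.onCell 0 τ.sym (fun _ => 0) = fun _ => 0 := by
      funext k
      simp [CubeSym.onCell, CubeSym.act]
    cases h : τ.rev <;> simp [Motion.onOrder, Motion.onList, order, reverseIf, h, this]
  | succ m ih =>
    rw [order_succ, Motion.onOrder, order_succ, Motion.onList, reverseIf_flatMap_finRange,
      List.map_flatMap]
    congr 1
    funext i
    rw [block, ih, move_motion, Motion.onOrder, Motion.mul_onList, ← Motion.mul_onList τ⁻¹,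
      inv_mul_cancel, Motion.one_onList, Motion.mul_onList, move_octant]
    rw [block]
    generalize (R.motion (revIf τ.rev i)).onList m (R.order m) = l
    have e : inOctant m (τ.sym.onOctant (R.octant (revIf τ.rev i))) ∘ τ.sym.onCell m =
        τ.sym.onCell (m + 1) ∘ inOctant m (R.octant (revIf τ.rev i)) :=
      funext fun c => (onCell_inOctant _ _ _ _).symm
    cases h : τ.rev <;> rw [h] at e <;> simp_all [Motion.onList, reverseIf]

end MonoHilbert

namespace MonoHilbert

/-! ## Gates -/

/-- An entrance gate (at `false`) and an exit gate (at `true`). -/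
abbrev GatePair := Bool → Fin 3 → ℝ

namespace Motion

/-- The action on pairs of gates. -/
noncomputable def onGates (τ : Motion) (w : GatePair) : GatePair :=
  fun b => τ.sym.onPoint (w (xor b τ.rev))

theorem mul_onGates (a b : Motion) (w : GatePair) :
    (a * b).onGates w = a.onGates (b.onGates w) := by
  funext c
  simp [onGates, CubeSym.mul_onPoint]

theorem one_onGates (w : GatePair) : (1 : Motion).onGates w = w := by
  funext c
  simp [onGates, CubeSym.one_onPoint]

theorem inv_onGates_onGates (τ : Motion) (w : GatePair) : τ⁻¹.onGates (τ.onGates w) = w := by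
  rw [← mul_onGates, inv_mul_cancel, one_onGates]

end Motion

/-! ### Points, cells and common vertices -/

theorem abs_onPoint_sub (g : CubeSym) (x y : Fin 3 → ℝ) (k : Fin 3) :
    |g.onPoint x k - g.onPoint y k| = |x (g.perm k) - y (g.perm k)| := by
  cases h : g.flip k
  · simp [CubeSym.onPoint, CubeSym.act, h]
  · simp only [CubeSym.onPoint, CubeSym.act, h, if_true]
    rw [abs_sub_comm]
    congr 1
    ring

theorem scaleTo_sub (o : Octant) (x y : Fin 3 → ℝ) (k : Fin 3) :
    scaleTo o x k - scaleTo o y k = (x k - y k) / 2 := by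
  simp only [scaleTo]
  ring

theorem scaleTo_injective (o : Octant) : Function.Injective (scaleTo o) := fun x y h => by
  funext k
  have := congrFun h k
  simp only [scaleTo] at this
  linarith

theorem onPoint_scaleTo (g : CubeSym) (o : Octant) (x : Fin 3 → ℝ) :
    g.onPoint (scaleTo o x) = scaleTo (g.onOctant o) (g.onPoint x) := by
  funext k
  cases h1 : g.flip k <;> cases h2 : o (g.perm k) <;>
    simp [CubeSym.onPoint, CubeSym.onOctant, CubeSym.act, scaleTo, h1, h2] <;> ring

theorem scaleTo_mem_cube {m : ℕ} {c : Fin 3 → ℤ} {x : Fin 3 → ℝ} (o : Octant)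
    (h : x ∈ cube m c) : scaleTo o x ∈ cube (m + 1) (inOctant m o c) := by
  intro k
  obtain ⟨h1, h2⟩ := h k
  have hp : (0 : ℝ) < 2 ^ m := by positivity
  rw [div_le_iff₀ hp] at h1
  rw [le_div_iff₀ hp] at h2
  rw [div_le_iff₀ (by positivity), le_div_iff₀ (by positivity), pow_succ]
  cases h3 : o k <;> simp only [inOctant, scaleTo, h3, Bool.false_eq_true, if_true, if_false] <;>
    push_cast <;> constructor <;> nlinarith

theorem onPoint_mem_cube {m : ℕ} {c : Fin 3 → ℤ} {x : Fin 3 → ℝ} (g : CubeSym)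
    (h : x ∈ cube m c) : g.onPoint x ∈ cube m (g.onCell m c) := by
  intro k
  obtain ⟨h1, h2⟩ := h (g.perm k)
  have hp : (0 : ℝ) < 2 ^ m := by positivity
  rw [div_le_iff₀ hp] at h1
  rw [le_div_iff₀ hp] at h2
  rw [div_le_iff₀ hp, le_div_iff₀ hp]
  cases h3 : g.flip k <;>
    simp only [CubeSym.onPoint, CubeSym.onCell, CubeSym.act, h3, Bool.false_eq_true, if_true,
      if_false] <;>
    push_cast <;> constructor <;> nlinarith

/-- Two cells of edge `2⁻⁽ᵐ⁺¹⁾` with a common vertex span at most twice this length in each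
direction, so the coordinates differ by at most `2⁻ᵐ` for every `m`. -/
theorem eq_of_shareVertex {x y : Fin 3 → ℝ}
    (h : ∀ m, ∃ c d, ShareVertex c d ∧ x ∈ cube (m + 1) c ∧ y ∈ cube (m + 1) d) : x = y := by
  funext k
  have key : ∀ m : ℕ, |x k - y k| ≤ (1 / 2) ^ m := by
    intro m
    obtain ⟨c, d, ⟨v, hv, hv'⟩, hx, hy⟩ := h m
    obtain ⟨h1, h2⟩ := hx k
    obtain ⟨h3, h4⟩ := hy k
    have hp : (0 : ℝ) < 2 ^ (m + 1) := by positivity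
    rw [div_le_iff₀ hp] at h1 h3
    rw [le_div_iff₀ hp] at h2 h4
    have h5 : (c k : ℝ) ≤ d k + 1 ∧ (d k : ℝ) ≤ c k + 1 := by
      have : c k ≤ d k + 1 ∧ d k ≤ c k + 1 := by
        rcases hv k with h | h <;> rcases hv' k with h' | h' <;> omega
      exact_mod_cast this
    rw [one_div, inv_pow, ← one_div, abs_le, le_div_iff₀ (by positivity), neg_le_iff_add_nonneg,
      ← sub_nonneg]
    have hp' : (0 : ℝ) < 2 ^ m := by positivity
    rw [pow_succ] at h1 h2 h3 h4
    constructor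
    · have : 0 ≤ (x k - y k + 1 / 2 ^ m) * 2 ^ m := by
        rw [add_mul, div_mul_cancel₀ _ hp'.ne']
        linarith
      have := nonneg_of_mul_nonneg_left this hp'
      linarith
    · linarith
  have h0 : |x k - y k| ≤ 0 := ge_of_tendsto'
    (tendsto_pow_atTop_nhds_zero_of_lt_one (by norm_num) (by norm_num : (1 / 2 : ℝ) < 1)) key
  have := abs_nonpos_iff.1 h0
  linarith

theorem ShareVertex.refl (c : Fin 3 → ℤ) : ShareVertex c c :=
  ⟨c, fun _ => Or.inl rfl, fun _ => Or.inl rfl⟩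

theorem ShareVertex.symm {c d : Fin 3 → ℤ} (h : ShareVertex c d) : ShareVertex d c :=
  let ⟨v, h1, h2⟩ := h
  ⟨v, h2, h1⟩

/-- A common point forces the integer coordinates to differ by at most one; then the coordinatewise
maximum is a vertex of both cells. -/
theorem shareVertex_of_mem_cube {m : ℕ} {c d : Fin 3 → ℤ} {x : Fin 3 → ℝ} (hc : x ∈ cube m c)
    (hd : x ∈ cube m d) : ShareVertex c d := by
  have key : ∀ k, c k ≤ d k + 1 ∧ d k ≤ c k + 1 := by
    intro k
    obtain ⟨h1, h2⟩ := hc k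
    obtain ⟨h3, h4⟩ := hd k
    have hp : (0 : ℝ) < 2 ^ m := by positivity
    have h5 := (div_le_div_iff_of_pos_right hp).1 (h1.trans h4)
    have h6 := (div_le_div_iff_of_pos_right hp).1 (h3.trans h2)
    exact ⟨by exact_mod_cast h5, by exact_mod_cast h6⟩
  refine ⟨fun k => max (c k) (d k), fun k => ?_, fun k => ?_⟩ <;>
    have := key k <;> beta_reduce <;> omega

theorem ShareVertex.onCell {c d : Fin 3 → ℤ} (h : ShareVertex c d) (m : ℕ) (g : CubeSym) :
    ShareVertex (g.onCell m c) (g.onCell m d) := by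
  obtain ⟨v, hc, hd⟩ := h
  refine ⟨fun k => if g.flip k then 2 ^ m - v (g.perm k) else v (g.perm k), fun k => ?_,
    fun k => ?_⟩
  · have := hc (g.perm k)
    cases h : g.flip k <;>
      simp only [CubeSym.onCell, CubeSym.act, h, Bool.false_eq_true, if_true, if_false] <;> omega
  · have := hd (g.perm k)
    cases h : g.flip k <;>
      simp only [CubeSym.onCell, CubeSym.act, h, Bool.false_eq_true, if_true, if_false] <;> omega

theorem ShareVertex.inOctant {c d : Fin 3 → ℤ} (h : ShareVertex c d) (m : ℕ) (o : Octant) :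
    ShareVertex (inOctant m o c) (inOctant m o d) := by
  obtain ⟨v, hc, hd⟩ := h
  refine ⟨MonoHilbert.inOctant m o v, fun k => ?_, fun k => ?_⟩
  · have := hc k
    simp only [MonoHilbert.inOctant]
    omega
  · have := hd k
    simp only [MonoHilbert.inOctant]
    omega

/-! ### The gates of a rule, and vertex-continuity as a condition on gates -/

namespace Rule

/-- The index of the first (last) octant. -/
def endIndex (b : Bool) : Fin 8 := if b then 7 else 0

theorem revIf_endIndex (r b : Bool) : revIf r (endIndex b) = endIndex (xor b r) := by
  cases r <;> cases b <;> rfl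

/-- The pair of gates of a rule is a fixed point of this map. -/
noncomputable def gateMap (R : Rule) (w : GatePair) : GatePair :=
  fun b => scaleTo (R.octant (endIndex b)) ((R.motion (endIndex b)).onGates w b)

/-- In the maximum metric, symmetries preserve distances, a reversal only selects the other point of
the pair, and the scaling to an octant halves distances. -/
theorem contractingWith_gateMap (R : Rule) : ContractingWith (1 / 2) R.gateMap := by
  refine ⟨?_, LipschitzWith.of_dist_le_mul fun v w => ?_⟩
  · rw [← NNReal.coe_lt_coe]
    norm_num
  · rw [dist_pi_le_iff (by positivity)]
    intro b
    rw [dist_pi_le_iff (by positivity)]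
    intro k
    rw [Real.dist_eq, gateMap, gateMap, scaleTo_sub, abs_div, Motion.onGates, Motion.onGates,
      abs_onPoint_sub, ← Real.dist_eq]
    have h1 := dist_le_pi_dist (v (xor b (R.motion (endIndex b)).rev))
      (w (xor b (R.motion (endIndex b)).rev)) ((R.motion (endIndex b)).sym.perm k)
    have h2 := dist_le_pi_dist v w (xor b (R.motion (endIndex b)).rev)
    have h3 : ((1 / 2 : NNReal) : ℝ) = 1 / 2 := by simp
    rw [h3, abs_two]
    linarith

/-- The pair of gates of a rule. -/
noncomputable def gates (R : Rule) : GatePair := R.contractingWith_gateMap.fixedPoint _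

theorem gateMap_gates (R : Rule) : R.gateMap R.gates = R.gates :=
  R.contractingWith_gateMap.fixedPoint_isFixedPt

theorem eq_gates {R : Rule} {w : GatePair} (h : R.gateMap w = w) : w = R.gates :=
  R.contractingWith_gateMap.fixedPoint_unique h

/-- The gates of the octant with index `i`. -/
noncomputable def gate (R : Rule) (i : Fin 8) (b : Bool) : Fin 3 → ℝ :=
  scaleTo (R.octant i) ((R.motion i).onGates R.gates b)

theorem gates_eq (R : Rule) (b : Bool) : R.gates b = R.gate (endIndex b) b :=
  (congrFun R.gateMap_gates b).symm

/-- The largest distance `d` of one of the six coordinates to 1/2 satisfies `d ≤ 1/4 + d/2` by the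
fixed point equation, hence `d ≤ 1/2`. -/
theorem gates_mem_Icc (R : Rule) (b : Bool) (k : Fin 3) : 0 ≤ R.gates b k ∧ R.gates b k ≤ 1 := by
  obtain ⟨p, hp⟩ := Finite.exists_max fun p : Bool × Fin 3 => |R.gates p.1 p.2 - 1 / 2|
  have h1 : |R.gates p.1 p.2 - 1 / 2| ≤ 1 / 4 + |R.gates p.1 p.2 - 1 / 2| / 2 := by
    set i := endIndex p.1
    have h2 := hp (xor p.1 (R.motion i).rev, (R.motion i).sym.perm p.2)
    simp only at h2
    have h3 : R.gates p.1 p.2 = scaleTo (R.octant i) ((R.motion i).onGates R.gates p.1) p.2 :=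
      congrFun (congrFun R.gateMap_gates p.1).symm p.2
    have h4 : |R.gates p.1 p.2 - 1 / 2| ≤ 1 / 4 +
        |R.gates (xor p.1 (R.motion i).rev) ((R.motion i).sym.perm p.2) - 1 / 2| / 2 := by
      rw [h3]
      simp only [scaleTo, Motion.onGates, CubeSym.onPoint, CubeSym.act]
      generalize R.gates (xor p.1 (R.motion i).rev) ((R.motion i).sym.perm p.2) = t
      rw [abs_le]
      have := neg_abs_le (t - 1 / 2)
      have := le_abs_self (t - 1 / 2)
      split_ifs <;> constructor <;> linarith
    linarith
  have h2 := (hp (b, k)).trans (by linarith : _ ≤ (1 / 2 : ℝ))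
  rw [abs_le] at h2
  simp only at h2
  constructor <;> linarith

/-- The first (last) element of a list. -/
def endOf (b : Bool) (l : List (Fin 3 → ℤ)) : Option (Fin 3 → ℤ) :=
  if b then l.getLast? else l.head?

theorem endOf_map (b : Bool) (f : (Fin 3 → ℤ) → Fin 3 → ℤ) (l : List (Fin 3 → ℤ)) :
    endOf b (l.map f) = (endOf b l).map f := by
  cases b <;> simp [endOf]

theorem endOf_reverseIf (b r : Bool) (l : List (Fin 3 → ℤ)) :
    endOf b (reverseIf r l) = endOf (xor b r) l := by
  cases b <;> cases r <;> simp [endOf, reverseIf]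

theorem getElem?_order (R : Rule) (m : ℕ) (i : Fin 8) (b : Bool) :
    (R.order (m + 1))[if b then ((i : ℕ) + 1) * 8 ^ m - 1 else (i : ℕ) * 8 ^ m]? =
      endOf b (R.block m i) := by
  have hp : 0 < 8 ^ m := by positivity
  rw [order_succ]
  cases b
  · have := getElem?_flatMap_finRange (R.block m) (R.length_block m) i (j := 0) hp
    simpa [endOf, List.head?_eq_getElem?] using this
  · have := getElem?_flatMap_finRange (R.block m) (R.length_block m) i (j := 8 ^ m - 1) (by omega)
    have e : ((i : ℕ) + 1) * 8 ^ m - 1 = (i : ℕ) * 8 ^ m + (8 ^ m - 1) := by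
      rw [Nat.succ_mul]
      omega
    simpa [endOf, List.getLast?_eq_getElem?, length_block, e] using this

theorem endOf_order_succ (R : Rule) (m : ℕ) (b : Bool) :
    endOf b (R.order (m + 1)) = endOf b (R.block m (endIndex b)) := by
  rw [← getElem?_order]
  cases b
  · simp [endOf, endIndex, List.head?_eq_getElem?]
  · simp [endOf, endIndex, List.getLast?_eq_getElem?, length_order, pow_succ, mul_comm]

/-- A reversed block ends where the smaller order begins, so the hypothesis is needed for both ends
at once. -/
theorem exists_endOf_block {R : Rule} {m : ℕ}
    (h : ∀ b, ∃ c, endOf b (R.order m) = some c ∧ R.gates b ∈ cube m c) (i : Fin 8) (b : Bool) :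
    ∃ c, endOf b (R.block m i) = some c ∧ R.gate i b ∈ cube (m + 1) c := by
  obtain ⟨c, h1, h2⟩ := h (xor b (R.motion i).rev)
  refine ⟨inOctant m (R.octant i) ((R.motion i).sym.onCell m c), ?_, ?_⟩
  · rw [block, endOf_map, Motion.onList, endOf_map, endOf_reverseIf, h1]
    rfl
  · exact scaleTo_mem_cube _ (onPoint_mem_cube _ h2)

theorem exists_endOf_order (R : Rule) (m : ℕ) (b : Bool) :
    ∃ c, endOf b (R.order m) = some c ∧ R.gates b ∈ cube m c := by
  induction m generalizing b with
  | zero =>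
    refine ⟨fun _ => 0, by cases b <;> rfl, fun k => ?_⟩
    have := R.gates_mem_Icc b k
    simpa using this
  | succ m ih =>
    rw [endOf_order_succ, gates_eq]
    exact exists_endOf_block ih _ b

theorem exists_getElem?_order (R : Rule) (m : ℕ) (i : Fin 8) (b : Bool) :
    ∃ c, (R.order (m + 1))[if b then ((i : ℕ) + 1) * 8 ^ m - 1 else (i : ℕ) * 8 ^ m]? = some c ∧
      R.gate i b ∈ cube (m + 1) c := by
  rw [getElem?_order]
  exact exists_endOf_block (R.exists_endOf_order m) i b

/-- At every depth `x` and the gate lie in the same cell, so they coincide. -/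
theorem eq_gate {R : Rule} {i : Fin 8} {b : Bool} {x : Fin 3 → ℝ}
    (h : ∀ m, ∃ c, (R.order (m + 1))[if b then ((i : ℕ) + 1) * 8 ^ m - 1 else (i : ℕ) * 8 ^ m]? =
      some c ∧ x ∈ cube (m + 1) c) : x = R.gate i b := by
  refine eq_of_shareVertex fun m => ?_
  obtain ⟨c, h1, h2⟩ := h m
  obtain ⟨d, h3, h4⟩ := R.exists_getElem?_order m i b
  rw [h1, Option.some_inj] at h3
  exact ⟨c, d, h3 ▸ ShareVertex.refl c, h2, h4⟩

theorem gate_eq_of_order_eq {R R' : Rule} (h : R.order = R'.order) (i : Fin 8) (b : Bool) :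
    R.gate i b = R'.gate i b := by
  refine eq_gate fun m => ?_
  rw [← h]
  exact R.exists_getElem?_order m i b

theorem gates_eq_of_order_eq {R R' : Rule} (h : R.order = R'.order) : R.gates = R'.gates := by
  funext b
  rw [gates_eq, gates_eq, gate_eq_of_order_eq h]

theorem isGate_iff (R : Rule) (b : Bool) (x : Fin 3 → ℝ) :
    (∀ m, ∃ c, endOf b (R.order m) = some c ∧ x ∈ cube m c) ↔ R.gates b = x := by
  constructor
  · intro h
    refine eq_of_shareVertex fun m => ?_
    obtain ⟨c, h1, h2⟩ := h (m + 1)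
    obtain ⟨d, h3, h4⟩ := R.exists_endOf_order (m + 1) b
    rw [h1, Option.some_inj] at h3
    exact ⟨d, c, h3 ▸ ShareVertex.refl c, h4, h2⟩
  · rintro rfl m
    exact R.exists_endOf_order m b

theorem isEntranceGate_iff (R : Rule) (x : Fin 3 → ℝ) :
    R.order.IsEntranceGate x ↔ R.gates false = x := R.isGate_iff false x

theorem isExitGate_iff (R : Rule) (x : Fin 3 → ℝ) :
    R.order.IsExitGate x ↔ R.gates true = x := R.isGate_iff true x

/-- The transformed pair solves the fixed point equation of the conjugated rule, and that solution
is unique. -/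
theorem gates_move (τ : Motion) (R : Rule) : (R.move τ).gates = τ.onGates R.gates := by
  refine (eq_gates ?_).symm
  funext b
  rw [gateMap, move_motion, Motion.mul_onGates, Motion.inv_onGates_onGates, Motion.mul_onGates,
    move_octant, revIf_endIndex]
  change scaleTo _ (τ.sym.onPoint _) = τ.sym.onPoint (R.gates (xor b τ.rev))
  rw [← onPoint_scaleTo, gates_eq, gate]

theorem gate_move (τ : Motion) (R : Rule) (i : Fin 8) (b : Bool) :
    (R.move τ).gate i b = τ.sym.onPoint (R.gate (revIf τ.rev i) (xor b τ.rev)) := by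
  rw [gate, move_motion, gates_move, Motion.mul_onGates, Motion.inv_onGates_onGates,
    Motion.mul_onGates, move_octant]
  change scaleTo _ (τ.sym.onPoint _) = _
  rw [← onPoint_scaleTo, gate]

/-- The gates of consecutive octants coincide. -/
def Linked (R : Rule) : Prop := ∀ i : Fin 7, R.gate i.castSucc true = R.gate i.succ false

theorem isChain_block {R : Rule} {m : ℕ} (h : (R.order m).IsChain ShareVertex) (i : Fin 8) :
    (R.block m i).IsChain ShareVertex := by
  have h1 : (reverseIf (R.motion i).rev (R.order m)).IsChain ShareVertex := by
    cases (R.motion i).rev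
    · exact h
    · simp only [reverseIf, if_true, List.isChain_reverse]
      exact h.imp fun _ _ h => h.symm
  rw [block, Motion.onList, List.isChain_map, List.isChain_map]
  exact h1.imp fun _ _ h => (h.onCell _ _).inOctant _ _

/-- Forward: the last cells in one octant and the first cells in the next are consecutive at every
depth, so the points to which they shrink agree. Backward: by induction on the depth, blocks are
images of a continuous order, and at a transition the two cells contain the common gate. -/
theorem vertexContinuous_iff (R : Rule) : R.order.VertexContinuous ↔ R.Linked := by
  constructor
  · intro h i
    refine eq_of_shareVertex fun m => ?_
    obtain ⟨c, h1, h2⟩ := R.exists_getElem?_order m i.castSucc true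
    obtain ⟨d, h3, h4⟩ := R.exists_getElem?_order m i.succ false
    refine ⟨c, d, ?_, h2, h4⟩
    have hp : 0 < 8 ^ m := by positivity
    simp only [if_true, Bool.false_eq_true, if_false, Fin.val_castSucc, Fin.val_succ] at h1 h3
    obtain ⟨h5, rfl⟩ := List.getElem?_eq_some_iff.1 h1
    obtain ⟨h6, rfl⟩ := List.getElem?_eq_some_iff.1 h3
    -- The last position of block `i`; its successor is the first position of block `i + 1`.
    have h7 := List.isChain_iff_getElem.1 (h (m + 1)) (((i : ℕ) + 1) * 8 ^ m - 1)
    have e : ((i : ℕ) + 1) * 8 ^ m - 1 + 1 = ((i : ℕ) + 1) * 8 ^ m :=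
      Nat.sub_add_cancel (Nat.mul_pos (Nat.succ_pos _) hp)
    simp only [e] at h7
    exact h7 h6
  · intro h m
    induction m with
    | zero => simp [order]
    | succ m ih =>
      rw [order_succ, List.flatMap_def, List.isChain_flatten]
      · refine ⟨fun l hl => ?_, ?_⟩
        · obtain ⟨i, -, rfl⟩ := List.mem_map.1 hl
          exact isChain_block ih i
        · rw [List.isChain_map]
          have h8 : (List.finRange 8).IsChain
              fun i j => ∃ k : Fin 7, i = k.castSucc ∧ j = k.succ := by decide
          refine h8.imp ?_
          rintro _ _ ⟨k, rfl, rfl⟩ x hx y hy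
          obtain ⟨c, h1, h2⟩ := exists_endOf_block (R.exists_endOf_order m) k.castSucc true
          obtain ⟨d, h3, h4⟩ := exists_endOf_block (R.exists_endOf_order m) k.succ false
          simp only [endOf, if_true, Bool.false_eq_true, if_false] at h1 h3
          rw [h1] at hx
          rw [h3] at hy
          cases hx
          cases hy
          rw [h] at h2
          exact shareVertex_of_mem_cube h2 h4
      -- The criterion for a concatenation to be a chain requires that no block is empty.
      · intro hl
        obtain ⟨i, -, hi⟩ := List.mem_map.1 hl
        have := R.length_block m i
        rw [hi] at this
        have hp : 0 < 8 ^ m := by positivity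
        simp at this
        omega

theorem linked_move {R : Rule} (h : R.Linked) (τ : Motion) : (R.move τ).Linked := by
  intro i
  rw [gate_move, gate_move]
  congr 1
  cases hr : τ.rev
  · exact h i
  · have := h i.rev
    simp only [revIf, if_true, Fin.rev_castSucc, Fin.rev_succ, Bool.xor_true, Bool.not_true,
      Bool.not_false]
    exact this.symm

end Rule

namespace ConnectionScheme

/-- The gates of the octant with index `i`. -/
def ends {t : GateType} (s : ConnectionScheme t) (i : Fin 8) (b : Bool) : Fin 3 → ℝ :=
  s.gate (if b then i.succ else i.castSucc)

end ConnectionScheme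

theorem Rule.matches_iff {t : GateType} (R : Rule) (s : ConnectionScheme t) :
    R.order.Matches s ↔ (∀ i, R.octant i = s.octant i) ∧ ∀ i b, R.gate i b = s.ends i b := by
  have h0 : ∀ i : Fin 8, (R.order 1)[(i : ℕ)]? = some (inOctant 0 (R.octant i) fun _ => 0) := by
    intro i
    have := R.getElem?_order 0 i false
    simpa [block_zero, endOf] using this
  constructor
  · refine fun h => ⟨fun i => ?_, fun i b => ?_⟩
    · have := (h i).1
      rw [h0, Option.some_inj] at this
      exact inOctant_zero_injective this
    · refine (eq_gate fun m => ?_).symm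
      cases b
      · exact ((h i).2 m).1
      · exact ((h i).2 m).2
  · rintro ⟨h1, h2⟩ i
    refine ⟨by rw [h0, h1], fun m => ⟨?_, ?_⟩⟩
    · have := R.exists_getElem?_order m i false
      rw [h2] at this
      exact this
    · have := R.exists_getElem?_order m i true
      rw [h2] at this
      exact this

end MonoHilbert

namespace MonoHilbert

/-! ## Rules and connection schemes -/

/-- The pair of gates of a type. -/
noncomputable def GateType.gates (t : GateType) : GatePair :=
  fun b => if b then t.exit else t.entrance

/-- The motions that preserve the pair of gates of a type. -/
noncomputable def GateType.stabilizer (t : GateType) : Subgroup Motion where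
  carrier := {τ | τ.onGates t.gates = t.gates}
  mul_mem' {a b} ha hb := by
    simp only [Set.mem_ofPred_eq] at *
    rw [Motion.mul_onGates, hb, ha]
  one_mem' := Motion.one_onGates _
  inv_mem' {a} ha := by
    simp only [Set.mem_ofPred_eq] at *
    nth_rewrite 1 [← ha]
    exact Motion.inv_onGates_onGates _ _

theorem GateType.mem_stabilizer {t : GateType} {τ : Motion} :
    τ ∈ t.stabilizer ↔ τ.onGates t.gates = t.gates := Iff.rfl

/-- The gate that precedes (follows) the octant with index `i`. -/
def gateIndex (i : Fin 8) (b : Bool) : Fin 9 := if b then i.succ else i.castSucc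

/-- A reversal turns the gate before an octant into the gate after the opposite octant, which is why
the side `b` flips together with the index. -/
theorem revIf_gateIndex (r : Bool) (i : Fin 8) (b : Bool) :
    revIf r (gateIndex i b) = gateIndex (revIf r i) (xor b r) := by
  cases r <;> cases b <;> simp [revIf, gateIndex, Fin.rev_castSucc, Fin.rev_succ]

theorem exists_gateIndex (j : Fin 9) : ∃ i b, j = gateIndex i b := by
  refine Fin.lastCases ⟨7, true, rfl⟩ (fun i => ⟨i, false, rfl⟩) j

namespace ConnectionScheme

variable {t : GateType}

theorem ends_eq (s : ConnectionScheme t) (i : Fin 8) (b : Bool) :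
    s.ends i b = s.gate (gateIndex i b) := rfl

theorem ends_endIndex (s : ConnectionScheme t) (b : Bool) :
    s.ends (Rule.endIndex b) b = t.gates b := by
  cases b
  · exact s.gate_first
  · exact s.gate_last

theorem exists_motion (s : ConnectionScheme t) (i : Fin 8) :
    ∃ τ : Motion, ∀ b, scaleTo (s.octant i) (τ.onGates t.gates b) = s.ends i b := by
  obtain ⟨g, ⟨h1, h2⟩ | ⟨h1, h2⟩⟩ := s.link i
  · refine ⟨⟨g, false⟩, fun b => ?_⟩
    cases b
    · exact h1.symm
    · exact h2.symm
  · refine ⟨⟨g, true⟩, fun b => ?_⟩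
    cases b
    · exact h1.symm
    · exact h2.symm

theorem ext' {s s' : ConnectionScheme t} (h1 : ∀ i, s.octant i = s'.octant i)
    (h2 : ∀ j, s.gate j = s'.gate j) : s = s' := by
  cases s
  cases s'
  simp only [ConnectionScheme.mk.injEq]
  exact ⟨Equiv.ext h1, funext h2⟩

/-- The scheme `s'` is the image of `s` under a motion. -/
def MapsTo (τ : Motion) (s s' : ConnectionScheme t) : Prop := IsImage τ.sym τ.rev s s'

theorem MapsTo.ends {τ : Motion} {s s' : ConnectionScheme t} (h : MapsTo τ s s') (i : Fin 8)
    (b : Bool) : s'.ends i b = τ.sym.onPoint (s.ends (revIf τ.rev i) (xor b τ.rev)) := by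
  rw [ends_eq, h.2, revIf_gateIndex, ends_eq]

theorem mapsTo_of_ends {τ : Motion} {s s' : ConnectionScheme t}
    (h1 : ∀ i, s'.octant i = τ.sym.onOctant (s.octant (revIf τ.rev i)))
    (h2 : ∀ i b, s'.ends i b = τ.sym.onPoint (s.ends (revIf τ.rev i) (xor b τ.rev))) :
    MapsTo τ s s' := by
  refine ⟨h1, fun j => ?_⟩
  obtain ⟨i, b, rfl⟩ := exists_gateIndex j
  rw [revIf_gateIndex]
  exact h2 i b

/-- Both schemes start and end at the gates that are prescribed by the type. -/
theorem MapsTo.mem_stabilizer {τ : Motion} {s s' : ConnectionScheme t} (h : MapsTo τ s s') :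
    τ ∈ t.stabilizer := by
  funext b
  rw [← ends_endIndex s', h.ends, Rule.revIf_endIndex, ends_endIndex]
  rfl

theorem MapsTo.mul {a b : Motion} {s s' s'' : ConnectionScheme t} (h : MapsTo a s s')
    (h' : MapsTo b s' s'') : MapsTo (b * a) s s'' := by
  refine mapsTo_of_ends (fun i => ?_) fun i c => ?_
  · rw [h'.1, h.1, revIf_revIf, Motion.mul_sym, CubeSym.mul_onOctant]
    rfl
  · rw [h'.ends, h.ends, revIf_revIf, Motion.mul_sym, CubeSym.mul_onPoint, Motion.mul_rev,
      Bool.xor_assoc]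

theorem MapsTo.inv {a : Motion} {s s' : ConnectionScheme t} (h : MapsTo a s s') :
    MapsTo a⁻¹ s' s := by
  refine mapsTo_of_ends (fun i => ?_) fun i c => ?_
  · rw [h.1, Motion.inv_rev, revIf_self, ← CubeSym.mul_onOctant, Motion.inv_sym, inv_mul_cancel,
      CubeSym.one_onOctant]
  · rw [h.ends, Motion.inv_rev, revIf_self, ← CubeSym.mul_onPoint, Motion.inv_sym, inv_mul_cancel,
      CubeSym.one_onPoint, Bool.xor_assoc, Bool.xor_self, Bool.xor_false]

/-- Without reversal each octant of the scheme stays in its place, and all eight octants occur, so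
the symmetry fixes every octant. -/
theorem MapsTo.eq_one {τ : Motion} {s : ConnectionScheme t} (h : MapsTo τ s s)
    (hr : τ.rev = false) : τ = 1 := by
  refine Motion.ext (CubeSym.eq_one_of_onOctant fun o => ?_) hr
  have := h.1 (s.octant.symm o)
  simp only [hr, revIf, Bool.false_eq_true, if_false, Equiv.apply_symm_apply] at this
  exact this.symm

theorem MapsTo.unique {a b : Motion} {s s' : ConnectionScheme t} (ha : MapsTo a s s')
    (hb : MapsTo b s s') (hr : a.rev = b.rev) : a = b := by
  have := (ha.mul hb.inv).eq_one (by simp [hr])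
  rw [inv_mul_eq_one] at this
  exact this.symm

/-- The image of a scheme under a motion that preserves the gates of its type. -/
noncomputable def move (s : ConnectionScheme t) (τ : t.stabilizer) : ConnectionScheme t where
  octant := (revIfEquiv τ.1.rev).trans (s.octant.trans τ.1.sym.octantEquiv)
  gate j := τ.1.sym.onPoint (s.gate (revIf τ.1.rev j))
  gate_first := by
    have h1 := congrFun τ.2 false
    have h2 := s.ends_endIndex (xor false τ.1.rev)
    rw [← Rule.revIf_endIndex, ends_eq, ← revIf_gateIndex] at h2
    change τ.1.sym.onPoint (s.gate (revIf τ.1.rev (gateIndex (Rule.endIndex false) false))) = _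
    rw [h2]
    exact h1
  gate_last := by
    have h1 := congrFun τ.2 true
    have h2 := s.ends_endIndex (xor true τ.1.rev)
    rw [← Rule.revIf_endIndex, ends_eq, ← revIf_gateIndex] at h2
    change τ.1.sym.onPoint (s.gate (revIf τ.1.rev (gateIndex (Rule.endIndex true) true))) = _
    rw [h2]
    exact h1
  link i := by
    have key : ∀ b, τ.1.sym.onPoint (s.gate (revIf τ.1.rev (gateIndex i b))) =
        τ.1.sym.onPoint (s.ends (revIf τ.1.rev i) (xor b τ.1.rev)) := fun b => by
      rw [revIf_gateIndex]
      rfl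
    obtain ⟨σ, hσ⟩ := s.exists_motion (revIf τ.1.rev i)
    have key' : ∀ b, τ.1.sym.onPoint (s.gate (revIf τ.1.rev (gateIndex i b))) =
        scaleTo (τ.1.sym.onOctant (s.octant (revIf τ.1.rev i)))
          ((τ.1 * σ).sym.onPoint (t.gates (xor (xor b τ.1.rev) σ.rev))) := fun b => by
      rw [key, ← hσ, onPoint_scaleTo, Motion.mul_sym, CubeSym.mul_onPoint]
      rfl
    refine ⟨(τ.1 * σ).sym, ?_⟩
    have h1 := key' false
    have h2 := key' true
    cases h3 : xor τ.1.rev σ.rev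
    · refine Or.inl ⟨?_, ?_⟩
      · rw [Bool.false_xor, h3] at h1
        exact h1
      · rw [Bool.xor_assoc, h3] at h2
        exact h2
    · refine Or.inr ⟨?_, ?_⟩
      · rw [Bool.false_xor, h3] at h1
        exact h1
      · rw [Bool.xor_assoc, h3] at h2
        exact h2

theorem mapsTo_move (s : ConnectionScheme t) (τ : t.stabilizer) : MapsTo τ.1 s (s.move τ) :=
  ⟨fun _ => rfl, fun _ => rfl⟩

theorem mapsTo_iff {s s' : ConnectionScheme t} {τ : t.stabilizer} :
    MapsTo τ.1 s s' ↔ s.move τ = s' := by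
  constructor
  · exact fun h => ext' (fun i => (h.1 i).symm) fun j => (h.2 j).symm
  · rintro rfl
    exact mapsTo_move s τ

/-- A rule fits a scheme if it has the same octants with the same gates. -/
def Fits (s : ConnectionScheme t) (R : Rule) : Prop :=
  (∀ i, R.octant i = s.octant i) ∧ ∀ i b, R.gate i b = s.ends i b

theorem Fits.gates {s : ConnectionScheme t} {R : Rule} (h : s.Fits R) : R.gates = t.gates := by
  funext b
  rw [Rule.gates_eq, h.2, ends_endIndex]

/-- Replaces the gates of `R`, which depend on its motions, by the fixed gates of the type. In the
backward direction the gates of the type solve the fixed point equation of `R`, so by uniqueness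
they are its gates. The motions in different octants can thus be chosen independently. -/
theorem fits_iff {s : ConnectionScheme t} {R : Rule} : s.Fits R ↔ (∀ i, R.octant i = s.octant i) ∧
    ∀ i b, scaleTo (s.octant i) ((R.motion i).onGates t.gates b) = s.ends i b := by
  constructor
  · refine fun h => ⟨h.1, fun i b => ?_⟩
    rw [← h.gates, ← h.1, ← h.2]
    rfl
  · rintro ⟨h1, h2⟩
    have h3 : t.gates = R.gates := by
      refine Rule.eq_gates ?_
      funext b
      rw [Rule.gateMap, h1, h2, ends_endIndex]
    refine ⟨h1, fun i b => ?_⟩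
    rw [Rule.gate, ← h3, h1, h2]

theorem Fits.linked {s : ConnectionScheme t} {R : Rule} (h : s.Fits R) : R.Linked := fun i => by
  rw [h.2, h.2]
  rfl

theorem Fits.move {s s' : ConnectionScheme t} {R : Rule} (h : s.Fits R) {τ : Motion}
    (hτ : MapsTo τ s s') : s'.Fits (R.move τ) := by
  refine ⟨fun i => ?_, fun i b => ?_⟩
  · rw [Rule.move_octant, h.1, hτ.1]
  · rw [Rule.gate_move, h.2, hτ.ends]

/-- An order determines its octants and gates, so a motion between curves is also a motion between
their schemes. -/
theorem Fits.mapsTo {s s' : ConnectionScheme t} {R R' : Rule} (h : s.Fits R) (h' : s'.Fits R')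
    {τ : Motion} (hR : R'.order = τ.onOrder R.order) : MapsTo τ s s' := by
  rw [← Rule.order_move] at hR
  refine mapsTo_of_ends (fun i => ?_) fun i b => ?_
  · rw [← h'.1, Rule.octant_eq_of_order_eq hR, Rule.move_octant, h.1]
  · rw [← h'.2, Rule.gate_eq_of_order_eq hR, Rule.gate_move, h.2]

end ConnectionScheme

/-- The curve that is defined by a rule. -/
def Rule.curve (R : Rule) (h : R.Linked) : MonoHilbertCurve :=
  ⟨R.order, ⟨R, rfl⟩, R.vertexContinuous_iff.2 h⟩

theorem exists_curve_eq (C : MonoHilbertCurve) : ∃ (R : Rule) (h : R.Linked), C = R.curve h := by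
  obtain ⟨S, ⟨R, rfl⟩, h⟩ := C
  exact ⟨R, R.vertexContinuous_iff.1 h, rfl⟩

theorem mk_curve_eq_iff {R R' : Rule} {h : R.Linked} {h' : R'.Linked} :
    (⟦R.curve h⟧ : CurveClass) = ⟦R'.curve h'⟧ ↔ ∃ τ : Motion, R'.order = τ.onOrder R.order := by
  rw [Quotient.eq]
  constructor
  · rintro ⟨g, r, h⟩
    exact ⟨⟨g, r⟩, h⟩
  · rintro ⟨τ, h⟩
    exact ⟨τ.sym, τ.rev, h⟩

/-! ## Counting curves that match a scheme -/

/-- The elements with property `p` form a union of fibres of `f`, each of size `a`. -/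
theorem card_image_mul {X Q : Type} [Finite X] (f : X → Q) (p : X → Prop) (a : ℕ)
    (h : ∀ x, p x → Nat.card {y // f y = f x} = a) (hp : ∀ x y, p x → f y = f x → p y) :
    Nat.card {q // ∃ x, p x ∧ f x = q} * a = Nat.card {x // p x} := by
  let F : {x // p x} → {q // ∃ x, p x ∧ f x = q} := fun x => ⟨f x.1, x.1, x.2, rfl⟩
  have hF : Function.Surjective F := by
    rintro ⟨_, x, hx, rfl⟩
    exact ⟨⟨x, hx⟩, rfl⟩
  have : Finite {q // ∃ x, p x ∧ f x = q} := Finite.of_surjective F hF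
  cases nonempty_fintype {q // ∃ x, p x ∧ f x = q}
  rw [← Nat.card_congr (Equiv.sigmaFiberEquiv F), Nat.card_sigma]
  rw [Finset.sum_congr rfl (g := fun _ => a)]
  · simp
  · rintro ⟨_, x, hx, rfl⟩ -
    rw [← h x hx]
    exact Nat.card_congr
      { toFun := fun y => ⟨y.1.1, congrArg Subtype.val y.2⟩
        invFun := fun y => ⟨⟨y.1, hp x y.1 hx y.2⟩, Subtype.ext y.2⟩
        left_inv := fun _ => rfl
        right_inv := fun _ => rfl }

namespace ConnectionScheme

variable {t : GateType}

/-- The rule with the octants of the scheme and with given motions. -/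
def rule (s : ConnectionScheme t) (β : Fin 8 → Motion) (h : Fin 8 → t.stabilizer) : Rule where
  octant := s.octant
  sym i := (β i * (h i).1).sym
  rev i := (β i * (h i).1).rev

theorem rule_motion (s : ConnectionScheme t) (β : Fin 8 → Motion) (h : Fin 8 → t.stabilizer)
    (i : Fin 8) : (s.rule β h).motion i = β i * (h i).1 := rfl

/-- Motions of the cube to the octants that map the gates to the gates in the scheme. -/
def IsBase (s : ConnectionScheme t) (β : Fin 8 → Motion) : Prop :=
  ∀ i b, scaleTo (s.octant i) ((β i).onGates t.gates b) = s.ends i b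

theorem exists_isBase (s : ConnectionScheme t) : ∃ β, s.IsBase β :=
  ⟨fun i => (s.exists_motion i).choose, fun i => (s.exists_motion i).choose_spec⟩

variable {s : ConnectionScheme t} {β : Fin 8 → Motion}

theorem IsBase.fits (hβ : s.IsBase β) (h : Fin 8 → t.stabilizer) : s.Fits (s.rule β h) := by
  refine fits_iff.2 ⟨fun i => rfl, fun i b => ?_⟩
  rw [rule_motion, Motion.mul_onGates, (h i).2, hβ]

/-- Two motions with the same effect on the gates of the type differ by right multiplication with an
element of the stabilizer. The fitting rules are thus parametrised by eight elements of it. -/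
theorem IsBase.exists_rule (hβ : s.IsBase β) {R : Rule} (hR : s.Fits R) :
    ∃ h, R = s.rule β h := by
  have h1 := fits_iff.1 hR
  have h2 : ∀ i, (β i)⁻¹ * R.motion i ∈ t.stabilizer := fun i => by
    rw [GateType.mem_stabilizer, Motion.mul_onGates]
    have : (R.motion i).onGates t.gates = (β i).onGates t.gates :=
      funext fun b => scaleTo_injective (s.octant i) (by rw [h1.2, hβ])
    rw [this, Motion.inv_onGates_onGates]
  refine ⟨fun i => ⟨_, h2 i⟩, Rule.ext' h1.1 fun i => ?_⟩
  rw [rule_motion, mul_inv_cancel_left]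

/-- The class of the curve defined by a rule that fits the scheme. -/
def IsBase.curveClass (hβ : s.IsBase β) (h : Fin 8 → t.stabilizer) : CurveClass :=
  ⟦(s.rule β h).curve (hβ.fits h).linked⟧

theorem IsBase.numCurves_eq (hβ : s.IsBase β) :
    s.numCurves = Nat.card {q // ∃ h, hβ.curveClass h = q} := by
  refine Nat.card_congr (Equiv.subtypeEquivRight fun q => ?_)
  constructor
  · rintro ⟨C, rfl, hC⟩
    obtain ⟨R, hR, rfl⟩ := exists_curve_eq C
    obtain ⟨h, rfl⟩ := hβ.exists_rule ((R.matches_iff s).1 hC)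
    exact ⟨h, rfl⟩
  · rintro ⟨h, rfl⟩
    exact ⟨_, rfl, (Rule.matches_iff _ s).2 (hβ.fits h)⟩

theorem IsBase.mapsTo_of_fixes (hβ : s.IsBase β) {h : Fin 8 → t.stabilizer} {τ : Motion}
    (hτ : τ.onOrder (s.rule β h).order = (s.rule β h).order) : MapsTo τ s s :=
  (hβ.fits h).mapsTo (hβ.fits h) hτ.symm

/-- The common factor `β i` cancels, so ambiguity comes only from motions that fix the order. -/
theorem rule_order_eq_iff (h h' : Fin 8 → t.stabilizer) :
    (s.rule β h).order = (s.rule β h').order ↔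
      ∀ i, ((h i)⁻¹ * h' i).1.onOrder (s.rule β h).order = (s.rule β h).order := by
  have key : ∀ i, ((s.rule β h).motion i).onOrder (s.rule β h).order =
      ((s.rule β h').motion i).onOrder (s.rule β h).order ↔
      ((h i)⁻¹ * h' i).1.onOrder (s.rule β h).order = (s.rule β h).order := by
    intro i
    rw [rule_motion, rule_motion, Subgroup.coe_mul, Subgroup.coe_inv, Motion.mul_onOrder,
      Motion.mul_onOrder, Motion.mul_onOrder]
    constructor
    · intro e
      have := congrArg (β i)⁻¹.onOrder e
      rw [Motion.inv_onOrder_onOrder, Motion.inv_onOrder_onOrder] at this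
      rw [← this, Motion.inv_onOrder_onOrder]
    · intro e
      have := congrArg (h i).1.onOrder e
      rw [← Motion.mul_onOrder, mul_inv_cancel, Motion.one_onOrder] at this
      rw [this]
  constructor
  · exact fun e i => (key i).1 (Rule.motion_onOrder_eq_of_order_eq e i)
  · exact fun e => Rule.order_eq_of_motion_onOrder_eq rfl fun i => (key i).2 (e i)

/-- Only the identity maps the scheme to itself, so neither a motion between curves nor an ambiguity
of the rule can identify two different choices. -/
theorem numCurves_of_not_isSymmetric (hs : ¬ s.IsSymmetric) :
    s.numCurves = Nat.card t.stabilizer ^ 8 := by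
  obtain ⟨β, hβ⟩ := s.exists_isBase
  have h1 : ∀ τ, MapsTo τ s s → τ = 1 := fun τ hτ => by
    refine hτ.eq_one ?_
    cases h : τ.rev
    · rfl
    · refine absurd ⟨τ.sym, ?_⟩ hs
      rw [← h]
      exact hτ
  have hinj : Function.Injective hβ.curveClass := fun h h' e => by
    obtain ⟨τ, hτ⟩ := mk_curve_eq_iff.1 e
    have := h1 τ ((hβ.fits h).mapsTo (hβ.fits h') hτ)
    rw [this, Motion.one_onOrder] at hτ
    funext i
    have h2 := h1 _ (hβ.mapsTo_of_fixes ((rule_order_eq_iff h h').1 hτ.symm i))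
    have h3 : (h i)⁻¹ * h' i = 1 := Subtype.ext h2
    exact inv_mul_eq_one.1 h3
  have h4 : Nat.card {q // ∃ h, hβ.curveClass h = q} = Nat.card (Fin 8 → t.stabilizer) :=
    (Nat.card_congr (Equiv.ofInjective _ hinj)).symm
  rw [hβ.numCurves_eq, h4, Nat.card_fun]
  simp

end ConnectionScheme

end MonoHilbert

namespace MonoHilbert

/-! ## Counting curves that match a symmetric scheme -/

/-- Functions on eight points as functions with values in pairs on four points. -/
def foldEquiv (α : Type) : (Fin 8 → α) ≃ (Fin 4 → α × α) where
  toFun h i := (h (i.castAdd 4), h (i.castAdd 4).rev)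
  invFun p j := if hj : (j : ℕ) < 4 then (p ⟨j, hj⟩).1 else (p ⟨7 - j, by omega⟩).2
  left_inv h := by
    funext j
    by_cases hj : (j : ℕ) < 4
    · simp only [hj, dif_pos]
      rfl
    · simp only [hj, dif_neg, not_false_eq_true]
      congr 1
      ext
      simp [Fin.val_rev]
      omega
  right_inv p := by
    funext i
    have h1 : ((i.castAdd 4 : Fin 8) : ℕ) < 4 := by simp
    have h2 : ¬ ((i.castAdd 4).rev : ℕ) < 4 := by
      rw [Fin.val_rev]
      simp
      omega
    simp only [h1, h2, dif_pos, dif_neg, not_false_eq_true]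
    refine Prod.ext rfl ?_
    simp only
    congr 2
    ext
    simp [Fin.val_rev]
    omega

theorem card_pair_eq_two {G : Type} [Group G] {a : G} (ha : a ≠ 1) (x : G) :
    Nat.card {y : G // x⁻¹ * y = 1 ∨ x⁻¹ * y = a} = 2 := by
  have : {y : G | x⁻¹ * y = 1 ∨ x⁻¹ * y = a} = {x, x * a} := by
    ext y
    rw [Set.mem_insert_iff, Set.mem_singleton_iff, Set.mem_ofPred_eq, inv_mul_eq_one,
      inv_mul_eq_iff_eq_mul, eq_comm]
  have h2 : Set.ncard {y : G | x⁻¹ * y = 1 ∨ x⁻¹ * y = a} = 2 := by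
    rw [this]
    exact Set.ncard_pair fun h => ha (by simpa using h)
  exact h2

/-- Functions to a group that are symmetric under reversal, up to right multiplication with `a`. -/
def SymmetricUpTo {G : Type} [Group G] (a : G) (h : Fin 8 → G) : Prop :=
  ∀ i, (h i)⁻¹ * h i.rev = 1 ∨ (h i)⁻¹ * h i.rev = a

/-- Since `a` is its own inverse, the conditions at `i` and at `i.rev` are equivalent. Each of the
four pairs of opposite indices has a free first value and two choices for the second. -/
theorem card_symmetricUpTo {G : Type} [Group G] [Finite G] {a : G} (ha : a ≠ 1) (ha2 : a * a = 1) :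
    Nat.card {h : Fin 8 → G // SymmetricUpTo a h} = (Nat.card G * 2) ^ 4 := by
  have hinv : a⁻¹ = a := inv_eq_of_mul_eq_one_left ha2
  have key : ∀ h : Fin 8 → G, SymmetricUpTo a h ↔ ∀ i : Fin 4,
      ((foldEquiv G h i).1)⁻¹ * (foldEquiv G h i).2 = 1 ∨
        ((foldEquiv G h i).1)⁻¹ * (foldEquiv G h i).2 = a := by
    intro h
    refine ⟨fun H i => H (i.castAdd 4), fun H j => ?_⟩
    by_cases hj : (j : ℕ) < 4
    · exact H ⟨j, hj⟩
    · have h1 := H ⟨7 - j, by omega⟩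
      have e : (Fin.castAdd 4 ⟨7 - (j : ℕ), by omega⟩ : Fin 8) = j.rev := by
        ext
        simp [Fin.val_rev]
      simp only [foldEquiv, Equiv.coe_fn_mk, e, Fin.rev_rev] at h1
      rcases h1 with h1 | h1
      · left
        rw [← inv_inj, mul_inv_rev, inv_inv, h1, inv_one]
      · right
        rw [← inv_inj, mul_inv_rev, inv_inv, h1, hinv]
  rw [Nat.card_congr ((foldEquiv G).subtypeEquiv (q := fun p => ∀ i : Fin 4,
      ((p i).1)⁻¹ * (p i).2 = 1 ∨ ((p i).1)⁻¹ * (p i).2 = a) key)]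
  rw [Nat.card_congr (Equiv.subtypePiEquivPi
    (p := fun (_ : Fin 4) (x : G × G) => x.1⁻¹ * x.2 = 1 ∨ x.1⁻¹ * x.2 = a))]
  rw [Nat.card_pi]
  have h2 : Nat.card {x : G × G // x.1⁻¹ * x.2 = 1 ∨ x.1⁻¹ * x.2 = a} = Nat.card G * 2 := by
    cases nonempty_fintype G
    rw [Nat.card_congr (Equiv.subtypeProdEquivSigmaSubtype
      fun x y : G => x⁻¹ * y = 1 ∨ x⁻¹ * y = a), Nat.card_sigma]
    simp only [card_pair_eq_two ha, Finset.sum_const, Finset.card_univ, smul_eq_mul,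
      Nat.card_eq_fintype_card]
  simp [h2]

namespace ConnectionScheme

variable {t : GateType} {s : ConnectionScheme t} {β : Fin 8 → Motion} {a : t.stabilizer}

theorem MapsTo.rev_eq_true (h : MapsTo a.1 s s) (ha : a ≠ 1) : a.1.rev = true := by
  by_contra h1
  exact ha (Subtype.ext (h.eq_one (by simpa using h1)))

theorem MapsTo.mul_self (h : MapsTo a.1 s s) : a * a = 1 :=
  Subtype.ext ((h.mul h).eq_one (by simp))

/-- A motion of a scheme to itself is determined by whether it reverses, and `a` does reverse. -/
theorem MapsTo.eq_or_eq (h : MapsTo a.1 s s) (ha : a ≠ 1) {b : t.stabilizer}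
    (hb : MapsTo b.1 s s) : b = 1 ∨ b = a := by
  cases h1 : b.1.rev
  · exact Or.inl (Subtype.ext (hb.eq_one h1))
  · exact Or.inr (Subtype.ext (hb.unique h (by rw [h1, h.rev_eq_true ha])))

/-- Motions from the cube to the octants that are compatible with a symmetry of the scheme. -/
structure IsSymmetricBase (s : ConnectionScheme t) (β : Fin 8 → Motion) (a : t.stabilizer) :
    Prop where
  isBase : s.IsBase β
  mapsTo : MapsTo a.1 s s
  ne_one : a ≠ 1
  mul_base : ∀ i, a.1 * β i.rev = β i

/-- Base motions are chosen freely in the first four octants and transported to the last four by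
`a`; the equation holds on both halves because `a` is an involution. -/
theorem exists_isSymmetricBase (h : MapsTo a.1 s s) (ha : a ≠ 1) :
    ∃ β, s.IsSymmetricBase β a := by
  obtain ⟨β, hβ⟩ := s.exists_isBase
  have hr := h.rev_eq_true ha
  refine ⟨fun i => if (i : ℕ) < 4 then β i else a.1 * β i.rev, fun i b => ?_, h, ha, fun i => ?_⟩
  · split_ifs with hi
    · exact hβ i b
    · have h1 := h.1 i
      rw [hr] at h1
      have h2 := h.ends i b
      rw [hr] at h2
      rw [h1, h2, Motion.mul_onGates]
      change scaleTo _ (a.1.sym.onPoint ((β i.rev).onGates t.gates (xor b a.1.rev))) = _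
      rw [← onPoint_scaleTo, hr]
      congr 1
      exact hβ i.rev (xor b true)
  · have e : ((i.rev : Fin 8) : ℕ) = 7 - i := by
      rw [Fin.val_rev]
      omega
    by_cases hi : (i : ℕ) < 4
    · rw [if_pos hi, if_neg (by omega), Fin.rev_rev, ← mul_assoc]
      have := congrArg Subtype.val h.mul_self
      rw [Subgroup.coe_mul, Subgroup.coe_one] at this
      rw [this, one_mul]
    · rw [if_neg hi, if_pos (by omega)]

/-- The rule for the reversed curve. -/
noncomputable def star (a : t.stabilizer) (h : Fin 8 → t.stabilizer) : Fin 8 → t.stabilizer :=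
  fun i => h i.rev * a

namespace IsSymmetricBase

variable (H : s.IsSymmetricBase β a)

include H

theorem star_star (h : Fin 8 → t.stabilizer) : star a (star a h) = h := by
  funext i
  simp [star, mul_assoc, H.mapsTo.mul_self]

/-- With the symmetric base, `β i * h i.rev * a = a * (β i.rev * h i.rev) * a⁻¹`. -/
theorem rule_star (h : Fin 8 → t.stabilizer) : s.rule β (star a h) = (s.rule β h).move a.1 := by
  have hr := H.mapsTo.rev_eq_true H.ne_one
  have hinv : a.1⁻¹ = a.1 := inv_eq_of_mul_eq_one_left (congrArg Subtype.val H.mapsTo.mul_self)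
  refine Rule.ext' (fun i => ?_) fun i => ?_
  · exact H.mapsTo.1 i
  · rw [Rule.move_motion, rule_motion, rule_motion, hr, hinv, star, ← H.mul_base i]
    simp [revIf, mul_assoc]

theorem order_star (h : Fin 8 → t.stabilizer) :
    (s.rule β (star a h)).order = a.1.onOrder (s.rule β h).order := by
  rw [H.rule_star, Rule.order_move]

/-- If the order is invariant, then `h` and `star a h` define the same order, so they differ in each
octant by 1 or `a`. Conversely, if the smaller order is invariant, multiplying `h i` by `a` does not
change its block, so invariance passes to the next depth. -/
theorem onOrder_eq_iff (h : Fin 8 → t.stabilizer) :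
    a.1.onOrder (s.rule β h).order = (s.rule β h).order ↔ SymmetricUpTo a h := by
  constructor
  · intro e i
    rw [← H.order_star] at e
    have h1 := H.isBase.mapsTo_of_fixes ((rule_order_eq_iff h (star a h)).1 e.symm i)
    have ha2 := H.mapsTo.mul_self
    rcases H.mapsTo.eq_or_eq H.ne_one h1 with h2 | h2
    · right
      rw [star, ← mul_assoc] at h2
      rw [eq_inv_of_mul_eq_one_left h2, inv_eq_of_mul_eq_one_left ha2]
    · left
      rw [star, ← mul_assoc] at h2
      simpa using h2
  · intro e
    rw [← H.order_star]
    funext m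
    induction m with
    | zero => rfl
    | succ m ih =>
      -- This copy becomes the invariance under `a` of the order of depth `m`, needed where `star a
      -- h` differs from `h`.
      have ih' := ih
      rw [H.order_star] at ih'
      rw [Rule.order_succ, Rule.order_succ]
      congr 1
      funext i
      rw [Rule.block, Rule.block, ih, rule_motion, rule_motion]
      congr 1
      rcases e i with h1 | h1
      · rw [inv_mul_eq_one] at h1
        rw [star, ← h1, Subgroup.coe_mul, ← mul_assoc, Motion.mul_onList]
        congr 1
      · rw [inv_mul_eq_iff_eq_mul] at h1
        rw [star, h1, mul_assoc, H.mapsTo.mul_self, mul_one]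

theorem curveClass_eq_iff (h h' : Fin 8 → t.stabilizer) :
    H.isBase.curveClass h = H.isBase.curveClass h' ↔
      (s.rule β h').order = (s.rule β h).order ∨
        (s.rule β h').order = a.1.onOrder (s.rule β h).order := by
  rw [IsBase.curveClass, IsBase.curveClass, mk_curve_eq_iff]
  constructor
  · rintro ⟨τ, hτ⟩
    have h1 := (H.isBase.fits h).mapsTo (H.isBase.fits h') hτ
    have h2 := H.mapsTo.eq_or_eq H.ne_one (b := ⟨τ, h1.mem_stabilizer⟩) h1
    rcases h2 with h2 | h2
    · left
      rw [hτ]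
      exact (congrArg (fun b => Motion.onOrder b _) (congrArg Subtype.val h2)).trans
        (Motion.one_onOrder _)
    · right
      rw [hτ]
      exact congrArg (fun b => Motion.onOrder b _) (congrArg Subtype.val h2)
  · rintro (e | e)
    · exact ⟨1, by rw [e, Motion.one_onOrder]⟩
    · exact ⟨a.1, e⟩

/-- The order equals its own image under `a`, so classes are orders here, and every choice may
independently be multiplied by `a`. -/
theorem curveClass_eq_iff_of_symmetricUpTo {h : Fin 8 → t.stabilizer} (hh : SymmetricUpTo a h)
    (h' : Fin 8 → t.stabilizer) : H.isBase.curveClass h' = H.isBase.curveClass h ↔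
      ∀ i, (h i)⁻¹ * h' i = 1 ∨ (h i)⁻¹ * h' i = a := by
  have h1 := (H.onOrder_eq_iff h).2 hh
  rw [eq_comm, H.curveClass_eq_iff, h1, or_self, eq_comm, rule_order_eq_iff]
  refine forall_congr' fun i => ⟨fun e => ?_, fun e => ?_⟩
  · exact H.mapsTo.eq_or_eq H.ne_one (H.isBase.mapsTo_of_fixes e)
  · rcases e with e | e
    · rw [e]
      exact Motion.one_onOrder _
    · rw [e, h1]

theorem rule_order_injective {h : Fin 8 → t.stabilizer} (hh : ¬ SymmetricUpTo a h)
    {h' : Fin 8 → t.stabilizer} (e : (s.rule β h).order = (s.rule β h').order) : h = h' := by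
  funext i
  have h1 := (rule_order_eq_iff h h').1 e i
  rcases H.mapsTo.eq_or_eq H.ne_one (H.isBase.mapsTo_of_fixes h1) with h2 | h2
  · exact inv_mul_eq_one.1 h2
  · rw [h2] at h1
    exact absurd ((H.onOrder_eq_iff h).1 h1) hh

/-- Here `a` moves the order, so the rule is determined by its order, and the only other
representative in the scheme is the image under `a`. -/
theorem curveClass_eq_iff_of_not_symmetricUpTo {h : Fin 8 → t.stabilizer}
    (hh : ¬ SymmetricUpTo a h) (h' : Fin 8 → t.stabilizer) :
    H.isBase.curveClass h' = H.isBase.curveClass h ↔ h' = h ∨ h' = star a h := by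
  rw [H.curveClass_eq_iff]
  constructor
  · rintro (e | e)
    · exact Or.inl (H.rule_order_injective hh e).symm
    · rw [← H.order_star] at e
      right
      rw [H.rule_order_injective hh e, H.star_star]
  · rintro (rfl | rfl)
    · exact Or.inl rfl
    · right
      rw [← H.order_star, H.star_star]

theorem symmetricUpTo_of_curveClass_eq {h h' : Fin 8 → t.stabilizer} (hh : SymmetricUpTo a h)
    (e : H.isBase.curveClass h' = H.isBase.curveClass h) : SymmetricUpTo a h' := by
  rw [← H.onOrder_eq_iff]
  have h1 := (H.onOrder_eq_iff h).2 hh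
  rw [eq_comm, H.curveClass_eq_iff, h1, or_self] at e
  rw [e, h1]

theorem card_fiber_of_symmetricUpTo {h : Fin 8 → t.stabilizer} (hh : SymmetricUpTo a h) :
    Nat.card {h' // H.isBase.curveClass h' = H.isBase.curveClass h} = 2 ^ 8 := by
  rw [Nat.card_congr (Equiv.subtypeEquivRight (H.curveClass_eq_iff_of_symmetricUpTo hh)),
    Nat.card_congr (Equiv.subtypePiEquivPi
      (p := fun i (x : t.stabilizer) => (h i)⁻¹ * x = 1 ∨ (h i)⁻¹ * x = a)), Nat.card_pi]
  simp [card_pair_eq_two H.ne_one]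

theorem card_fiber_of_not_symmetricUpTo {h : Fin 8 → t.stabilizer} (hh : ¬ SymmetricUpTo a h) :
    Nat.card {h' // H.isBase.curveClass h' = H.isBase.curveClass h} = 2 := by
  rw [Nat.card_congr (Equiv.subtypeEquivRight (H.curveClass_eq_iff_of_not_symmetricUpTo hh))]
  have h1 : h ≠ star a h := fun e => hh ((H.onOrder_eq_iff h).1 (by rw [← H.order_star, ← e]))
  exact Set.ncard_pair h1

theorem numCurves_eq [Finite t.stabilizer] : s.numCurves = (Nat.card t.stabilizer * 2) ^ 4 / 2 ^ 8 +
    (Nat.card t.stabilizer ^ 8 - (Nat.card t.stabilizer * 2) ^ 4) / 2 := by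
  have h1 := card_image_mul H.isBase.curveClass (SymmetricUpTo a) (2 ^ 8)
    (fun h hh => H.card_fiber_of_symmetricUpTo hh)
    fun h h' hh e => H.symmetricUpTo_of_curveClass_eq hh e
  have h2 := card_image_mul H.isBase.curveClass (fun h => ¬ SymmetricUpTo a h) 2
    (fun h hh => H.card_fiber_of_not_symmetricUpTo hh)
    fun h h' hh e hh' => hh (H.symmetricUpTo_of_curveClass_eq hh' e.symm)
  have h3 := card_symmetricUpTo H.ne_one H.mapsTo.mul_self
  have h4 : Nat.card {h : Fin 8 → t.stabilizer // SymmetricUpTo a h} +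
      Nat.card {h : Fin 8 → t.stabilizer // ¬ SymmetricUpTo a h} = Nat.card t.stabilizer ^ 8 := by
    classical
    rw [← Nat.card_sum, Nat.card_congr (Equiv.sumCompl _), Nat.card_fun]
    simp
  have h5 : s.numCurves = Nat.card {q // ∃ h, SymmetricUpTo a h ∧ H.isBase.curveClass h = q} +
      Nat.card {q // ∃ h, ¬ SymmetricUpTo a h ∧ H.isBase.curveClass h = q} := by
    classical
    have hf1 : Set.Finite {q | ∃ h, SymmetricUpTo a h ∧ H.isBase.curveClass h = q} :=
      (Set.finite_range H.isBase.curveClass).subset fun q ⟨h, _, e⟩ => ⟨h, e⟩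
    have hf2 : Set.Finite {q | ∃ h, ¬ SymmetricUpTo a h ∧ H.isBase.curveClass h = q} :=
      (Set.finite_range H.isBase.curveClass).subset fun q ⟨h, _, e⟩ => ⟨h, e⟩
    rw [H.isBase.numCurves_eq]
    have hd : Disjoint {q | ∃ h, SymmetricUpTo a h ∧ H.isBase.curveClass h = q}
        {q | ∃ h, ¬ SymmetricUpTo a h ∧ H.isBase.curveClass h = q} := by
      rw [Set.disjoint_left]
      rintro _ ⟨h, hh, rfl⟩ ⟨h', hh', e⟩
      exact hh' (H.symmetricUpTo_of_curveClass_eq hh e)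
    have := Set.ncard_union_eq hd hf1 hf2
    refine Eq.trans ?_ this
    change Set.ncard {q | ∃ h, H.isBase.curveClass h = q} = _
    congr 1
    ext q
    simp only [Set.mem_union, Set.mem_ofPred_eq]
    constructor
    · rintro ⟨h, e⟩
      by_cases hh : SymmetricUpTo a h
      · exact Or.inl ⟨h, hh, e⟩
      · exact Or.inr ⟨h, hh, e⟩
    · rintro (⟨h, -, e⟩ | ⟨h, -, e⟩) <;> exact ⟨h, e⟩
  omega

end IsSymmetricBase

theorem exists_mapsTo_of_isSymmetric (hs : s.IsSymmetric) :
    ∃ a : t.stabilizer, MapsTo a.1 s s ∧ a ≠ 1 := by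
  obtain ⟨g, hg⟩ := hs
  have h1 : MapsTo ⟨g, true⟩ s s := hg
  refine ⟨⟨_, h1.mem_stabilizer⟩, h1, fun h => ?_⟩
  have := congrArg (fun a : t.stabilizer => a.1.rev) h
  simp at this

theorem numCurves_of_isSymmetric [Finite t.stabilizer] (hs : s.IsSymmetric) :
    s.numCurves = (Nat.card t.stabilizer * 2) ^ 4 / 2 ^ 8 +
      (Nat.card t.stabilizer ^ 8 - (Nat.card t.stabilizer * 2) ^ 4) / 2 := by
  obtain ⟨a, h, ha⟩ := exists_mapsTo_of_isSymmetric hs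
  obtain ⟨β, H⟩ := exists_isSymmetricBase h ha
  exact H.numCurves_eq

/-! ## Counting schemes modulo motions -/

theorem mk_eq_iff {s s' : ConnectionScheme t} : (⟦s⟧ : Quotient (setoid t)) = ⟦s'⟧ ↔
    ∃ τ : t.stabilizer, s.move τ = s' := by
  rw [Quotient.eq]
  constructor
  · rintro ⟨g, r, h⟩
    have h1 : MapsTo ⟨g, r⟩ s s' := h
    exact ⟨⟨_, h1.mem_stabilizer⟩, mapsTo_iff.1 h1⟩
  · rintro ⟨τ, h⟩
    exact ⟨_, _, mapsTo_iff.2 h⟩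

/-- Conjugating the reversing motion by a motion between the schemes gives a reversing motion. -/
theorem isSymmetric_of_mk_eq {s s' : ConnectionScheme t} (hs : s.IsSymmetric)
    (h : (⟦s'⟧ : Quotient (setoid t)) = ⟦s⟧) : s'.IsSymmetric := by
  obtain ⟨a, h1, ha⟩ := exists_mapsTo_of_isSymmetric hs
  obtain ⟨τ, hτ⟩ := mk_eq_iff.1 h
  have h2 := mapsTo_iff.2 hτ
  have h3 := (h2.mul h1).mul h2.inv
  refine ⟨(τ.1⁻¹ * (a.1 * τ.1)).sym, ?_⟩
  have h4 : (τ.1⁻¹ * (a.1 * τ.1)).rev = true := by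
    simp [h1.rev_eq_true ha]
  rw [← h4]
  exact h3

theorem card_fiber_of_not_isSymmetric (hs : ¬ s.IsSymmetric) :
    Nat.card {s' : ConnectionScheme t // (⟦s'⟧ : Quotient (setoid t)) = ⟦s⟧} =
      Nat.card t.stabilizer := by
  refine (Nat.card_congr (Equiv.ofBijective
    (fun τ => ⟨s.move τ, (mk_eq_iff.2 ⟨τ, rfl⟩).symm⟩) ⟨fun a b hab => ?_, ?_⟩)).symm
  · have h1 : s.move a = s.move b := congrArg Subtype.val hab
    have h2 := (mapsTo_move s a).mul (mapsTo_iff.2 h1.symm).inv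
    have h3 : (b.1⁻¹ * a.1).rev = false := by
      by_contra h3
      refine hs ⟨(b.1⁻¹ * a.1).sym, ?_⟩
      rw [Bool.not_eq_false] at h3
      rw [← h3]
      exact h2
    exact (Subtype.ext (inv_mul_eq_one.1 (h2.eq_one h3))).symm
  · rintro ⟨s', hs'⟩
    obtain ⟨τ, hτ⟩ := mk_eq_iff.1 hs'.symm
    exact ⟨τ, Subtype.ext hτ⟩

/-- The class is the orbit of `s`, and the motions that fix `s` are 1 and `a`, so every scheme in it
is reached by exactly two motions. -/
theorem card_fiber_of_isSymmetric [Finite t.stabilizer] (hs : s.IsSymmetric) :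
    Nat.card {s' : ConnectionScheme t // (⟦s'⟧ : Quotient (setoid t)) = ⟦s⟧} * 2 =
      Nat.card t.stabilizer := by
  obtain ⟨a, h1, ha⟩ := exists_mapsTo_of_isSymmetric hs
  have h2 := card_image_mul (X := t.stabilizer) (fun τ => s.move τ) (fun _ => True) 2
    (fun τ _ => ?_) fun _ _ _ _ => trivial
  · rw [Nat.card_congr (Equiv.subtypeUnivEquiv fun _ => trivial)] at h2
    rw [← h2]
    congr 1
    refine Nat.card_congr (Equiv.subtypeEquivRight fun s' => ?_)
    rw [eq_comm, mk_eq_iff]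
    simp
  · rw [← card_pair_eq_two ha τ]
    refine Nat.card_congr (Equiv.subtypeEquivRight fun σ => ?_)
    constructor
    · intro h
      have h3 := (mapsTo_move s σ).mul (mapsTo_iff.2 h.symm).inv
      have h4 := h1.eq_or_eq ha (b := τ⁻¹ * σ) h3
      exact h4
    · rintro (h | h)
      · rw [inv_mul_eq_one] at h
        rw [h]
      · rw [inv_mul_eq_iff_eq_mul] at h
        refine mapsTo_iff.1 ?_
        rw [h]
        exact h1.mul (mapsTo_move s τ)

/-- The classes of symmetric schemes, and the classes of asymmetric schemes. -/
theorem card_classes [Finite (ConnectionScheme t)] [Finite t.stabilizer] {n N M : ℕ}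
    (hn : Nat.card t.stabilizer = n) (hN : Nat.card (ConnectionScheme t) = N)
    (hM : Nat.card {s : ConnectionScheme t // s.IsSymmetric} = M) :
    Nat.card {q : Quotient (setoid t) // q.out.IsSymmetric} * n = 2 * M ∧
      Nat.card {q : Quotient (setoid t) // ¬ q.out.IsSymmetric} * n = N - M := by
  have h1 := card_image_mul (fun s => (⟦s⟧ : Quotient (setoid t))) IsSymmetric (n / 2)
    (fun s hs => by
      have := card_fiber_of_isSymmetric hs
      omega) fun s s' hs e => isSymmetric_of_mk_eq hs e
  have h2 := card_image_mul (fun s => (⟦s⟧ : Quotient (setoid t))) (fun s => ¬ s.IsSymmetric) n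
    (fun s hs => by rw [card_fiber_of_not_isSymmetric hs, hn])
    fun s s' hs e hs' => hs (isSymmetric_of_mk_eq hs' e.symm)
  have h3 : Nat.card {s : ConnectionScheme t // s.IsSymmetric} +
      Nat.card {s : ConnectionScheme t // ¬ s.IsSymmetric} = N := by
    classical
    rw [← Nat.card_sum, Nat.card_congr (Equiv.sumCompl _), hN]
  have e1 : ∀ q : Quotient (setoid t), (∃ s : ConnectionScheme t, s.IsSymmetric ∧ ⟦s⟧ = q) ↔
      q.out.IsSymmetric := fun q =>
    ⟨fun ⟨s, hs, e⟩ => isSymmetric_of_mk_eq hs (by rw [e, Quotient.out_eq]),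
      fun h => ⟨_, h, q.out_eq⟩⟩
  have e2 : ∀ q : Quotient (setoid t), (∃ s : ConnectionScheme t, ¬ s.IsSymmetric ∧ ⟦s⟧ = q) ↔
      ¬ q.out.IsSymmetric := fun q =>
    ⟨fun ⟨s, hs, e⟩ h => hs (isSymmetric_of_mk_eq h (by rw [e, Quotient.out_eq])),
      fun h => ⟨_, h, q.out_eq⟩⟩
  rw [Nat.card_congr (Equiv.subtypeEquivRight e1)] at h1
  rw [Nat.card_congr (Equiv.subtypeEquivRight e2)] at h2
  refine ⟨?_, by omega⟩
  -- A symmetric scheme forces `n` to be even, so `n / 2` is exact; if there is none, both sides are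
  -- zero.
  by_cases hs : ∃ s : ConnectionScheme t, s.IsSymmetric
  · obtain ⟨s, hs⟩ := hs
    have h5 := card_fiber_of_isSymmetric hs
    rw [hn] at h5
    have h6 : n = n / 2 * 2 := by omega
    rw [h6, ← mul_assoc, h1, hM, mul_comm]
  · have h7 : IsEmpty {s : ConnectionScheme t // s.IsSymmetric} := ⟨fun s => hs ⟨s.1, s.2⟩⟩
    have h8 : IsEmpty {q : Quotient (setoid t) // q.out.IsSymmetric} :=
      ⟨fun q => hs ⟨_, q.2⟩⟩
    rw [Nat.card_of_isEmpty] at hM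
    simp [← hM]

end ConnectionScheme

end MonoHilbert

namespace MonoHilbert

/-! ## Walks -/

/-- The tree affects only how values are shared during evaluation, so nothing has to be known about
its contents. -/
theorem memo_eq {α : Type} (f : ℕ → α) (t : Tree) : memo f t = f := by
  funext p
  induction t with
  | leaf => rfl
  | node k l r ihl ihr =>
    change Bool.rec (Bool.rec (memo f r p) (memo f l p) (Nat.ble p k)) (f k) (Nat.beq p k) = f p
    cases h : Nat.beq p k
    · cases Nat.ble p k
      · exact ihr
      · exact ihl
    · rw [Nat.eq_of_beq_eq_true h]

theorem memNat_iff {a : ℕ} {l : List ℕ} : memNat a l = true ↔ a ∈ l := by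
  induction l with
  | nil => simp [memNat]
  | cons b l ih =>
    have h1 : memNat a (b :: l) =
        @Bool.rec (fun _ => Bool) (memNat a l) true (Nat.beq a b) := rfl
    rw [List.mem_cons, h1]
    cases h : Nat.beq a b
    · simp [Nat.ne_of_beq_eq_false h, ih]
    · simp [Nat.eq_of_beq_eq_true h]

theorem partners_cons (a : ℕ × ℕ) (l : List (ℕ × ℕ)) (u : ℕ) : partners (a :: l) u =
    if a.1 = u then if a.2 ∈ partners l u then partners l u else a.2 :: partners l u
    else if a.2 = u then if a.1 ∈ partners l u then partners l u else a.1 :: partners l u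
    else partners l u := by
  change @Bool.rec (fun _ => List ℕ)
    (Bool.rec (partners l u)
      (Bool.rec (a.1 :: partners l u) (partners l u) (memNat a.1 (partners l u)))
      (Nat.beq a.2 u))
    (Bool.rec (a.2 :: partners l u) (partners l u) (memNat a.2 (partners l u))) (Nat.beq a.1 u) = _
  cases h1 : Nat.beq a.1 u
  · rw [if_neg (Nat.ne_of_beq_eq_false h1)]
    cases h2 : Nat.beq a.2 u
    · rw [if_neg (Nat.ne_of_beq_eq_false h2)]
    · rw [if_pos (Nat.eq_of_beq_eq_true h2)]
      cases h3 : memNat a.1 (partners l u)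
      · rw [if_neg (by rw [← memNat_iff, h3]; decide)]
      · rw [if_pos (memNat_iff.1 h3)]
  · rw [if_pos (Nat.eq_of_beq_eq_true h1)]
    cases h3 : memNat a.2 (partners l u)
    · rw [if_neg (by rw [← memNat_iff, h3]; decide)]
    · rw [if_pos (memNat_iff.1 h3)]

theorem mem_partners {ims : List (ℕ × ℕ)} {u v : ℕ} :
    v ∈ partners ims u ↔ (u, v) ∈ ims ∨ (v, u) ∈ ims := by
  induction ims generalizing v with
  | nil => simp [partners]
  | cons a l ih =>
    obtain ⟨a, b⟩ := a
    rw [partners_cons]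
    simp only [List.mem_cons, Prod.mk.injEq]
    split_ifs with h1 h2 h2 h3
    · subst h1
      rw [ih] at h2 ⊢
      grind
    · subst h1
      rw [List.mem_cons, ih]
      grind
    · subst h2
      rw [ih] at h3 ⊢
      grind
    · subst h2
      rw [List.mem_cons, ih]
      grind
    · rw [ih]
      grind

theorem nodup_partners (ims : List (ℕ × ℕ)) (u : ℕ) : (partners ims u).Nodup := by
  induction ims with
  | nil => simp [partners]
  | cons a l ih =>
    rw [partners_cons]
    split_ifs <;> simp_all

theorem mem_neighbors {ims : List (ℕ × ℕ)} {p k q : ℕ} : (k, q) ∈ neighbors ims p ↔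
    k < 8 ∧ octOffset k ≤ p ∧ inGrid (p - octOffset k) = true ∧
      ∃ v ∈ partners ims (p - octOffset k), q = v + octOffset k := by
  have h8 : k ∈ [0, 1, 2, 3, 4, 5, 6, 7] ↔ k < 8 := by
    simp only [List.mem_cons, List.not_mem_nil, or_false]
    omega
  have h9 : ∀ k p, (Nat.ble (octOffset k) p && inGrid (Nat.sub p (octOffset k))) = true ↔
      octOffset k ≤ p ∧ inGrid (p - octOffset k) = true := fun k p => by
    rw [Bool.and_eq_true, Nat.ble_eq]
    rfl
  rw [neighbors, List.mem_flatMap]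
  constructor
  · rintro ⟨k', hk, h⟩
    cases h1 : Nat.ble (octOffset k') p && inGrid (Nat.sub p (octOffset k'))
    · rw [h1] at h
      simp at h
    · rw [h1] at h
      obtain ⟨v, hv, e⟩ := List.mem_map.1 h
      simp only [Prod.mk.injEq] at e
      obtain ⟨rfl, rfl⟩ := e
      obtain ⟨h2, h3⟩ := (h9 _ _).1 h1
      exact ⟨h8.1 hk, h2, h3, v, hv, rfl⟩
  · rintro ⟨h1, h2, h3, v, hv, rfl⟩
    refine ⟨k, h8.2 h1, ?_⟩
    rw [(h9 _ _).2 ⟨h2, h3⟩]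
    exact List.mem_map.2 ⟨v, hv, rfl⟩

theorem nodup_neighbors (ims : List (ℕ × ℕ)) (p : ℕ) : (neighbors ims p).Nodup := by
  rw [neighbors, List.nodup_flatMap]
  constructor
  · intro k _
    cases Nat.ble (octOffset k) p && inGrid (Nat.sub p (octOffset k))
    · exact List.nodup_nil
    · refine (nodup_partners _ _).map fun a b h => ?_
      simp only [Prod.mk.injEq, true_and] at h
      exact Nat.add_right_cancel h
  · refine List.Pairwise.imp (R := (· ≠ ·)) (fun {a b} hab => ?_) (by decide)
    have key : ∀ k s, s ∈ (Bool.rec [] ((partners ims (Nat.sub p (octOffset k))).map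
        fun v => (k, Nat.add v (octOffset k)))
        (Nat.ble (octOffset k) p && inGrid (Nat.sub p (octOffset k))) : List (ℕ × ℕ)) →
        s.1 = k := by
      intro k s
      cases Nat.ble (octOffset k) p && inGrid (Nat.sub p (octOffset k))
      · simp
      · intro h
        obtain ⟨v, -, rfl⟩ := List.mem_map.1 h
        rfl
    intro s h1 h2
    exact hab ((key a s h1).symm.trans (key b s h2))

theorem testBit_finalOctants {ims : List (ℕ × ℕ)} {x k q : ℕ} (h : (k, q) ∈ neighbors ims x) :
    (finalOctants ims x).testBit k = true := by
  rw [finalOctants]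
  generalize neighbors ims x = l at h
  induction l with
  | nil => simp at h
  | cons s l ih =>
    rw [List.foldr_cons]
    change (2 ^ s.1 ||| List.foldr _ 0 l).testBit k = true
    rw [Nat.testBit_or]
    rcases List.mem_cons.1 h with rfl | h
    · simp [Nat.testBit_two_pow_self]
    · rw [Bool.or_eq_true]
      exact Or.inr (ih h)

section walks

variable {ad : ℕ → List (ℕ × ℕ)} {fin : ℕ} {target : ℕ → Bool}

/-- The octant with index `k` can be visited next. -/
def canVisit (fin n vis k : ℕ) : Bool :=
  Bool.rec false (Bool.rec (Bool.rec true false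
    (Nat.beq (Nat.land fin (Nat.lor vis (Nat.pow 2 k))) fin)) true (Nat.beq n 0))
    (Nat.beq (Nat.land vis (Nat.pow 2 k)) 0)

theorem land_two_pow_eq_zero_iff {vis k : ℕ} :
    Nat.beq (Nat.land vis (Nat.pow 2 k)) 0 = true ↔ vis.testBit k = false := by
  rw [Nat.beq_eq]
  change vis &&& 2 ^ k = 0 ↔ _
  constructor
  · intro h
    have := congrArg (Nat.testBit · k) h
    simpa [Nat.testBit_and, Nat.testBit_two_pow_self] using this
  · intro h
    apply Nat.eq_of_testBit_eq
    intro i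
    rw [Nat.testBit_and, Nat.testBit_two_pow, Nat.zero_testBit]
    by_cases hi : k = i
    · subst hi
      simp [h]
    · simp [hi]

theorem canVisit_zero {vis k : ℕ} : canVisit fin 0 vis k = true ↔ vis.testBit k = false := by
  rw [← land_two_pow_eq_zero_iff]
  change Bool.rec false true _ = true ↔ _
  cases Nat.beq (Nat.land vis (Nat.pow 2 k)) 0 <;> simp

theorem testBit_of_canVisit {n vis k : ℕ} (h : canVisit fin n vis k = true) :
    vis.testBit k = false := by
  rw [← land_two_pow_eq_zero_iff]
  by_contra h1
  rw [Bool.not_eq_true] at h1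
  rw [canVisit, h1] at h
  cases h

/-- The mask `fin` only prunes: a step is rejected if it uses up all octants in which the walk could
end while further steps remain. -/
theorem canVisit_of {n vis k j : ℕ} (h : vis.testBit k = false) (hj : fin.testBit j = true)
    (hj' : (vis ||| 2 ^ k).testBit j = false) : canVisit fin n vis k = true := by
  rw [canVisit, land_two_pow_eq_zero_iff.2 h]
  cases Nat.beq n 0
  · have : Nat.beq (Nat.land fin (Nat.lor vis (Nat.pow 2 k))) fin = false := by
      by_contra h1
      rw [Bool.not_eq_false] at h1
      have h2 := congrArg (Nat.testBit · j) (Nat.eq_of_beq_eq_true h1)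
      change (fin &&& (vis ||| 2 ^ k)).testBit j = fin.testBit j at h2
      rw [Nat.testBit_and, hj, hj'] at h2
      cases h2
    rw [this]
  · rfl

theorem walks_succ (n vis p : ℕ) : walks ad fin target (n + 1) vis p =
    (ad p).flatMap fun s => if canVisit fin n vis s.1 then
      (walks ad fin target n (vis ||| 2 ^ s.1) s.2).map fun w => s :: w else [] := by
  change List.rec (motive := fun _ => List (List (ℕ × ℕ))) [] (fun s _ acc => Bool.rec acc
    (((walks ad fin target n (Nat.lor vis (Nat.pow 2 s.1)) s.2).map fun w => s :: w) ++ acc)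
    (canVisit fin n vis s.1)) (ad p) = _
  induction ad p with
  | nil => rfl
  | cons s l ih =>
    rw [List.flatMap_cons, ← ih]
    cases h : canVisit fin n vis s.1
    · simp [h]
    · simp only [h, if_true]
      rfl

theorem walkCount_eq (n vis p : ℕ) : walkCount ad fin target n vis p =
    (walks ad fin target n vis p).length := by
  induction n generalizing vis p with
  | zero =>
    change Bool.rec 0 1 (target p) = (Bool.rec [] [[]] (target p) : List (List (ℕ × ℕ))).length
    cases target p <;> rfl
  | succ n ih =>
    rw [walks_succ]
    change List.rec (motive := fun _ => ℕ) 0 (fun s _ acc => Bool.rec acc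
      (Nat.add (walkCount ad fin target n (Nat.lor vis (Nat.pow 2 s.1)) s.2) acc)
      (canVisit fin n vis s.1)) (ad p) = _
    induction ad p with
    | nil => rfl
    | cons s l ih' =>
      rw [List.flatMap_cons, List.length_append, ← ih']
      cases h : canVisit fin n vis s.1
      · simp [h]
      · simp only [h, if_true]
        rw [List.length_map, ← ih]
        rfl

theorem nodup_walks (had : ∀ p, (ad p).Nodup) (n vis p : ℕ) :
    (walks ad fin target n vis p).Nodup := by
  induction n generalizing vis p with
  | zero =>
    change (Bool.rec [] [[]] (target p) : List (List (ℕ × ℕ))).Nodup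
    cases target p <;> simp
  | succ n ih =>
    rw [walks_succ, List.nodup_flatMap]
    constructor
    · intro s _
      split_ifs
      · exact (ih _ _).map fun a b h => (List.cons.inj h).2
      · exact List.nodup_nil
    · refine (had p).imp fun {a b} hab => ?_
      intro w h1 h2
      beta_reduce at h1 h2
      split_ifs at h1 h2
      · obtain ⟨w1, -, rfl⟩ := List.mem_map.1 h1
        obtain ⟨w2, -, h⟩ := List.mem_map.1 h2
        exact hab (List.cons.inj h).1.symm
      all_goals simp_all

/-- A walk, as a function. -/
structure IsWalk (ad : ℕ → List (ℕ × ℕ)) (target : ℕ → Bool) (vis : ℕ) {n : ℕ} (k : Fin n → ℕ)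
    (c : Fin (n + 1) → ℕ) : Prop where
  mem : ∀ i, (k i, c i.succ) ∈ ad (c i.castSucc)
  injective : Function.Injective k
  testBit : ∀ i, vis.testBit (k i) = false
  target : target (c (Fin.last n)) = true

/-- Soundness of the search, for every `fin`. -/
theorem isWalk_of_mem_walks {n vis p : ℕ} {w : List (ℕ × ℕ)}
    (h : w ∈ walks ad fin target n vis p) : ∃ (k : Fin n → ℕ) (c : Fin (n + 1) → ℕ),
      w = List.ofFn (fun i => (k i, c i.succ)) ∧ c 0 = p ∧ IsWalk ad target vis k c := by
  induction n generalizing vis p w with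
  | zero =>
    change w ∈ (Bool.rec [] [[]] (target p) : List (List (ℕ × ℕ))) at h
    cases hs : target p
    · rw [hs] at h
      simp at h
    · rw [hs] at h
      refine ⟨Fin.elim0, fun _ => p, by simpa using h, rfl, fun i => i.elim0, fun i => i.elim0,
        fun i => i.elim0, hs⟩
  | succ n ih =>
    rw [walks_succ, List.mem_flatMap] at h
    obtain ⟨s, hs, h⟩ := h
    split_ifs at h with hv
    · obtain ⟨w', hw, rfl⟩ := List.mem_map.1 h
      obtain ⟨k, c, rfl, hc, H⟩ := ih hw
      have hk : ∀ i, vis.testBit (k i) = false ∧ s.1 ≠ k i := fun i => by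
        have := H.testBit i
        rw [Nat.testBit_or, Nat.testBit_two_pow, Bool.or_eq_false_iff] at this
        exact ⟨this.1, by simpa using this.2⟩
      refine ⟨Fin.cons s.1 k, Fin.cons p c, ?_, rfl, fun i => ?_, ?_, fun i => ?_, ?_⟩
      · rw [List.ofFn_succ]
        simp only [Fin.cons_succ, Fin.cons_zero, hc]
      · refine Fin.cases ?_ (fun i => ?_) i
        · simpa [hc] using hs
        · simpa [← Fin.succ_castSucc] using H.mem i
      · rw [Fin.cons_injective_iff]
        refine ⟨?_, H.injective⟩
        rintro ⟨i, hi⟩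
        exact (hk i).2 hi.symm
      · refine Fin.cases ?_ (fun i => ?_) i
        · exact testBit_of_canVisit hv
        · exact (hk i).1
      · rw [← Fin.succ_last, Fin.cons_succ]
        exact H.target
    · simp at h

/-- Completeness of the search: the pruning loses nothing if the last octant is in `fin`, since
until the last step that octant is not yet visited. -/
theorem mem_walks_of_isWalk {n vis : ℕ} {k : Fin n → ℕ} {c : Fin (n + 1) → ℕ}
    (H : IsWalk ad target vis k c) (hfin : ∀ i, i.succ = Fin.last n → fin.testBit (k i) = true) :
    List.ofFn (fun i => (k i, c i.succ)) ∈ walks ad fin target n vis (c 0) := by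
  induction n generalizing vis with
  | zero =>
    change _ ∈ (Bool.rec [] [[]] (target (c 0)) : List (List (ℕ × ℕ)))
    have := H.target
    rw [show Fin.last 0 = 0 from rfl] at this
    rw [this]
    simp
  | succ n ih =>
    rw [walks_succ, List.mem_flatMap]
    refine ⟨(k 0, c 1), H.mem 0, ?_⟩
    have hk : ∀ i : Fin n, (vis ||| 2 ^ k 0).testBit (k i.succ) = false := fun i => by
      rw [Nat.testBit_or, Nat.testBit_two_pow, H.testBit]
      simpa using H.injective.ne (Fin.succ_ne_zero i).symm
    have hv : canVisit fin n vis (k 0) = true := by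
      cases n with
      | zero => exact canVisit_zero.2 (H.testBit 0)
      | succ n =>
        exact canVisit_of (H.testBit 0) (hfin (Fin.last _) rfl) (hk (Fin.last _))
    rw [if_pos hv, List.mem_map]
    refine ⟨List.ofFn (fun i : Fin n => (k i.succ, c i.succ.succ)), ?_, ?_⟩
    · exact ih (k := fun i => k i.succ) (c := fun i => c i.succ) ⟨fun i => H.mem i.succ,
        fun i j hij => Fin.succ_injective _ (H.injective hij), hk, H.target⟩
        fun i hi => hfin i.succ (by rw [hi, Fin.succ_last])
    · rw [List.ofFn_succ]
      rfl

end walks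

/-! ## Points of the grid as real points -/

/-- The point with integer coordinates `t` in a grid of size `N`. -/
noncomputable def Trip.point (N : ℕ) (t : Trip) : Fin 3 → ℝ := fun k => (sel k t : ℝ) / N

/-- All coordinates are at most `N`. -/
def Trip.le (N : ℕ) (t : Trip) : Prop := ∀ k : Fin 3, sel k t ≤ N

theorem Trip.ext_sel {s t : Trip} (h : ∀ k : Fin 3, sel k s = sel k t) : s = t :=
  Prod.ext (h 0) (Prod.ext (h 1) (h 2))

theorem Trip.point_injective {N : ℕ} (hN : 0 < N) : Function.Injective (Trip.point N) :=
  fun s t h => Trip.ext_sel fun k => by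
    have h1 := congrFun h k
    have hN' : (N : ℝ) ≠ 0 := by positivity
    simp only [point] at h1
    rw [div_left_inj' hN'] at h1
    exact_mod_cast h1

/-- The code of a symmetry. -/
def CubeSym.code (g : CubeSym) : SymCode :=
  ((g.perm 0, g.perm 1, g.perm 2), (g.flip 0, g.flip 1, g.flip 2))

theorem CubeSym.code_mem (g : CubeSym) : g.code ∈ symCodes := by
  have h1 : ∀ σ : Equiv.Perm (Fin 3), (((σ 0 : ℕ), (σ 1 : ℕ), (σ 2 : ℕ)) : Trip) ∈ permCodes := by
    decide
  have h2 : ∀ a b c : Bool, (a, b, c) ∈ flipCodes := by decide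
  exact List.mem_flatMap.2 ⟨_, h1 g.perm, List.mem_map.2 ⟨_, h2 _ _ _, rfl⟩⟩

theorem exists_code_eq {c : SymCode} (h : c ∈ symCodes) : ∃ g : CubeSym, g.code = c := by
  obtain ⟨p, hp, h⟩ := List.mem_flatMap.1 h
  obtain ⟨f, -, rfl⟩ := List.mem_map.1 h
  have h1 : ∀ p ∈ permCodes, ∃ σ : Equiv.Perm (Fin 3),
      (((σ 0 : ℕ), (σ 1 : ℕ), (σ 2 : ℕ)) : Trip) = p := by
    decide
  obtain ⟨σ, rfl⟩ := h1 p hp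
  exact ⟨⟨σ, ![f.1, f.2.1, f.2.2]⟩, rfl⟩

theorem sel_apply (D : ℕ) (g : CubeSym) (t : Trip) (k : Fin 3) :
    sel k (g.code.apply D t) = flipIf D (g.flip k) (sel (g.perm k) t) := by
  fin_cases k <;> rfl

theorem Trip.le_apply {D : ℕ} (g : CubeSym) {t : Trip} (h : t.le D) : (g.code.apply D t).le D := by
  intro k
  rw [sel_apply]
  cases g.flip k
  · exact h _
  · exact Nat.sub_le _ _

theorem point_apply {D : ℕ} (hD : 0 < D) (g : CubeSym) {t : Trip} (h : t.le D) :
    (g.code.apply D t).point D = g.onPoint (t.point D) := by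
  funext k
  have hD' : (D : ℝ) ≠ 0 := by positivity
  simp only [Trip.point, CubeSym.onPoint, CubeSym.act]
  rw [sel_apply]
  cases g.flip k
  · rfl
  · change ((D - sel (g.perm k) t : ℕ) : ℝ) / D = 1 - _
    rw [Nat.cast_sub (h _), sub_div, div_self hD']

theorem pack_eq (t : Trip) : pack t = t.1 + (4096 * t.2.1 + 16777216 * t.2.2) := rfl

/-- Coordinates below 4096 are the digits of the code in base 4096, so no carry occurs. -/
theorem unpack_pack {t : Trip} (h : t.le 4095) : unpack (pack t) = t := by
  have h0 := h 0
  have h1 := h 1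
  obtain ⟨a, b, c⟩ := t
  change a ≤ 4095 at h0
  change b ≤ 4095 at h1
  refine Prod.ext ?_ (Prod.ext ?_ ?_)
  · change (a + (4096 * b + 16777216 * c)) % 4096 = a
    omega
  · change (a + (4096 * b + 16777216 * c)) / 4096 % 4096 = b
    omega
  · change (a + (4096 * b + 16777216 * c)) / 16777216 = c
    omega

theorem pack_unpack (c : ℕ) : pack (unpack c) = c := by
  change c % 4096 + (4096 * (c / 4096 % 4096) + 16777216 * (c / 16777216)) = c
  omega

theorem unpack_injective : Function.Injective unpack :=
  Function.LeftInverse.injective (g := pack) pack_unpack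

/-- The point with a given code in the refined grid. -/
noncomputable def codePoint (c : ℕ) : Fin 3 → ℝ := (unpack c).point 1020

theorem codePoint_injective : Function.Injective codePoint :=
  (Trip.point_injective (by norm_num)).comp unpack_injective

/-- The coordinates of an octant. -/
def octTrip (o : Octant) : Trip := ((o 0).toNat, (o 1).toNat, (o 2).toNat)

/-- The index of an octant. -/
def octIndex (o : Octant) : ℕ := (o 0).toNat + (2 * (o 1).toNat + 4 * (o 2).toNat)

theorem octIndex_lt (o : Octant) : octIndex o < 8 := by
  have : ∀ o : Octant, octIndex o < 8 := by decide
  exact this o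

theorem octIndex_injective : Function.Injective octIndex := by
  have : ∀ o o' : Octant, octIndex o = octIndex o' → o = o' := by decide
  exact this

theorem exists_octIndex_eq {k : ℕ} (hk : k < 8) : ∃ o, octIndex o = k := by
  have : ∀ k : Fin 8, ∃ o, octIndex o = k := by decide
  exact this ⟨k, hk⟩

theorem octOffset_octIndex (o : Octant) : octOffset (octIndex o) = 510 * pack (octTrip o) := by
  have : ∀ o : Octant, octOffset (octIndex o) = 510 * pack (octTrip o) := by decide
  exact this o

theorem sel_octTrip (o : Octant) (k : Fin 3) : sel k (octTrip o) = if o k then 1 else 0 := by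
  fin_cases k <;> simp [sel, octTrip, Bool.toNat, Bool.cond_eq_ite]

/-- The coordinates in the refined grid of a point of an octant. -/
def octShift (o : Octant) (t : Trip) : Trip :=
  (t.1 + 510 * (o 0).toNat, t.2.1 + 510 * (o 1).toNat, t.2.2 + 510 * (o 2).toNat)

theorem sel_octShift (o : Octant) (t : Trip) (k : Fin 3) :
    sel k (octShift o t) = sel k t + 510 * if o k then 1 else 0 := by
  fin_cases k <;> simp [sel, octShift, Bool.toNat, Bool.cond_eq_ite]

theorem pack_octShift (o : Octant) (t : Trip) :
    pack (octShift o t) = pack t + octOffset (octIndex o) := by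
  rw [octOffset_octIndex, pack_eq, pack_eq, pack_eq]
  simp only [octShift, octTrip]
  ring

theorem Trip.le_octShift (o : Octant) {t : Trip} (h : t.le 510) : (octShift o t).le 1020 := by
  intro k
  have := h k
  rw [sel_octShift]
  split_ifs <;> omega

theorem Trip.le.mono {t : Trip} {m n : ℕ} (h : t.le m) (hmn : m ≤ n) : t.le n :=
  fun k => (h k).trans hmn

/-- Scaling `t / 510` to the octant `o` gives `(t + 510 * o) / 1020`, so in codes it is the addition
of a constant. -/
theorem codePoint_pack_add (o : Octant) {t : Trip} (h : t.le 510) :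
    codePoint (pack t + octOffset (octIndex o)) = scaleTo o (t.point 510) := by
  rw [← pack_octShift, codePoint, unpack_pack ((Trip.le_octShift o h).mono (by norm_num))]
  funext k
  simp only [Trip.point, scaleTo]
  rw [sel_octShift]
  split_ifs <;> push_cast <;> ring

theorem codePoint_two_mul_pack {t : Trip} (h : t.le 510) :
    codePoint (2 * pack t) = t.point 510 := by
  have e : 2 * pack t = pack t.double := by
    change 2 * (t.1 + (4096 * t.2.1 + 16777216 * t.2.2)) =
      t.1 * 2 + (4096 * (t.2.1 * 2) + 16777216 * (t.2.2 * 2))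
    ring
  have h2 : ∀ k : Fin 3, sel k t.double = sel k t * 2 := fun k => by fin_cases k <;> rfl
  have h3 : t.double.le 4095 := fun k => by
    have := h k
    rw [h2]
    omega
  rw [e, codePoint, unpack_pack h3]
  funext k
  simp only [Trip.point]
  rw [h2]
  push_cast
  ring

theorem inGrid_pack {t : Trip} (h : t.le 510) : inGrid (pack t) = true := by
  have e := unpack_pack (h.mono (by norm_num : 510 ≤ 4095))
  have h0 := congrArg Prod.fst e
  have h1 := congrArg (fun t => t.2.1) e
  have h2 := congrArg (fun t => t.2.2) e
  simp only [unpack] at h0 h1 h2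
  rw [inGrid, h0, h1, h2]
  simp only [Bool.and_eq_true, Nat.ble_eq]
  exact ⟨h 0, h 1, h 2⟩

theorem mem_images {e x : Trip} {u v : ℕ} : (u, v) ∈ images e x ↔
    ∃ g : CubeSym, u = pack (g.code.apply 510 e) ∧ v = pack (g.code.apply 510 x) := by
  rw [images, List.mem_map]
  constructor
  · rintro ⟨c, hc, h⟩
    obtain ⟨g, rfl⟩ := exists_code_eq hc
    simp only [Prod.mk.injEq] at h
    exact ⟨g, h.1.symm, h.2.symm⟩
  · rintro ⟨g, rfl, rfl⟩
    exact ⟨g.code, g.code_mem, rfl⟩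

/-- A pair of gates that is given by points of the grid. -/
noncomputable def pairPoints (e x : Trip) : GatePair :=
  fun b => if b then x.point 510 else e.point 510

/-- The octant `o`, with gates `p` and `q`, is an image of the cube with its gates. -/
def Segment (w : GatePair) (o : Octant) (p q : Fin 3 → ℝ) : Prop :=
  ∃ τ : Motion, p = scaleTo o (τ.onGates w false) ∧ q = scaleTo o (τ.onGates w true)

theorem Segment.symm {w : GatePair} {o : Octant} {p q : Fin 3 → ℝ} (h : Segment w o p q) :
    Segment w o q p := by
  obtain ⟨τ, rfl, rfl⟩ := h
  refine ⟨⟨τ.sym, !τ.rev⟩, ?_, ?_⟩ <;> cases h : τ.rev <;> simp [Motion.onGates, h]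

theorem mem_partners_images {e x : Trip} {u v : ℕ} : v ∈ partners (images e x) u ↔
    ∃ τ : Motion, u = pack (τ.sym.code.apply 510 (if τ.rev then x else e)) ∧
      v = pack (τ.sym.code.apply 510 (if τ.rev then e else x)) := by
  rw [mem_partners, mem_images, mem_images]
  constructor
  · rintro (⟨g, rfl, rfl⟩ | ⟨g, rfl, rfl⟩)
    · exact ⟨⟨g, false⟩, rfl, rfl⟩
    · exact ⟨⟨g, true⟩, rfl, rfl⟩
  · rintro ⟨⟨g, r⟩, rfl, rfl⟩
    cases r
    · exact Or.inl ⟨g, rfl, rfl⟩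
    · exact Or.inr ⟨g, rfl, rfl⟩

section neighbors

variable {e x : Trip} (he : e.le 510) (hx : x.le 510)

include he hx

theorem onGates_pairPoints (τ : Motion) (b : Bool) : τ.onGates (pairPoints e x) b =
    (τ.sym.code.apply 510 (if xor b τ.rev then x else e)).point 510 := by
  rw [point_apply (by norm_num)]
  · cases h : xor b τ.rev <;> simp [Motion.onGates, pairPoints, h]
  · split_ifs
    · exact hx
    · exact he

/-- With `mem_neighbors_of_segment`, edges of the computed graph correspond exactly to octants with
admissible gates. -/
theorem segment_of_mem_neighbors {p k q : ℕ} (h : (k, q) ∈ neighbors (images e x) p) :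
    ∃ o, octIndex o = k ∧ Segment (pairPoints e x) o (codePoint p) (codePoint q) := by
  obtain ⟨h1, h2, -, v, hv, rfl⟩ := mem_neighbors.1 h
  obtain ⟨o, rfl⟩ := exists_octIndex_eq h1
  obtain ⟨τ, h3, rfl⟩ := mem_partners_images.1 hv
  refine ⟨o, rfl, τ, ?_, ?_⟩
  · rw [onGates_pairPoints he hx, ← Nat.sub_add_cancel h2, h3, codePoint_pack_add]
    · simp
    · refine Trip.le_apply _ ?_
      split_ifs
      · exact hx
      · exact he
  · rw [onGates_pairPoints he hx, codePoint_pack_add]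
    · cases τ.rev <;> simp
    · refine Trip.le_apply _ ?_
      split_ifs
      · exact he
      · exact hx

/-- The code of a point of the refined grid. -/
noncomputable def _root_.MonoHilbert.encode (x : Fin 3 → ℝ) : ℕ :=
  pack (⌊1020 * x 0⌋₊, ⌊1020 * x 1⌋₊, ⌊1020 * x 2⌋₊)

omit he hx in
theorem encode_codePoint (c : ℕ) : encode (codePoint c) = c := by
  have h : ∀ k : Fin 3, ⌊1020 * codePoint c k⌋₊ = sel k (unpack c) := fun k => by
    rw [codePoint, Trip.point]
    push_cast
    rw [mul_div_cancel₀ _ (by norm_num), Nat.floor_natCast]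
  rw [encode, h 0, h 1, h 2]
  exact pack_unpack c

theorem exists_codePoint_eq {o : Octant} {p q : Fin 3 → ℝ} (h : Segment (pairPoints e x) o p q) :
    ∃ t : Trip, t.le 1020 ∧ p = codePoint (pack t) := by
  obtain ⟨τ, rfl, -⟩ := h
  have h1 : (τ.sym.code.apply 510 (if xor false τ.rev then x else e)).le 510 := by
    refine Trip.le_apply _ ?_
    split_ifs
    · exact hx
    · exact he
  refine ⟨octShift o (τ.sym.code.apply 510 (if xor false τ.rev then x else e)),
    Trip.le_octShift _ h1, ?_⟩
  rw [onGates_pairPoints he hx, pack_octShift, codePoint_pack_add _ h1]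

theorem mem_neighbors_of_segment {o : Octant} {p q : Fin 3 → ℝ}
    (h : Segment (pairPoints e x) o p q) :
    (octIndex o, encode q) ∈ neighbors (images e x) (encode p) := by
  obtain ⟨τ, rfl, rfl⟩ := h
  have h1 : ∀ b, (τ.sym.code.apply 510 (if xor b τ.rev then x else e)).le 510 := fun b => by
    refine Trip.le_apply _ ?_
    split_ifs
    · exact hx
    · exact he
  rw [onGates_pairPoints he hx, onGates_pairPoints he hx, ← codePoint_pack_add _ (h1 _),
    ← codePoint_pack_add _ (h1 _), encode_codePoint, encode_codePoint, mem_neighbors]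
  refine ⟨octIndex_lt o, Nat.le_add_left _ _, ?_, _, ?_, rfl⟩
  · rw [Nat.add_sub_cancel]
    exact inGrid_pack (h1 _)
  · rw [Nat.add_sub_cancel, mem_partners_images]
    refine ⟨τ, ?_, ?_⟩ <;> cases τ.rev <;> simp

theorem mem_walks_of_segments {n : ℕ} {o : Fin n → Octant} (ho : Function.Injective o)
    {y : Fin (n + 1) → Fin 3 → ℝ}
    (hy : ∀ i, Segment (pairPoints e x) (o i) (y i.castSucc) (y i.succ)) {fin : ℕ}
    {target : ℕ → Bool} (htarget : target (encode (y (Fin.last n))) = true)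
    (hfin : ∀ i, i.succ = Fin.last n → fin.testBit (octIndex (o i)) = true) :
    List.ofFn (fun i => (octIndex (o i), encode (y i.succ))) ∈
      walks (neighbors (images e x)) fin target n 0 (encode (y 0)) :=
  mem_walks_of_isWalk (k := fun i => octIndex (o i)) (c := fun i => encode (y i))
    ⟨fun i => mem_neighbors_of_segment he hx (hy i), octIndex_injective.comp ho,
      fun _ => Nat.zero_testBit _, htarget⟩ hfin

end neighbors

end MonoHilbert

namespace MonoHilbert

/-! ## Fixed points of contractions of the cube -/

/-- The size of a grid that contains the fixed points that have to be considered. -/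
abbrev fixGrid : ℕ := 69615

/-- One step of the approximation of the solution `y` of the equation `s * y = o + g y`. -/
def fixStep (s D : ℕ) (o : Trip) (c : SymCode) (t : Trip) : Trip :=
  (Nat.div (Nat.add (Nat.mul o.1 D) (c.apply D t).1) s,
    Nat.div (Nat.add (Nat.mul o.2.1 D) (c.apply D t).2.1) s,
    Nat.div (Nat.add (Nat.mul o.2.2 D) (c.apply D t).2.2) s)

/-- The approximation need not be trusted, because `isFix` verifies its result exactly. Along a
cycle of length `k` of the axis permutation the solution has a denominator that divides `s ^ k ± 1`;
`fixGrid` = 3² · 5 · 7 · 13 · 17 is the least common multiple of these numbers for `s = 2, 4` and `k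
≤ 3`. The factor 16 in `solveFix` leaves room for rounding. -/
def iterateFix (s D : ℕ) (o : Trip) (c : SymCode) : ℕ → Trip
  | 0 => (0, 0, 0)
  | n + 1 => fixStep s D o c (iterateFix s D o c n)

/-- The solution `y` of the equation `s * y = o + g y`, found by approximation. -/
def solveFix (s : ℕ) (o : Trip) (c : SymCode) : Trip :=
  let t := iterateFix s (Nat.mul 16 fixGrid) o c 24
  (Nat.div (Nat.add t.1 8) 16, Nat.div (Nat.add t.2.1 8) 16, Nat.div (Nat.add t.2.2 8) 16)

/-- The point `t` solves the equation. -/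
def isFix (s : ℕ) (o : Trip) (c : SymCode) (t : Trip) : Bool :=
  Nat.beq (Nat.mul s t.1) (Nat.add (Nat.mul o.1 fixGrid) (c.apply fixGrid t).1) &&
  (Nat.beq (Nat.mul s t.2.1) (Nat.add (Nat.mul o.2.1 fixGrid) (c.apply fixGrid t).2.1) &&
    Nat.beq (Nat.mul s t.2.2) (Nat.add (Nat.mul o.2.2 fixGrid) (c.apply fixGrid t).2.2))

/-- Scaling a triple. -/
def Trip.scale (n : ℕ) (t : Trip) : Trip := (Nat.mul n t.1, Nat.mul n t.2.1, Nat.mul n t.2.2)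

/-- The solution is in the list, if its coordinates are in increasing order and the first one is
zero. -/
def fixOK (s : ℕ) (l : List Trip) (o : Trip) (c : SymCode) (t : Trip) : Bool :=
  isFix s o c t && (!(t.sorted && Nat.beq t.1 0) ||
    l.any fun v => (v.scale fixGrid).beq (t.scale gridSize))

theorem fixOK_half : (symCodes.all fun c =>
    fixOK 2 halfFixed (0, 0, 0) c (solveFix 2 (0, 0, 0) c)) = true := by
  decide +kernel

def octTrips : List Trip :=
  [(0, 0, 0), (1, 0, 0), (0, 1, 0), (1, 1, 0), (0, 0, 1), (1, 0, 1), (0, 1, 1), (1, 1, 1)]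

theorem fixOK_quarter : (octTrips.all fun o => symCodes.all fun c =>
    fixOK 4 quarterFixed o c (solveFix 4 o c)) = true := by
  decide +kernel

theorem Trip.beq_iff {s t : Trip} : s.beq t = true ↔ s = t := by
  obtain ⟨a, b, c⟩ := s
  obtain ⟨a', b', c'⟩ := t
  simp only [Trip.beq, Bool.and_eq_true, Nat.beq_eq, Prod.mk.injEq]

theorem Trip.sorted_iff {t : Trip} : t.sorted = true ↔ sel 0 t ≤ sel 1 t ∧ sel 1 t ≤ sel 2 t := by
  simp only [Trip.sorted, Bool.and_eq_true, Nat.ble_eq]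
  rfl

theorem Trip.sorted_of_point {N : ℕ} (hN : 0 < N) {t : Trip} (h : Monotone (t.point N)) :
    t.sorted = true := by
  have key : ∀ i j : Fin 3, i ≤ j → sel i t ≤ sel j t := fun i j hij => by
    have h1 := h hij
    have hN' : (0 : ℝ) < N := by positivity
    simp only [point] at h1
    rw [div_le_div_iff_of_pos_right hN'] at h1
    exact_mod_cast h1
  exact Trip.sorted_iff.2 ⟨key 0 1 (by decide), key 1 2 (by decide)⟩

theorem Trip.le_of_point {N : ℕ} (hN : 0 < N) {t : Trip} (h : ∀ k, t.point N k ≤ 1) : t.le N := by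
  intro k
  have h1 := h k
  have hN' : (0 : ℝ) < N := by positivity
  rw [point, div_le_one hN'] at h1
  exact_mod_cast h1

/-- At a coordinate with the largest difference, twice that difference is at most itself, so it
vanishes. -/
theorem eq_of_contraction {σ : Fin 3 → Fin 3} {y z : Fin 3 → ℝ}
    (h : ∀ k, 2 * |y k - z k| ≤ |y (σ k) - z (σ k)|) : y = z := by
  obtain ⟨p, hp⟩ := Finite.exists_max fun k => |y k - z k|
  have h1 := h p
  have h2 := hp (σ p)
  have h0 := abs_nonneg (y p - z p)
  funext k
  have h3 := hp k
  have h4 : |y k - z k| ≤ 0 := by linarith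
  have := abs_nonpos_iff.1 h4
  linarith

/-- The integer solution `t` yields a real solution of the same equation, and the solution is unique
because `g` preserves distances while `s ≥ 2`. Hence `y` is that solution, and the check places it
in the list. -/
theorem exists_of_fixOK {s : ℕ} (hs : 2 ≤ s) {l : List Trip} {o : Octant} {g : CubeSym} {t : Trip}
    (h : fixOK s l (octTrip o) g.code t = true) {y : Fin 3 → ℝ} (hy : Monotone y) (hy0 : y 0 = 0)
    (hfix : ∀ k, s * y k = (if o k then 1 else 0) + g.onPoint y k) :
    ∃ v ∈ l, y = v.point 510 := by
  rw [fixOK, Bool.and_eq_true] at h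
  obtain ⟨h1, h2⟩ := h
  have hs' : (2 : ℝ) ≤ s := by exact_mod_cast hs
  have h3 : ∀ k : Fin 3, s * sel k t = sel k (octTrip o) * 69615 +
      flipIf 69615 (g.flip k) (sel (g.perm k) t) := by
    simp only [isFix, Bool.and_eq_true, Nat.beq_eq] at h1
    intro k
    rw [← sel_apply]
    fin_cases k
    · exact h1.1
    · exact h1.2.1
    · exact h1.2.2
  -- Truncated subtraction is the true reflection only within the grid. A largest coordinate `c`
  -- above the grid size would satisfy `2 * c ≤ 69615 + c`, a contradiction.
  have hle : ∀ k : Fin 3, sel k t ≤ 69615 := by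
    obtain ⟨p, hp⟩ := Finite.exists_max fun k : Fin 3 => sel k t
    have h4 := h3 p
    have h5 : sel p (octTrip o) ≤ 1 := by
      rw [sel_octTrip]
      split_ifs <;> omega
    have h6 := hp (g.perm p)
    have h7 : flipIf 69615 (g.flip p) (sel (g.perm p) t) ≤ max 69615 (sel p t) := by
      cases g.flip p
      · exact h6.trans (le_max_right _ _)
      · exact (Nat.sub_le _ _).trans (le_max_left _ _)
    have h8 : 2 * sel p t ≤ s * sel p t := Nat.mul_le_mul_right _ hs
    have h9 : sel p t ≤ 69615 := by
      by_contra hc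
      rw [max_eq_right (by omega)] at h7
      omega
    exact fun k => (hp k).trans h9
  have h4 : y = t.point 69615 := by
    refine eq_of_contraction (σ := g.perm) fun k => ?_
    have e1 := hfix k
    have e2 : (s : ℝ) * t.point 69615 k = (if o k then 1 else 0) + g.onPoint (t.point 69615) k := by
      rw [← point_apply (by norm_num) g hle]
      simp only [Trip.point]
      rw [sel_apply]
      have := h3 k
      rw [sel_octTrip] at this
      have h5 : (s : ℝ) * sel k t = (if o k then 1 else 0) * 69615 +
          (flipIf 69615 (g.flip k) (sel (g.perm k) t) : ℕ) := by
        exact_mod_cast this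
      rw [← mul_div_assoc, h5]
      push_cast
      rw [add_div, mul_div_cancel_right₀ _ (by norm_num)]
    have e3 : g.onPoint y k - g.onPoint (t.point 69615) k = s * (y k - t.point 69615 k) := by
      linear_combination e2 - e1
    rw [← abs_onPoint_sub, e3, abs_mul, Nat.abs_cast]
    exact mul_le_mul_of_nonneg_right hs' (abs_nonneg _)
  have h5 : (t.sorted && Nat.beq t.1 0) = true := by
    rw [Bool.and_eq_true]
    refine ⟨Trip.sorted_of_point (N := 69615) (by norm_num) (by rwa [← h4]), ?_⟩
    rw [h4] at hy0
    simp only [Trip.point] at hy0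
    rw [div_eq_zero_iff] at hy0
    rw [Nat.beq_eq]
    rcases hy0 with h | h
    · exact_mod_cast h
    · norm_num at h
  rw [h5, Bool.not_true, Bool.false_or, List.any_eq_true] at h2
  obtain ⟨v, hv, h6⟩ := h2
  rw [Trip.beq_iff] at h6
  refine ⟨v, hv, ?_⟩
  rw [h4]
  funext k
  have h7 : sel k v * 69615 = sel k t * 510 := by
    have := congrArg (sel k) h6
    fin_cases k <;> simpa [Trip.scale, sel, mul_comm] using this
  simp only [Trip.point]
  rw [div_eq_div_iff (by norm_num) (by norm_num)]
  exact_mod_cast h7.symm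

theorem octTrip_mem (o : Octant) : octTrip o ∈ octTrips := by
  have : ∀ o : Octant, octTrip o ∈ octTrips := by decide
  exact this o

theorem exists_halfFixed {g : CubeSym} {y : Fin 3 → ℝ} (hy : Monotone y) (hy0 : y 0 = 0)
    (hfix : ∀ k, 2 * y k = g.onPoint y k) :
    ∃ v ∈ halfFixed, y = v.point 510 := by
  refine exists_of_fixOK (s := 2) le_rfl (o := fun _ => false)
    (List.all_eq_true.1 fixOK_half _ g.code_mem) hy hy0 fun k => ?_
  simpa using hfix k

theorem exists_quarterFixed {o : Octant} {g : CubeSym} {y : Fin 3 → ℝ} (hy : Monotone y)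
    (hy0 : y 0 = 0)
    (hfix : ∀ k, 4 * y k = (if o k then 1 else 0) + g.onPoint y k) :
    ∃ v ∈ quarterFixed, y = v.point 510 := by
  refine exists_of_fixOK (s := 4) (by norm_num)
    (List.all_eq_true.1 (List.all_eq_true.1 fixOK_quarter _ (octTrip_mem o)) _ g.code_mem)
    hy hy0 fun k => ?_
  exact_mod_cast hfix k

end MonoHilbert

namespace MonoHilbert

/-! ## The classification of pairs of gates -/

instance (N : ℕ) (t : Trip) : Decidable (t.le N) :=
  inferInstanceAs (Decidable (∀ k : Fin 3, sel k t ≤ N))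

theorem Rule.exists_path {R : Rule} (hR : R.Linked) : ∃ y : Fin 9 → Fin 3 → ℝ,
    y 0 = R.gates false ∧ y (Fin.last 8) = R.gates true ∧
      ∀ i, Segment R.gates (R.octant i) (y i.castSucc) (y i.succ) := by
  refine ⟨Fin.cons (R.gates false) fun i => R.gate i true, rfl, (R.gates_eq true).symm,
    fun i => ⟨R.motion i, ?_, rfl⟩⟩
  refine Fin.cases ?_ (fun i => ?_) i
  · exact R.gates_eq false
  · rw [Fin.castSucc_succ, Fin.cons_succ]
    exact hR i

theorem encode_point {t : Trip} (h : t.le 510) : encode (t.point 510) = 2 * pack t := by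
  rw [← codePoint_two_mul_pack h, encode_codePoint]

theorem pack_injective {s t : Trip} (hs : s.le 510) (ht : t.le 510) (h : pack s = pack t) :
    s = t := by
  rw [← unpack_pack (hs.mono (by norm_num)), h, unpack_pack (ht.mono (by norm_num))]

section known

variable {R : Rule} (hR : R.Linked) {e x : Trip} (hw : R.gates = pairPoints e x)

include hw

theorem le_of_gates_eq : e.le 510 ∧ x.le 510 := by
  constructor
  · refine Trip.le_of_point (by norm_num) fun k => ?_
    have := (R.gates_mem_Icc false k).2
    rw [hw] at this
    exact this
  · refine Trip.le_of_point (by norm_num) fun k => ?_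
    have := (R.gates_mem_Icc true k).2
    rw [hw] at this
    exact this

include hR

theorem noWalks_eq_false : noWalks e x = false := by
  obtain ⟨he, hx⟩ := le_of_gates_eq hw
  obtain ⟨y, h0, h8, hy⟩ := R.exists_path hR
  rw [hw] at hy h0 h8
  change y 0 = e.point 510 at h0
  change y (Fin.last 8) = x.point 510 at h8
  have hlast : (octIndex (R.octant 7), encode (y 7)) ∈
      neighbors (images e x) (Nat.mul 2 (pack x)) := by
    have := mem_neighbors_of_segment he hx (hy 7).symm
    change (_, encode (y 7)) ∈ neighbors (images e x) (encode (y (Fin.last 8))) at this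
    rw [h8, encode_point hx] at this
    exact this
  have h := mem_walks_of_segments he hx R.octant.injective hy
    (fin := finalOctants (images e x) (Nat.mul 2 (pack x)))
    (target := Nat.beq (Nat.mul 2 (pack x)))
    (by
      rw [h8, encode_point hx, Nat.beq_eq]
      rfl)
    (fun i hi => by
      have : i = 7 := Fin.succ_injective _ hi
      subst this
      exact testBit_finalOctants hlast)
  rw [h0, encode_point he] at h
  rw [noWalks, List.isEmpty_eq_false_iff]
  exact List.ne_nil_of_mem h

/-- The first five octants of a linked rule form such a walk. The mask 255 contains all octants, so
nothing is pruned. -/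
theorem exists_walk_five :
    (walks (neighbors (images e x)) 255 (fun _ => true) 5 0 (Nat.mul 2 (pack e))).isEmpty =
      false := by
  obtain ⟨he, hx⟩ := le_of_gates_eq hw
  obtain ⟨y, h0, -, hy⟩ := R.exists_path hR
  rw [hw] at hy h0
  change y 0 = e.point 510 at h0
  have h := mem_walks_of_segments he hx (n := 5)
    (o := fun i => R.octant (i.castLE (by norm_num : 5 ≤ 8)))
    (R.octant.injective.comp (Fin.castLE_injective (by norm_num : 5 ≤ 8)))
    (y := fun i => y (i.castLE (by norm_num : 6 ≤ 9)))
    (fun i => hy (i.castLE (by norm_num : 5 ≤ 8)))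
    (fin := 255) (target := fun _ => true) rfl
    (fun i _ => by
      have : ∀ k < 8, (255 : ℕ).testBit k = true := by decide
      exact this _ (octIndex_lt _))
  have e0 : y (Fin.castLE (by norm_num : 6 ≤ 9) (0 : Fin 6)) = e.point 510 := h0
  rw [e0, encode_point he] at h
  rw [List.isEmpty_eq_false_iff]
  exact List.ne_nil_of_mem h

theorem exists_known (h : pairOK e x = true) : ∃ a ∈ typePairs ++ spuriousPairs, ∃ τ : Motion,
    τ.onGates (pairPoints a.1 a.2) = pairPoints e x := by
  obtain ⟨he, hx⟩ := le_of_gates_eq hw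
  rw [pairOK, exists_walk_five hR hw, Bool.false_or, List.any_eq_true] at h
  obtain ⟨a, ha, h⟩ := h
  have hle : ∀ a ∈ typePairs ++ spuriousPairs, a.1.le 510 ∧ a.2.le 510 := by decide
  obtain ⟨ha1, ha2⟩ := hle a ha
  refine ⟨a, ha, ?_⟩
  rw [isImageOf, List.any_eq_true] at h
  obtain ⟨b, hb, h⟩ := h
  obtain ⟨g, h1, h2⟩ := mem_images (u := b.1) (v := b.2) |>.1 hb
  have key : (b.1 = pack e ∧ b.2 = pack x) ∨ (b.2 = pack e ∧ b.1 = pack x) := by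
    simpa only [Bool.or_eq_true, Bool.and_eq_true, Nat.beq_eq] using h
  rw [h1, h2] at key
  rcases key with ⟨h3, h4⟩ | ⟨h3, h4⟩
  · have h5 := pack_injective (Trip.le_apply g ha1) he h3
    have h6 := pack_injective (Trip.le_apply g ha2) hx h4
    refine ⟨⟨g, false⟩, ?_⟩
    funext c
    rw [onGates_pairPoints ha1 ha2]
    cases c
    · simp [h5, pairPoints]
    · simp [h6, pairPoints]
  · have h5 := pack_injective (Trip.le_apply g ha2) he h3
    have h6 := pack_injective (Trip.le_apply g ha1) hx h4
    refine ⟨⟨g, true⟩, ?_⟩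
    funext c
    rw [onGates_pairPoints ha1 ha2]
    cases c
    · simp [h5, pairPoints]
    · simp [h6, pairPoints]

end known

theorem GateType.gates_eq (t : GateType) : t.gates = pairPoints t.trips.1 t.trips.2 := by
  funext b k
  cases t <;> cases b <;> fin_cases k <;>
    simp [gates, pairPoints, entrance, exit, trips, Trip.point, sel] <;> norm_num

/-- The rule has the gates of one of the six types, up to a motion. -/
def Rule.IsTyped (R : Rule) : Prop := ∃ (t : GateType) (τ : Motion), τ.onGates R.gates = t.gates

theorem Rule.IsTyped.of_move {R : Rule} {τ : Motion} (h : (R.move τ).IsTyped) : R.IsTyped := by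
  obtain ⟨t, σ, h⟩ := h
  rw [gates_move, ← Motion.mul_onGates] at h
  exact ⟨t, _, h⟩

theorem noWalks_spuriousPairs : (spuriousPairs.all fun p => noWalks p.1 p.2) = true := by
  decide +kernel

/-- A linked rule has a walk of length five, so its gates are images of a listed pair; the spurious
pairs are excluded because a linked rule also has a complete walk. -/
theorem isTyped_of_pairOK {R : Rule} (hR : R.Linked) {e x : Trip} (hw : R.gates = pairPoints e x)
    (h : pairOK e x = true) : R.IsTyped := by
  obtain ⟨a, ha, τ, hτ⟩ := exists_known hR hw h
  rw [← hw] at hτ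
  rcases List.mem_append.1 ha with ha | ha
  · obtain ⟨t, -, rfl⟩ := List.mem_map.1 ha
    rw [← GateType.gates_eq] at hτ
    exact ⟨t, τ⁻¹, by rw [← hτ, Motion.inv_onGates_onGates]⟩
  · have h1 : (R.move τ⁻¹).gates = pairPoints a.1 a.2 := by
      rw [Rule.gates_move, ← hτ, Motion.inv_onGates_onGates]
    have h2 := noWalks_eq_false (Rule.linked_move hR _) h1
    have h3 := List.all_eq_true.1 noWalks_spuriousPairs a ha
    rw [h2] at h3
    cases h3

/-- A point common to two different octants lies in a plane that separates them, hence on the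
boundary of each octant; pulled back to the cube, it is a gate on the boundary of the cube. -/
theorem Rule.Linked.boundary {R : Rule} (hR : R.Linked) (b : Bool) :
    ∃ k, R.gates b k = 0 ∨ R.gates b k = 1 := by
  have key : ∀ (i j : Fin 8) (a c : Bool), i ≠ j → R.gate i a = R.gate j c →
      ∃ k, R.gates (xor a (R.motion i).rev) k = 0 ∨ R.gates (xor a (R.motion i).rev) k = 1 := by
    intro i j a c hij h
    obtain ⟨k, hk⟩ := Function.ne_iff.1 (R.octant.injective.ne hij)
    refine ⟨(R.motion i).sym.perm k, ?_⟩
    have h1 := congrFun h k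
    have hi := R.gates_mem_Icc (xor a (R.motion i).rev) ((R.motion i).sym.perm k)
    have hj := R.gates_mem_Icc (xor c (R.motion j).rev) ((R.motion j).sym.perm k)
    simp only [gate, scaleTo, Motion.onGates, CubeSym.onPoint, CubeSym.act] at h1
    cases h2 : R.octant i k <;> cases h3 : R.octant j k
    · simp [h2, h3] at hk
    · rw [h2, h3] at h1
      simp only [Bool.false_eq_true, if_false, if_true] at h1
      split_ifs at h1
      · left; linarith
      · left; linarith
      · right; linarith
      · right; linarith
    · rw [h2, h3] at h1
      simp only [Bool.false_eq_true, if_false, if_true] at h1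
      split_ifs at h1
      · right; linarith
      · right; linarith
      · left; linarith
      · left; linarith
    · simp [h2, h3] at hk
  -- The octant with index 1 has neighbours on both sides, so its two gates account for both gates
  -- of the cube; its reversal decides which is which.
  have h0 := key 1 0 false true (by decide) (hR 0).symm
  have h1 := key 1 2 true false (by decide) (hR 1)
  cases b <;> cases h : (R.motion 1).rev <;> rw [h] at h0 h1
  · exact h0
  · exact h1
  · exact h1
  · exact h0

theorem orbitOf_cons (t : Trip) (d : SymCode) (l : List SymCode) :
    orbitOf t (d :: l) = @Bool.rec (fun _ => List Trip) (d.apply gridSize t :: orbitOf t l)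
      (orbitOf t l) ((orbitOf t l).any (d.apply gridSize t).beq) := rfl

theorem apply_mem_orbitOf {t : Trip} {l : List SymCode} {c : SymCode} (hc : c ∈ l) :
    c.apply gridSize t ∈ orbitOf t l := by
  induction l with
  | nil => cases hc
  | cons d l ih =>
    rw [orbitOf_cons]
    cases h : (orbitOf t l).any (d.apply gridSize t).beq
    · rcases List.mem_cons.1 hc with rfl | hc
      · exact List.mem_cons_self
      · exact List.mem_cons_of_mem _ (ih hc)
    · rcases List.mem_cons.1 hc with rfl | hc
      · obtain ⟨s, hs, h⟩ := List.any_eq_true.1 h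
        rw [Trip.beq_iff] at h
        rw [h]
        exact hs
      · exact ih hc

theorem apply_mem_orbit (g : CubeSym) (t : Trip) : g.code.apply gridSize t ∈ orbit t :=
  apply_mem_orbitOf g.code_mem

/-! ### Exhaustive checks of the candidate pairs of gates -/

theorem checkHalfHalf_zero : checkHalfHalf (0, 0, 0) = true := by decide +kernel

theorem checkHalfHalf_third : checkHalfHalf (0, 0, 170) = true := by decide +kernel

theorem checkHalfHalf_thirds : checkHalfHalf (0, 170, 170) = true := by decide +kernel

theorem checkHalfHalf_fifths : checkHalfHalf (0, 102, 204) = true := by decide +kernel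

theorem checkDoubleHalf_all : halfFixed.all checkDoubleHalf = true := by decide +kernel

theorem checkQuarter_take : (quarterFixed.take 5).all checkQuarter = true := by decide +kernel

theorem checkQuarter_drop : (quarterFixed.drop 5).all checkQuarter = true := by decide +kernel

theorem checkHalfHalf_of_mem {v : Trip} (hv : v ∈ halfFixed) : checkHalfHalf v = true := by
  simp only [halfFixed, List.mem_cons, List.not_mem_nil, or_false] at hv
  rcases hv with rfl | rfl | rfl | rfl
  · exact checkHalfHalf_zero
  · exact checkHalfHalf_third
  · exact checkHalfHalf_thirds
  · exact checkHalfHalf_fifths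

theorem checkQuarter_of_mem {v : Trip} (hv : v ∈ quarterFixed) : checkQuarter v = true := by
  rw [← List.take_append_drop 5 quarterFixed, List.mem_append] at hv
  rcases hv with hv | hv
  · exact List.all_eq_true.1 checkQuarter_take v hv
  · exact List.all_eq_true.1 checkQuarter_drop v hv

/-- A point that is fixed by a contraction to an octant, if it is on the boundary. -/
theorem exists_of_scaleTo_fixed {o : Octant} {g : CubeSym} {x : Fin 3 → ℝ}
    (h : x = scaleTo o (g.onPoint x)) (h1 : ∃ k, x k = 0 ∨ x k = 1)
    (h2 : ∀ k, 0 ≤ x k ∧ x k ≤ 1) :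
    ∃ v ∈ halfFixed, ∃ s : CubeSym, x = s.onPoint (v.point 510) := by
  let f : CubeSym := ⟨Equiv.refl _, o⟩
  let s : CubeSym := ⟨Tuple.sort (f.onPoint x), fun _ => false⟩
  have hf : f.onOctant o = fun _ => false := by
    funext k
    cases h : o k <;> simp [CubeSym.onOctant, CubeSym.act, f, h]
  have hs : s.onOctant (fun _ => false) = fun _ => false := by
    funext k
    simp [CubeSym.onOctant, CubeSym.act, s]
  have hm : Monotone ((s * f).onPoint x) := by
    rw [CubeSym.mul_onPoint]
    have : s.onPoint (f.onPoint x) = f.onPoint x ∘ Tuple.sort (f.onPoint x) := by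
      funext k
      rfl
    rw [this]
    exact Tuple.monotone_sort _
  have h3 : (s * f).onPoint x = scaleTo (fun _ => false)
      (((s * f) * g * (s * f)⁻¹).onPoint ((s * f).onPoint x)) := by
    have h10 : (s * f).onOctant o = fun _ => false := by rw [CubeSym.mul_onOctant, hf, hs]
    conv_lhs => rw [h]
    rw [onPoint_scaleTo, h10, ← CubeSym.mul_onPoint, ← CubeSym.mul_onPoint, inv_mul_cancel_right]
  have h4 : ∀ k, 2 * (s * f).onPoint x k =
      ((s * f) * g * (s * f)⁻¹).onPoint ((s * f).onPoint x) k := by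
    intro k
    have := congrFun h3 k
    simp only [scaleTo, Bool.false_eq_true, if_false] at this
    linarith
  have h5 : ∀ (g : CubeSym) (z : Fin 3 → ℝ), (∀ k, 0 ≤ z k ∧ z k ≤ 1) →
      ∀ k, 0 ≤ g.onPoint z k ∧ g.onPoint z k ≤ 1 := by
    intro g z hz k
    have := hz (g.perm k)
    simp only [CubeSym.onPoint, CubeSym.act]
    split_ifs <;> constructor <;> linarith
  have h6 := h5 (s * f) x h2
  have h7 := h5 ((s * f) * g * (s * f)⁻¹) _ h6
  have h8 : ∃ k, (s * f).onPoint x k = 0 ∨ (s * f).onPoint x k = 1 := by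
    obtain ⟨k, hk⟩ := h1
    refine ⟨(s * f).perm.symm k, ?_⟩
    simp only [CubeSym.onPoint, CubeSym.act, Equiv.apply_symm_apply]
    split_ifs
    · rcases hk with hk | hk
      · right; linarith
      · left; linarith
    · exact hk
  -- After `f` moves the octant to the origin and `s` sorts the coordinates, the fixed point
  -- equation bounds each coordinate by 1/2. The boundary coordinate is thus 0, and so is the
  -- smallest one.
  have h9 : (s * f).onPoint x 0 = 0 := by
    obtain ⟨k, hk⟩ := h8
    have a1 := h4 k
    have a2 := h7 k
    have a3 := hm (Fin.zero_le k)
    have a4 := h6 0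
    rcases hk with hk | hk <;> linarith
  obtain ⟨v, hv, e⟩ := exists_halfFixed hm h9 h4
  refine ⟨v, hv, (s * f)⁻¹, ?_⟩
  rw [← e, ← CubeSym.mul_onPoint, inv_mul_cancel, CubeSym.one_onPoint]

/-- The classification for rules whose first octant and gates are in a special position. -/
theorem isTyped_of_normalized {R : Rule} (hR : R.Linked) (h0 : R.octant 0 = fun _ => false)
    (hm : Monotone (R.gates false)) (hr : ¬ (R.rev 0 = false ∧ R.rev 7 = true)) : R.IsTyped := by
  have hI := R.gates_mem_Icc
  have hE : ∀ k, 2 * R.gates false k = (R.sym 0).onPoint (R.gates (R.rev 0)) k := by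
    intro k
    have := congrFun (R.gates_eq false) k
    simp only [Rule.gate, Rule.endIndex, Bool.false_eq_true, if_false, scaleTo, h0, Motion.onGates,
      Rule.motion, Bool.false_xor] at this
    linarith
  have hX : R.gates true = scaleTo (R.octant 7) ((R.sym 7).onPoint (R.gates (!R.rev 7))) := by
    have := R.gates_eq true
    simpa [Rule.gate, Rule.endIndex, Motion.onGates, Rule.motion] using this
  have hhalf : ∀ k, R.gates false k ≤ 1 / 2 := by
    intro k
    have h1 := hE k
    have h2 := hI (R.rev 0) ((R.sym 0).perm k)
    simp only [CubeSym.onPoint, CubeSym.act] at h1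
    split_ifs at h1 <;> linarith
  -- The entrance gate lies in the octant at the origin, so on the boundary of the cube only a
  -- coordinate 0 is possible, and the coordinates are sorted.
  have hz : R.gates false 0 = 0 := by
    obtain ⟨k, hk⟩ := hR.boundary false
    have h1 := hhalf k
    have h2 := hm (Fin.zero_le k)
    have h3 := hI false 0
    rcases hk with hk | hk <;> linarith
  have hpair : ∀ e x : Trip, R.gates false = e.point 510 → R.gates true = x.point 510 →
      R.gates = pairPoints e x := by
    intro e x h1 h2
    funext b
    cases b
    · exact h1
    · exact h2
  have hlehalf : ∀ v ∈ halfFixed, v.le 510 := by decide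
  cases hr0 : R.rev 0
  -- Neither end octant is reversed: both gates are fixed separately by a contraction.
  · have hr7 : R.rev 7 = false := by
      by_contra h
      exact hr ⟨hr0, by simpa using h⟩
    rw [hr0] at hE
    rw [hr7, Bool.not_false] at hX
    obtain ⟨v, hv, e1⟩ := exists_halfFixed hm hz hE
    obtain ⟨u, hu, s, e2⟩ := exists_of_scaleTo_fixed hX (hR.boundary true) (hI true)
    rw [← point_apply (by norm_num) s (hlehalf u hu)] at e2
    refine isTyped_of_pairOK hR (hpair _ _ e1 e2) ?_
    have h1 := checkHalfHalf_of_mem hv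
    rw [checkHalfHalf, List.all_eq_true] at h1
    exact List.all_eq_true.1 (h1 u hu) _ (apply_mem_orbit s u)
  · rw [hr0] at hE
    cases hr7 : R.rev 7
    -- Only the first octant is reversed: the exit gate is fixed by a contraction, and twice the
    -- entrance gate is an image of the exit gate.
    · rw [hr7, Bool.not_false] at hX
      obtain ⟨u, hu, s, e2⟩ := exists_of_scaleTo_fixed hX (hR.boundary true) (hI true)
      have h1 := List.all_eq_true.1 checkDoubleHalf_all u hu
      rw [checkDoubleHalf, List.all_eq_true] at h1
      have h2 := h1 _ (apply_mem_orbit (R.sym 0 * s) u)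
      have e3 : ∀ k, 2 * R.gates false k =
          ((R.sym 0 * s).code.apply 510 u).point 510 k := by
        intro k
        rw [hE, e2, ← CubeSym.mul_onPoint, point_apply (by norm_num) _ (hlehalf u hu)]
      have h3 : ((R.sym 0 * s).code.apply 510 u).sorted = true := by
        refine Trip.sorted_of_point (N := 510) (by norm_num) fun i j hij => ?_
        rw [← e3, ← e3]
        have := hm hij
        linarith
      rw [h3, Bool.not_true, Bool.false_or, Bool.and_eq_true] at h2
      obtain ⟨h4, h5⟩ := h2
      rw [Trip.beq_iff] at h4
      rw [← point_apply (by norm_num) s (hlehalf u hu)] at e2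
      have e1 : R.gates false = ((R.sym 0 * s).code.apply 510 u).half.point 510 := by
        funext k
        have h6 := e3 k
        have h7 : sel k ((R.sym 0 * s).code.apply 510 u) =
            sel k ((R.sym 0 * s).code.apply 510 u).half * 2 := by
          conv_lhs => rw [← h4]
          fin_cases k <;> rfl
        rw [Trip.point, h7] at h6
        rw [Trip.point]
        push_cast at h6 ⊢
        linarith
      refine isTyped_of_pairOK hR (hpair _ _ e1 e2) ?_
      exact List.all_eq_true.1 h5 _ (apply_mem_orbit s u)
    -- Both end octants are reversed: each gate determines the other, and substituting one equation
    -- in the other gives the factor 4 for the entrance gate.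
    · rw [hr7, Bool.not_true] at hX
      have hfix : ∀ k, 4 * R.gates false k =
          (if (R.sym 0).onOctant (R.octant 7) k then 1 else 0) +
            (R.sym 0 * R.sym 7).onPoint (R.gates false) k := by
        intro k
        have h1 := hE k
        rw [hX, onPoint_scaleTo, ← CubeSym.mul_onPoint, scaleTo] at h1
        linarith
      obtain ⟨v, hv, e1⟩ := exists_quarterFixed hm hz hfix
      have hle : v.double.le 510 := by
        have h2 : ∀ k : Fin 3, sel k v.double = sel k v * 2 := fun k => by fin_cases k <;> rfl
        intro k
        have h3 := hhalf k
        rw [e1, Trip.point, div_le_div_iff₀ (by norm_num) (by norm_num)] at h3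
        rw [h2]
        push_cast at h3
        exact_mod_cast (by linarith : (sel k v : ℝ) * 2 ≤ 510)
      have e2 : R.gates true = ((R.sym 0)⁻¹.code.apply 510 v.double).point 510 := by
        rw [point_apply (by norm_num) _ hle]
        apply (R.sym 0).onPoint_injective
        rw [← CubeSym.mul_onPoint, mul_inv_cancel, CubeSym.one_onPoint]
        funext k
        rw [← hE, e1]
        have h2 : sel k v.double = sel k v * 2 := by fin_cases k <;> rfl
        simp only [Trip.point]
        rw [h2]
        push_cast
        ring
      refine isTyped_of_pairOK hR (hpair _ _ e1 e2) ?_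
      have h1 := checkQuarter_of_mem hv
      exact List.all_eq_true.1 h1 _ (apply_mem_orbit _ _)

theorem isTyped_of_octant {R : Rule} (hR : R.Linked) (h0 : R.octant 0 = fun _ => false)
    (hr : ¬ (R.rev 0 = false ∧ R.rev 7 = true)) : R.IsTyped := by
  let s : CubeSym := ⟨Tuple.sort (R.gates false), fun _ => false⟩
  refine Rule.IsTyped.of_move (τ := ⟨s, false⟩) ?_
  refine isTyped_of_normalized (Rule.linked_move hR _) ?_ ?_ hr
  · rw [Rule.move_octant]
    change s.onOctant (R.octant 0) = _
    rw [h0]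
    funext k
    simp [CubeSym.onOctant, CubeSym.act, s]
  · rw [Rule.gates_move]
    have : (⟨s, false⟩ : Motion).onGates R.gates false =
        R.gates false ∘ Tuple.sort (R.gates false) := by
      funext k
      simp [Motion.onGates, CubeSym.onPoint, CubeSym.act, s]
    rw [this]
    exact Tuple.monotone_sort _

theorem isTyped_of_rev {R : Rule} (hR : R.Linked) (hr : ¬ (R.rev 0 = false ∧ R.rev 7 = true)) :
    R.IsTyped := by
  let f : CubeSym := ⟨Equiv.refl _, R.octant 0⟩
  refine Rule.IsTyped.of_move (τ := ⟨f, false⟩) ?_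
  refine isTyped_of_octant (Rule.linked_move hR _) ?_ hr
  rw [Rule.move_octant]
  funext k
  change f.onOctant (R.octant 0) k = false
  cases h : R.octant 0 k <;> simp [CubeSym.onOctant, CubeSym.act, f, h]

theorem Rule.Linked.isTyped {R : Rule} (hR : R.Linked) : R.IsTyped := by
  by_cases hr : R.rev 0 = false ∧ R.rev 7 = true
  · refine Rule.IsTyped.of_move (τ := ⟨1, true⟩) ?_
    refine isTyped_of_rev (Rule.linked_move hR _) fun h => ?_
    have h1 : R.rev 7 = false := h.1
    rw [hr.2] at h1
    cases h1
  · exact isTyped_of_rev hR hr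

end MonoHilbert

namespace MonoHilbert

/-! ## Connection schemes as walks -/

theorem card_eq_length {α β : Type} {l : List β} (hl : l.Nodup) {f : α → β}
    (hf : Function.Injective f) (h : ∀ b, b ∈ l ↔ ∃ a, f a = b) :
    Finite α ∧ Nat.card α = l.length := by
  classical
  have e : α ≃ {b // b ∈ l} := Equiv.ofBijective (fun a => ⟨f a, (h _).2 ⟨a, rfl⟩⟩)
    ⟨fun a b hab => hf (congrArg Subtype.val hab), fun b => by
      obtain ⟨a, ha⟩ := (h _).1 b.2
      exact ⟨a, Subtype.ext ha⟩⟩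
  have e' := e.trans (List.Nodup.getEquiv l hl).symm
  exact ⟨Finite.of_equiv _ e'.symm, by rw [Nat.card_congr e', Nat.card_fin]⟩

theorem CubeSym.code_injective : Function.Injective CubeSym.code := by
  intro g h e
  have h1 : ∀ k, g.perm k = h.perm k := by
    intro k
    simp only [code, Prod.mk.injEq] at e
    refine Fin.ext ?_
    fin_cases k
    · exact e.1.1
    · exact e.1.2.1
    · exact e.1.2.2
  have h2 : ∀ k, g.flip k = h.flip k := by
    intro k
    simp only [code, Prod.mk.injEq] at e
    fin_cases k
    · exact e.2.1
    · exact e.2.2.1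
    · exact e.2.2.2
  cases g
  cases h
  simp only [CubeSym.mk.injEq]
  exact ⟨Equiv.ext h1, funext h2⟩

/-- A motion, given by the code of its symmetry, maps the gates of type `t` to those of type
`t'`. -/
def mapsGates (t t' : GateType) (c : SymCode × Bool) : Bool :=
  Trip.beq (c.1.apply gridSize (cond c.2 t.trips.2 t.trips.1)) t'.trips.1 &&
    Trip.beq (c.1.apply gridSize (cond c.2 t.trips.1 t.trips.2)) t'.trips.2

namespace GateType

theorem le_trips (t : GateType) : t.trips.1.le 510 ∧ t.trips.2.le 510 := by
  cases t <;> decide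

theorem onGates_gates_eq_iff {t t' : GateType} {τ : Motion} :
    τ.onGates t.gates = t'.gates ↔ mapsGates t t' (τ.sym.code, τ.rev) = true := by
  have h := Trip.point_injective (N := 510) (by norm_num)
  have h1 : ∀ b, τ.onGates t.gates b =
      (τ.sym.code.apply 510 (if xor b τ.rev then t.trips.2 else t.trips.1)).point 510 := fun b => by
    rw [gates_eq, onGates_pairPoints t.le_trips.1 t.le_trips.2]
  rw [mapsGates, Bool.and_eq_true, Trip.beq_iff, Trip.beq_iff, funext_iff, Bool.forall_bool, h1, h1,
    t'.gates_eq]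
  change Trip.point 510 _ = Trip.point 510 _ ∧ Trip.point 510 _ = Trip.point 510 _ ↔ _
  rw [h.eq_iff, h.eq_iff]
  cases τ.rev <;> rfl

def motionCodes : List (SymCode × Bool) :=
  symCodes.flatMap fun c => [(c, false), (c, true)]

theorem _root_.MonoHilbert.Motion.mem_motionCodes (τ : Motion) :
    (τ.sym.code, τ.rev) ∈ motionCodes := by
  refine List.mem_flatMap.2 ⟨_, τ.sym.code_mem, ?_⟩
  cases τ.rev <;> simp

theorem exists_motion_code {c : SymCode × Bool} (h : c ∈ motionCodes) :
    ∃ τ : Motion, (τ.sym.code, τ.rev) = c := by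
  obtain ⟨d, hd, h⟩ := List.mem_flatMap.1 h
  obtain ⟨g, rfl⟩ := exists_code_eq hd
  simp only [List.mem_cons, List.not_mem_nil, or_false] at h
  rcases h with rfl | rfl
  · exact ⟨⟨g, false⟩, rfl⟩
  · exact ⟨⟨g, true⟩, rfl⟩

theorem nodup_motionCodes : motionCodes.Nodup := by
  decide +kernel

theorem card_stabilizer (t : GateType) : Finite t.stabilizer ∧
    Nat.card t.stabilizer = (motionCodes.filter (mapsGates t t)).length := by
  refine card_eq_length (nodup_motionCodes.filter _) (f := fun τ => (τ.1.sym.code, τ.1.rev)) ?_ ?_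
  · intro τ σ h
    simp only [Prod.mk.injEq] at h
    exact Subtype.ext (Motion.ext (CubeSym.code_injective h.1) h.2)
  · intro c
    rw [List.mem_filter]
    constructor
    · rintro ⟨h1, h2⟩
      obtain ⟨τ, rfl⟩ := exists_motion_code h1
      exact ⟨⟨τ, onGates_gates_eq_iff.2 h2⟩, rfl⟩
    · rintro ⟨τ, rfl⟩
      exact ⟨τ.1.mem_motionCodes, onGates_gates_eq_iff.1 τ.2⟩

/-- All 96 motions are tested for every ordered pair of different types. This makes the type of a
curve unique. -/
theorem eq_of_onGates_gates {t t' : GateType} {τ : Motion} (h : τ.onGates t.gates = t'.gates) :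
    t = t' := by
  have key : ∀ t t' : GateType, t = t' ∨ motionCodes.any (mapsGates t t') = false := by
    intro t t'
    cases t <;> cases t' <;> first
      | exact Or.inl rfl
      | exact Or.inr (by decide +kernel)
  rcases key t t' with h1 | h1
  · exact h1
  · rw [onGates_gates_eq_iff] at h
    have := List.any_eq_true.2 ⟨_, τ.mem_motionCodes, h⟩
    rw [h1] at this
    cases this

end GateType

/-- The walks that represent the connection schemes of a type. -/
noncomputable def schemeWalks (tr : Tree) (t : GateType) : List (List (ℕ × ℕ)) :=
  walks (memo (neighbors (images t.trips.1 t.trips.2)) tr)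
    (finalOctants (images t.trips.1 t.trips.2) (Nat.mul 2 (pack t.trips.2)))
    (Nat.beq (Nat.mul 2 (pack t.trips.2))) 8 0 (Nat.mul 2 (pack t.trips.1))

noncomputable def schemeCount (tr : Tree) (t : GateType) : ℕ :=
  walkCount (memo (neighbors (images t.trips.1 t.trips.2)) tr)
    (finalOctants (images t.trips.1 t.trips.2) (Nat.mul 2 (pack t.trips.2)))
    (Nat.beq (Nat.mul 2 (pack t.trips.2))) 8 0 (Nat.mul 2 (pack t.trips.1))

theorem schemeCount_eq (tr : Tree) (t : GateType) : schemeCount tr t = (schemeWalks tr t).length :=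
  walkCount_eq _ _ _

theorem nodup_schemeWalks (tr : Tree) (t : GateType) : (schemeWalks tr t).Nodup := by
  refine nodup_walks (fun p => ?_) _ _ _
  rw [memo_eq]
  exact nodup_neighbors _ _

namespace ConnectionScheme

variable {t : GateType}

theorem segment (s : ConnectionScheme t) (i : Fin 8) :
    Segment (pairPoints t.trips.1 t.trips.2) (s.octant i) (s.gate i.castSucc) (s.gate i.succ) := by
  obtain ⟨τ, h⟩ := s.exists_motion i
  rw [t.gates_eq] at h
  exact ⟨τ, (h false).symm, (h true).symm⟩

theorem exists_gate_eq (s : ConnectionScheme t) (j : Fin 9) :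
    ∃ u : Trip, u.le 1020 ∧ s.gate j = codePoint (pack u) := by
  refine Fin.lastCases ?_ (fun i => ?_) j
  · exact exists_codePoint_eq t.le_trips.1 t.le_trips.2 (s.segment 7).symm
  · exact exists_codePoint_eq t.le_trips.1 t.le_trips.2 (s.segment i)

theorem gate_zero (s : ConnectionScheme t) : s.gate 0 = t.trips.1.point 510 := by
  rw [s.gate_first]
  exact congrFun t.gates_eq false

theorem gate_eight (s : ConnectionScheme t) : s.gate 8 = t.trips.2.point 510 := by
  rw [s.gate_last]
  exact congrFun t.gates_eq true

/-- The walk that represents a connection scheme. -/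
noncomputable def walk (s : ConnectionScheme t) : List (ℕ × ℕ) :=
  List.ofFn fun i => (octIndex (s.octant i), encode (s.gate i.succ))

/-- All gates of a scheme are points of the refined grid, where `encode` loses no information, and
the first gate is given by the type. -/
theorem walk_injective : Function.Injective (walk (t := t)) := by
  intro s s' h
  have h1 := congrFun (List.ofFn_injective h)
  simp only [Prod.mk.injEq] at h1
  refine ext' (fun i => octIndex_injective (h1 i).1) fun j => ?_
  refine Fin.cases ?_ (fun i => ?_) j
  · rw [gate_zero, gate_zero]
  · have h2 := (h1 i).2
    obtain ⟨u, -, hu⟩ := s.exists_gate_eq i.succ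
    obtain ⟨v, -, hv⟩ := s'.exists_gate_eq i.succ
    rw [hu, hv, encode_codePoint, encode_codePoint] at h2
    rw [hu, hv, h2]

theorem walk_mem (tr : Tree) (s : ConnectionScheme t) : s.walk ∈ schemeWalks tr t := by
  obtain ⟨he, hx⟩ := t.le_trips
  have hlast : (octIndex (s.octant 7), encode (s.gate 7)) ∈
      neighbors (images t.trips.1 t.trips.2) (Nat.mul 2 (pack t.trips.2)) := by
    have := mem_neighbors_of_segment he hx (s.segment 7).symm
    change (_, encode (s.gate 7)) ∈ neighbors _ (encode (s.gate 8)) at this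
    rw [gate_eight, encode_point hx] at this
    exact this
  have h := mem_walks_of_segments he hx s.octant.injective s.segment
    (fin := finalOctants (images t.trips.1 t.trips.2) (Nat.mul 2 (pack t.trips.2)))
    (target := Nat.beq (Nat.mul 2 (pack t.trips.2)))
    (by
      change Nat.beq _ (encode (s.gate 8)) = true
      rw [gate_eight, encode_point hx, Nat.beq_eq]
      rfl)
    (fun i hi => by
      have : i = 7 := Fin.succ_injective _ hi
      subst this
      exact testBit_finalOctants hlast)
  rw [gate_zero, encode_point he] at h
  rw [schemeWalks, memo_eq]
  exact h

theorem exists_walk_eq {tr : Tree} {w : List (ℕ × ℕ)} (h : w ∈ schemeWalks tr t) :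
    ∃ s : ConnectionScheme t, s.walk = w := by
  obtain ⟨he, hx⟩ := t.le_trips
  rw [schemeWalks, memo_eq] at h
  obtain ⟨k, c, rfl, hc, H⟩ := isWalk_of_mem_walks h
  choose o ho hs using fun i => segment_of_mem_neighbors he hx (H.mem i)
  have hinj : Function.Injective o := fun i j hij => H.injective (by rw [← ho, ← ho, hij])
  -- Eight steps through distinct octants visit all eight of them.
  have hbij : Function.Bijective o :=
    (Fintype.bijective_iff_injective_and_card o).2 ⟨hinj, by simp⟩
  refine ⟨{ octant := Equiv.ofBijective o hbij
            gate := fun j => codePoint (c j)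
            gate_first := ?_
            gate_last := ?_
            link := fun i => ?_ }, ?_⟩
  · rw [hc]
    exact (codePoint_two_mul_pack he).trans (congrFun t.gates_eq false).symm
  · have h1 : Nat.mul 2 (pack t.trips.2) = c 8 := Nat.eq_of_beq_eq_true H.target
    rw [← h1]
    exact (codePoint_two_mul_pack hx).trans (congrFun t.gates_eq true).symm
  · obtain ⟨⟨g, r⟩, h1, h2⟩ := hs i
    rw [← t.gates_eq] at h1 h2
    refine ⟨g, ?_⟩
    cases r
    · exact Or.inl ⟨h1, h2⟩
    · exact Or.inr ⟨h1, h2⟩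
  · rw [walk]
    congr 1
    funext i
    simp only [Equiv.ofBijective_apply, encode_codePoint, ho]

theorem card_eq_schemeCount (tr : Tree) (t : GateType) : Finite (ConnectionScheme t) ∧
    Nat.card (ConnectionScheme t) = schemeCount tr t := by
  rw [schemeCount_eq]
  refine card_eq_length (nodup_schemeWalks tr t) walk_injective fun w => ⟨exists_walk_eq, ?_⟩
  rintro ⟨s, rfl⟩
  exact s.walk_mem tr

end ConnectionScheme

/-! ## Symmetric schemes as walks -/

/-- The action of a symmetry on the points of the refined grid, by their codes. -/
def movePoint (c : SymCode) (p : ℕ) : ℕ := pack (c.apply 1020 (unpack p))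

/-- The index of the octant with given coordinates. -/
def tripIndex (t : Trip) : ℕ := Nat.add t.1 (Nat.add (Nat.mul 2 t.2.1) (Nat.mul 4 t.2.2))

/-- The action of a symmetry on the octants, by their indices. -/
def moveOctant (c : SymCode) (k : ℕ) : ℕ :=
  tripIndex (c.apply 1 (Nat.mod k 2, Nat.mod (Nat.div k 2) 2, Nat.div k 4))

theorem codePoint_movePoint (g : CubeSym) {u : Trip} (h : u.le 1020) :
    codePoint (movePoint g.code (pack u)) = g.onPoint (codePoint (pack u)) := by
  rw [movePoint, codePoint, codePoint, unpack_pack (h.mono (by norm_num)),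
    unpack_pack ((Trip.le_apply g h).mono (by norm_num)), point_apply (by norm_num) g h]

theorem moveOctant_octIndex (g : CubeSym) (o : Octant) :
    moveOctant g.code (octIndex o) = octIndex (g.onOctant o) := by
  have h : ∀ o : Octant, (Nat.mod (octIndex o) 2, Nat.mod (Nat.div (octIndex o) 2) 2,
      Nat.div (octIndex o) 4) = octTrip o := by decide
  rw [moveOctant, h]
  have h1 : g.code.apply 1 (octTrip o) = octTrip (g.onOctant o) := by
    refine Trip.ext_sel fun k => ?_
    rw [sel_apply, sel_octTrip, sel_octTrip, CubeSym.onOctant, CubeSym.act]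
    cases g.flip k <;> cases o (g.perm k) <;> rfl
  rw [h1]
  rfl

/-- A walk from `p` is mapped to its reversal by a symmetry. -/
def isReversed (p : ℕ) (w : List (ℕ × ℕ)) (c : SymCode) : Bool :=
  decide ((p :: w.map Prod.snd).map (movePoint c) = (p :: w.map Prod.snd).reverse) &&
    decide ((w.map Prod.fst).map (moveOctant c) = (w.map Prod.fst).reverse)

theorem reverse_ofFn {α : Type} {n : ℕ} (f : Fin n → α) :
    (List.ofFn f).reverse = List.ofFn fun i => f i.rev := by
  refine List.ext_getElem (by simp) fun i h1 h2 => ?_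
  rw [List.getElem_reverse, List.getElem_ofFn, List.getElem_ofFn]
  congr 1
  ext
  simp [Fin.rev]
  omega

namespace ConnectionScheme

variable {t : GateType}

theorem isReversed_iff (s : ConnectionScheme t) (g : CubeSym) :
    isReversed (Nat.mul 2 (pack t.trips.1)) s.walk g.code = true ↔ IsImage g true s s := by
  have h1 : (Nat.mul 2 (pack t.trips.1) :: s.walk.map Prod.snd) =
      List.ofFn fun j => encode (s.gate j) := by
    rw [List.ofFn_succ, gate_zero, encode_point t.le_trips.1, walk, List.map_ofFn]
    rfl
  rw [isReversed, h1, walk, Bool.and_eq_true, decide_eq_true_iff, decide_eq_true_iff,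
    List.map_ofFn, List.map_ofFn, List.map_ofFn, reverse_ofFn, reverse_ofFn,
    List.ofFn_injective.eq_iff, List.ofFn_injective.eq_iff, funext_iff, funext_iff, and_comm]
  have e1 : ∀ i, moveOctant g.code (octIndex (s.octant i)) = octIndex (s.octant i.rev) ↔
      s.octant i.rev = g.onOctant (s.octant i) := fun i => by
    rw [moveOctant_octIndex, octIndex_injective.eq_iff, eq_comm]
  have e2 : ∀ j, movePoint g.code (encode (s.gate j)) = encode (s.gate j.rev) ↔
      s.gate j.rev = g.onPoint (s.gate j) := fun j => by
    obtain ⟨u, hu, h2⟩ := s.exists_gate_eq j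
    obtain ⟨v, -, h3⟩ := s.exists_gate_eq j.rev
    rw [h2, h3, encode_codePoint, encode_codePoint, ← codePoint_injective.eq_iff,
      codePoint_movePoint g hu, eq_comm]
  refine and_congr ⟨fun h i => ?_, fun h i => ?_⟩ ⟨fun h j => ?_, fun h j => ?_⟩
  · have := (e1 i.rev).1 (h i.rev)
    rwa [Fin.rev_rev] at this
  · refine (e1 i).2 ?_
    have := h i.rev
    rwa [revIf, if_pos rfl, Fin.rev_rev] at this
  · have := (e2 j.rev).1 (h j.rev)
    rwa [Fin.rev_rev] at this
  · refine (e2 j).2 ?_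
    have := h j.rev
    rwa [revIf, if_pos rfl, Fin.rev_rev] at this

/-- The symmetries that exchange the gates of a type. -/
def _root_.MonoHilbert.exchangeCodes (t : GateType) : List SymCode :=
  symCodes.filter fun c => mapsGates t t (c, true)

theorem isSymmetric_iff (s : ConnectionScheme t) : s.IsSymmetric ↔
    (exchangeCodes t).any (isReversed (Nat.mul 2 (pack t.trips.1)) s.walk) = true := by
  rw [List.any_eq_true]
  constructor
  · rintro ⟨g, h⟩
    have h1 : MapsTo ⟨g, true⟩ s s := h
    exact ⟨g.code, List.mem_filter.2 ⟨g.code_mem,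
      GateType.onGates_gates_eq_iff.1 h1.mem_stabilizer⟩, (s.isReversed_iff g).2 h⟩
  · rintro ⟨c, hc, h⟩
    obtain ⟨g, rfl⟩ := exists_code_eq (List.mem_filter.1 hc).1
    exact ⟨g, (s.isReversed_iff g).1 h⟩

theorem not_isSymmetric (h : exchangeCodes t = []) (s : ConnectionScheme t) : ¬ s.IsSymmetric := by
  rw [isSymmetric_iff, h]
  exact Bool.false_ne_true

noncomputable def _root_.MonoHilbert.symmetricCount (tr : Tree) (t : GateType) : ℕ :=
  ((schemeWalks tr t).filter fun w =>
    (exchangeCodes t).any (isReversed (Nat.mul 2 (pack t.trips.1)) w)).length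

theorem card_isSymmetric (tr : Tree) (t : GateType) :
    Nat.card {s : ConnectionScheme t // s.IsSymmetric} = symmetricCount tr t := by
  refine (card_eq_length ((nodup_schemeWalks tr t).filter _) (f := fun s => s.1.walk)
    (walk_injective.comp Subtype.val_injective) fun w => ?_).2
  rw [List.mem_filter]
  constructor
  · rintro ⟨h1, h2⟩
    obtain ⟨s, rfl⟩ := exists_walk_eq h1
    exact ⟨⟨s, s.isSymmetric_iff.2 h2⟩, rfl⟩
  · rintro ⟨s, rfl⟩
    exact ⟨s.1.walk_mem tr, s.1.isSymmetric_iff.1 s.2⟩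

end ConnectionScheme

end MonoHilbert

namespace MonoHilbert

/-! ## Curves of a given type -/

theorem CurveClass.hasType_iff {q : CurveClass} {t : GateType} : q.HasType t ↔
    ∃ (R : Rule) (h : R.Linked), (⟦R.curve h⟧ : CurveClass) = q ∧ R.gates = t.gates := by
  constructor
  · rintro ⟨C, hC, h1, h2⟩
    obtain ⟨R, h, rfl⟩ := exists_curve_eq C
    refine ⟨R, h, hC, ?_⟩
    funext b
    cases b
    · exact (R.isEntranceGate_iff _).1 h1
    · exact (R.isExitGate_iff _).1 h2
  · rintro ⟨R, h, hq, hg⟩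
    exact ⟨R.curve h, hq, (R.isEntranceGate_iff _).2 (congrFun hg false),
      (R.isExitGate_iff _).2 (congrFun hg true)⟩

theorem Rule.mk_curve_move {R : Rule} (h : R.Linked) (τ : Motion) :
    (⟦(R.move τ).curve (linked_move h τ)⟧ : CurveClass) = ⟦R.curve h⟧ :=
  Eq.symm (mk_curve_eq_iff.2 ⟨τ, R.order_move τ⟩)

/-- Existence is the classification of gates. For uniqueness, representatives of one class are
related by a motion, which would map the gates of one type to those of the other. -/
theorem CurveClass.existsUnique_hasType (q : CurveClass) : ∃! t : GateType, q.HasType t := by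
  obtain ⟨C, rfl⟩ := Quotient.exists_rep q
  obtain ⟨R, h, rfl⟩ := exists_curve_eq C
  obtain ⟨t, τ, ht⟩ := h.isTyped
  refine ⟨t, hasType_iff.2 ⟨_, _, R.mk_curve_move h τ, by rw [Rule.gates_move, ht]⟩, ?_⟩
  intro t' ht'
  obtain ⟨R', h', e, hg⟩ := hasType_iff.1 ht'
  obtain ⟨σ, hσ⟩ := mk_curve_eq_iff.1 e
  rw [← Rule.order_move] at hσ
  have h1 := Rule.gates_eq_of_order_eq hσ
  rw [Rule.gates_move, hg] at h1
  rw [h1, ← Motion.mul_onGates] at ht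
  exact GateType.eq_of_onGates_gates ht

/-- Linkedness lets the two gates at each transition be recorded as one, so nine gates suffice. -/
theorem Rule.Linked.exists_fits {R : Rule} (h : R.Linked) {t : GateType} (hg : R.gates = t.gates) :
    ∃ s : ConnectionScheme t, s.Fits R := by
  have h1 : ∀ i : Fin 8, (Fin.cons (R.gates false) fun i => R.gate i true :
      Fin 9 → Fin 3 → ℝ) i.castSucc = R.gate i false := by
    refine Fin.cases (R.gates_eq false) fun i => ?_
    rw [Fin.castSucc_succ, Fin.cons_succ]
    exact h i
  refine ⟨{ octant := R.octant
            gate := Fin.cons (R.gates false) fun i => R.gate i true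
            gate_first := congrFun hg false
            gate_last := (R.gates_eq true).symm.trans (congrFun hg true)
            link := fun i => ⟨R.sym i, ?_⟩ }, fun _ => rfl, fun i b => ?_⟩
  · rw [h1, Fin.cons_succ, Rule.gate, Rule.gate, hg]
    cases hr : R.rev i
    · left
      simp [Motion.onGates, Rule.motion, hr, GateType.gates]
    · right
      simp [Motion.onGates, Rule.motion, hr, GateType.gates]
  · cases b
    · exact (h1 i).symm
    · rfl

namespace ConnectionScheme

variable {t : GateType}

theorem exists_matches_iff {s : ConnectionScheme t} {q : CurveClass} :
    (∃ C : MonoHilbertCurve, (⟦C⟧ : CurveClass) = q ∧ C.1.Matches s) ↔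
      ∃ (R : Rule) (h : R.Linked), (⟦R.curve h⟧ : CurveClass) = q ∧ s.Fits R := by
  constructor
  · rintro ⟨C, hC, h1⟩
    obtain ⟨R, h, rfl⟩ := exists_curve_eq C
    exact ⟨R, h, hC, (R.matches_iff s).1 h1⟩
  · rintro ⟨R, h, hq, hs⟩
    exact ⟨R.curve h, hq, (R.matches_iff s).2 hs⟩

/-- The class of the schemes of the representatives of a curve class that have the gates of the
type. -/
theorem exists_schemeClass {q : CurveClass} (hq : q.HasType t) :
    ∃ σ : Quotient (setoid t), ∀ σ' : Quotient (setoid t), σ = σ' ↔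
      ∃ C : MonoHilbertCurve, (⟦C⟧ : CurveClass) = q ∧ C.1.Matches σ'.out := by
  obtain ⟨R, h, rfl, hg⟩ := CurveClass.hasType_iff.1 hq
  obtain ⟨s, hs⟩ := h.exists_fits hg
  refine ⟨⟦s⟧, fun σ' => ?_⟩
  rw [exists_matches_iff]
  constructor
  · intro e
    rw [← σ'.out_eq] at e
    obtain ⟨g, r, hτ⟩ := Quotient.exact e
    exact ⟨_, _, R.mk_curve_move h ⟨g, r⟩, hs.move (τ := ⟨g, r⟩) hτ⟩
  · rintro ⟨R', h', e, hs'⟩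
    obtain ⟨τ, hτ⟩ := mk_curve_eq_iff.1 e.symm
    rw [← σ'.out_eq]
    exact Quotient.sound ⟨τ.sym, τ.rev, hs.mapsTo hs' hτ⟩

theorem hasType_of_matches {s : ConnectionScheme t} {q : CurveClass}
    (h : ∃ C : MonoHilbertCurve, (⟦C⟧ : CurveClass) = q ∧ C.1.Matches s) : q.HasType t := by
  obtain ⟨R, h, e, hs⟩ := exists_matches_iff.1 h
  exact CurveClass.hasType_iff.2 ⟨R, h, e, hs.gates⟩

/-- Each curve class of the type has exactly one class of schemes, and the fibre over a class of
schemes consists of the curve classes that match a representative. -/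
theorem numCurves_eq_add [Finite (ConnectionScheme t)] {S T a b : ℕ}
    (hS : Nat.card {q : Quotient (setoid t) // q.out.IsSymmetric} = S)
    (hT : Nat.card {q : Quotient (setoid t) // ¬ q.out.IsSymmetric} = T)
    (ha : ∀ s : ConnectionScheme t, s.IsSymmetric → s.numCurves = a)
    (hb : ∀ s : ConnectionScheme t, ¬ s.IsSymmetric → s.numCurves = b) (ha0 : a ≠ 0)
    (hb0 : b ≠ 0) : MonoHilbert.numCurves t = S * a + T * b := by
  classical
  cases nonempty_fintype (Quotient (setoid t))
  choose F hF using fun q : {q : CurveClass // q.HasType t} => exists_schemeClass q.2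
  have h1 : ∀ σ : Quotient (setoid t), Nat.card {q // F q = σ} = σ.out.numCurves := fun σ =>
    Nat.card_congr
      { toFun := fun q => ⟨q.1.1, (hF q.1 σ).1 q.2⟩
        invFun := fun q => ⟨⟨q.1, hasType_of_matches q.2⟩, (hF _ σ).2 q.2⟩
        left_inv := fun _ => rfl
        right_inv := fun _ => rfl }
  have h2 : ∀ σ : Quotient (setoid t),
      σ.out.numCurves = if σ.out.IsSymmetric then a else b := fun σ => by
    split_ifs with h
    · exact ha _ h
    · exact hb _ h
  -- `Nat.card` vanishes on infinite types, so a nonzero count proves finiteness.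
  have h3 : ∀ σ : Quotient (setoid t), Finite {q // F q = σ} := fun σ => by
    refine Nat.finite_of_card_ne_zero ?_
    rw [h1, h2]
    split_ifs
    · exact ha0
    · exact hb0
  rw [MonoHilbert.numCurves, ← Nat.card_congr (Equiv.sigmaFiberEquiv F), Nat.card_sigma,
    Finset.sum_congr rfl fun σ _ => (h1 σ).trans (h2 σ), Finset.sum_ite, Finset.sum_const,
    Finset.sum_const, smul_eq_mul, smul_eq_mul, ← hS, ← hT, Nat.card_eq_fintype_card,
    Nat.card_eq_fintype_card, Fintype.card_subtype, Fintype.card_subtype]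

theorem numSchemes_eq_add [Finite (ConnectionScheme t)] {S T : ℕ}
    (hS : Nat.card {q : Quotient (setoid t) // q.out.IsSymmetric} = S)
    (hT : Nat.card {q : Quotient (setoid t) // ¬ q.out.IsSymmetric} = T) :
    numSchemes t = S + T := by
  classical
  rw [numSchemes, ← hS, ← hT, ← Nat.card_sum]
  exact (Nat.card_congr (Equiv.sumCompl _)).symm

/-- The counts for a type with `n` motions that preserve its gates, `N` schemes, and `M` symmetric
schemes. -/
theorem counts {n N M S T a b K L : ℕ} (tr : Tree)
    (hn : (GateType.motionCodes.filter (mapsGates t t)).length = n)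
    (hN : schemeCount tr t = N) (hM : Nat.card {s : ConnectionScheme t // s.IsSymmetric} = M)
    (hS : S * n = 2 * M) (hT : T * n = N - M) (hn0 : 0 < n)
    (ha : (n * 2) ^ 4 / 2 ^ 8 + (n ^ 8 - (n * 2) ^ 4) / 2 = a) (ha0 : a ≠ 0) (hb : n ^ 8 = b)
    (hK : S + T = K) (hL : S * a + T * b = L) :
    numSchemes t = K ∧ MonoHilbert.numCurves t = L ∧
      ∀ s : ConnectionScheme t, (s.IsSymmetric → s.numCurves = a) ∧
        (¬ s.IsSymmetric → s.numCurves = b) := by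
  subst hb hK hL
  have := (card_eq_schemeCount tr t).1
  have := t.card_stabilizer.1
  have hn' := t.card_stabilizer.2.trans hn
  obtain ⟨h1, h2⟩ := card_classes hn' ((card_eq_schemeCount tr t).2.trans hN) hM
  have h3 := Nat.eq_of_mul_eq_mul_right hn0 (h1.trans hS.symm)
  have h4 := Nat.eq_of_mul_eq_mul_right hn0 (h2.trans hT.symm)
  have h5 : ∀ s : ConnectionScheme t, s.IsSymmetric → s.numCurves = a := fun s hs => by
    rw [numCurves_of_isSymmetric hs, hn', ha]
  have h6 : ∀ s : ConnectionScheme t, ¬ s.IsSymmetric → s.numCurves = n ^ 8 := fun s hs => by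
    rw [numCurves_of_not_isSymmetric hs, hn']
  exact ⟨numSchemes_eq_add h3 h4, numCurves_eq_add h3 h4 h5 h6 ha0 (pow_pos hn0 8).ne',
    fun s => ⟨h5 s, h6 s⟩⟩

/-- A symmetric scheme would provide a reversing motion that preserves the gates, that is, a
symmetry that exchanges them. If none exists, all schemes are asymmetric. -/
theorem counts_of_exchangeCodes {n N T : ℕ} (tr : Tree)
    (hn : (GateType.motionCodes.filter (mapsGates t t)).length = n)
    (hN : schemeCount tr t = N) (he : exchangeCodes t = []) (hT : T * n = N) (hn0 : 0 < n) :
    numSchemes t = T ∧ MonoHilbert.numCurves t = T * n ^ 8 ∧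
      ∀ s : ConnectionScheme t, s.numCurves = n ^ 8 := by
  have := (card_eq_schemeCount tr t).1
  have := t.card_stabilizer.1
  have hn' := t.card_stabilizer.2.trans hn
  have hM : Nat.card {s : ConnectionScheme t // s.IsSymmetric} = 0 := by
    have : IsEmpty {s : ConnectionScheme t // s.IsSymmetric} :=
      ⟨fun s => not_isSymmetric he s.1 s.2⟩
    exact Nat.card_of_isEmpty
  obtain ⟨h1, h2⟩ := card_classes hn' ((card_eq_schemeCount tr t).2.trans hN) hM
  have h3 := Nat.eq_of_mul_eq_mul_right hn0 (h1.trans (Nat.zero_mul n).symm)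
  have h4 := Nat.eq_of_mul_eq_mul_right hn0 (h2.trans hT.symm)
  have h5 : ∀ s : ConnectionScheme t, s.numCurves = n ^ 8 := fun s => by
    rw [numCurves_of_not_isSymmetric (not_isSymmetric he s), hn']
  have h6 := numSchemes_eq_add h3 h4
  -- The value of `a` is arbitrary, since it is multiplied by the number 0 of symmetric classes.
  have h7 := numCurves_eq_add h3 h4 (a := 1) (fun s hs => absurd hs (not_isSymmetric he s))
    (fun s _ => h5 s) one_ne_zero (pow_pos hn0 8).ne'
  rw [Nat.zero_add] at h6
  rw [Nat.zero_mul, Nat.zero_add] at h7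
  exact ⟨h6, h7, h5⟩

end ConnectionScheme

/-! ## The numbers -/

/-- A search tree of all points with coordinates in a list. -/
def gridTree (l : List ℕ) : Tree :=
  Tree.ofList 8 (l.flatMap fun a => l.flatMap fun b => l.map fun c => pack (c, b, a))

/-- In the refined grid the gates in schemes of types A and B are corners of octants, with
coordinates 0, 510 or 1020; for type C, midpoints of edges of octants are added. -/
theorem schemeCount_A : schemeCount (gridTree [0, 510, 1020]) .A = 96 := by decide +kernel

theorem schemeCount_B : schemeCount (gridTree [0, 510, 1020]) .B = 560 := by decide +kernel

theorem schemeCount_C : schemeCount (gridTree [0, 255, 510, 765, 1020]) .C = 2758 := by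
  decide +kernel

theorem schemeCount_D : schemeCount .leaf .D = 8 := by decide +kernel

theorem schemeCount_E : schemeCount .leaf .E = 16 := by decide +kernel

theorem schemeCount_F : schemeCount .leaf .F = 1 := by decide +kernel

theorem symmetricCount_A : symmetricCount (gridTree [0, 510, 1020]) .A = 20 := by decide +kernel

theorem symmetricCount_B : symmetricCount (gridTree [0, 510, 1020]) .B = 36 := by decide +kernel

/-- Four motions preserve the gates, so the 20 symmetric schemes form 20 · 2 / 4 = 10 classes and
the other 76 form 76 / 4 = 19. -/
theorem counts_A : numSchemes .A = 29 ∧ numCurves .A = 1552544 ∧ ∀ s : ConnectionScheme .A,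
    (s.IsSymmetric → s.numCurves = 16 + 30720) ∧ (¬ s.IsSymmetric → s.numCurves = 65536) :=
  ConnectionScheme.counts (n := 4) (a := 16 + 30720) (S := 10) (T := 19) _
    (by decide +kernel) schemeCount_A
    ((ConnectionScheme.card_isSymmetric _ _).trans symmetricCount_A) (by norm_num) (by norm_num)
    (by norm_num) (by norm_num) (by norm_num) (by norm_num) (by norm_num) (by norm_num)

theorem counts_B : numSchemes .B = 149 ∧ numCurves .B = 9138464 ∧ ∀ s : ConnectionScheme .B,
    (s.IsSymmetric → s.numCurves = 16 + 30720) ∧ (¬ s.IsSymmetric → s.numCurves = 65536) :=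
  ConnectionScheme.counts (n := 4) (a := 16 + 30720) (S := 18) (T := 131) _
    (by decide +kernel) schemeCount_B
    ((ConnectionScheme.card_isSymmetric _ _).trans symmetricCount_B) (by norm_num) (by norm_num)
    (by norm_num) (by norm_num) (by norm_num) (by norm_num) (by norm_num) (by norm_num)

theorem counts_C : numSchemes .C = 2758 ∧ numCurves .C = 2758 ∧
    ∀ s : ConnectionScheme .C, s.numCurves = 1 :=
  ConnectionScheme.counts_of_exchangeCodes (n := 1) (T := 2758) _ (by decide +kernel) schemeCount_C
    (by decide +kernel) (by norm_num) (by norm_num)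

theorem counts_D : numSchemes .D = 4 ∧ numCurves .D = 1024 ∧
    ∀ s : ConnectionScheme .D, s.numCurves = 256 :=
  ConnectionScheme.counts_of_exchangeCodes (n := 2) (T := 4) _ (by decide +kernel) schemeCount_D
    (by decide +kernel) (by norm_num) (by norm_num)

theorem counts_E : numSchemes .E = 16 ∧ numCurves .E = 16 ∧
    ∀ s : ConnectionScheme .E, s.numCurves = 1 :=
  ConnectionScheme.counts_of_exchangeCodes (n := 1) (T := 16) _ (by decide +kernel) schemeCount_E
    (by decide +kernel) (by norm_num) (by norm_num)

theorem counts_F : numSchemes .F = 1 ∧ numCurves .F = 1 ∧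
    ∀ s : ConnectionScheme .F, s.numCurves = 1 :=
  ConnectionScheme.counts_of_exchangeCodes (n := 1) (T := 1) _ (by decide +kernel) schemeCount_F
    (by decide +kernel) (by norm_num) (by norm_num)

/-- The type with a given index. -/
def GateType.ofIndex : Fin 6 → GateType := ![.A, .B, .C, .D, .E, .F]

theorem GateType.ofIndex_bijective : Function.Bijective ofIndex := by
  let f : GateType → Fin 6 := fun t => match t with
    | .A => 0 | .B => 1 | .C => 2 | .D => 3 | .E => 4 | .F => 5
  refine Function.bijective_iff_has_inverse.2 ⟨f, fun i => ?_, fun t => ?_⟩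
  · fin_cases i <;> rfl
  · cases t <;> rfl

theorem card_curveClass : Nat.card CurveClass = ∑ i, numCurves (GateType.ofIndex i) := by
  choose F hF using fun q : CurveClass => q.existsUnique_hasType
  let e := Equiv.ofBijective _ GateType.ofIndex_bijective
  have h1 : ∀ i, Nat.card {q // e.symm (F q) = i} = numCurves (GateType.ofIndex i) := fun i => by
    refine Nat.card_congr (Equiv.subtypeEquivRight fun q => ?_)
    rw [Equiv.symm_apply_eq]
    constructor
    · intro h
      have := (hF q).1
      rw [h] at this
      exact this
    · exact fun h => ((hF q).2 _ h).symm
  -- Again finiteness follows from the nonzero value of `Nat.card`.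
  have h2 : ∀ i, Finite {q // e.symm (F q) = i} := fun i => by
    refine Nat.finite_of_card_ne_zero ?_
    rw [h1]
    fin_cases i
    · exact counts_A.2.1 ▸ by norm_num
    · exact counts_B.2.1 ▸ by norm_num
    · exact counts_C.2.1 ▸ by norm_num
    · exact counts_D.2.1 ▸ by norm_num
    · exact counts_E.2.1 ▸ by norm_num
    · exact counts_F.2.1 ▸ by norm_num
  rw [← Nat.card_congr (Equiv.sigmaFiberEquiv fun q => e.symm (F q)), Nat.card_sigma]
  exact Finset.sum_congr rfl fun i _ => h1 i

end MonoHilbert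

/-- The number of three-dimensional mono-Hilbert curves modulo rotation, reflection and reversal, in
total and for each type; each curve has exactly one type.  Moreover: the number of connection schemes
of each type, and the number of curves that match each connection scheme. -/
theorem mainTheorem2 :
    Nat.card MonoHilbert.CurveClass = 10694807 ∧
    (∀ q : MonoHilbert.CurveClass, ∃! t : MonoHilbert.GateType, q.HasType t) ∧
    (MonoHilbert.numCurves .A = 1552544 ∧
      MonoHilbert.numCurves .B = 9138464 ∧
      MonoHilbert.numCurves .C = 2758 ∧
      MonoHilbert.numCurves .D = 1024 ∧
      MonoHilbert.numCurves .E = 16 ∧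
      MonoHilbert.numCurves .F = 1) ∧
    (MonoHilbert.numSchemes .A = 29 ∧
      MonoHilbert.numSchemes .B = 149 ∧
      MonoHilbert.numSchemes .C = 2758 ∧
      MonoHilbert.numSchemes .D = 4 ∧
      MonoHilbert.numSchemes .E = 16 ∧
      MonoHilbert.numSchemes .F = 1) ∧
    (∀ t : MonoHilbert.GateType, t = .A ∨ t = .B →
      ∀ s : MonoHilbert.ConnectionScheme t,
        (s.IsSymmetric → s.numCurves = 16 + 30720) ∧ (¬ s.IsSymmetric → s.numCurves = 65536)) ∧
    (∀ s : MonoHilbert.ConnectionScheme .D, s.numCurves = 256) ∧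
    (∀ t : MonoHilbert.GateType, t = .C ∨ t = .E ∨ t = .F →
      ∀ s : MonoHilbert.ConnectionScheme t, s.numCurves = 1) := by
  refine ⟨?_, MonoHilbert.CurveClass.existsUnique_hasType,
    ⟨MonoHilbert.counts_A.2.1, MonoHilbert.counts_B.2.1, MonoHilbert.counts_C.2.1,
      MonoHilbert.counts_D.2.1, MonoHilbert.counts_E.2.1, MonoHilbert.counts_F.2.1⟩,
    ⟨MonoHilbert.counts_A.1, MonoHilbert.counts_B.1, MonoHilbert.counts_C.1,
      MonoHilbert.counts_D.1, MonoHilbert.counts_E.1, MonoHilbert.counts_F.1⟩, ?_,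
    MonoHilbert.counts_D.2.2, ?_⟩
  · rw [MonoHilbert.card_curveClass, Fin.sum_univ_six]
    change MonoHilbert.numCurves .A + MonoHilbert.numCurves .B + MonoHilbert.numCurves .C +
      MonoHilbert.numCurves .D + MonoHilbert.numCurves .E + MonoHilbert.numCurves .F = _
    rw [MonoHilbert.counts_A.2.1, MonoHilbert.counts_B.2.1, MonoHilbert.counts_C.2.1,
      MonoHilbert.counts_D.2.1, MonoHilbert.counts_E.2.1, MonoHilbert.counts_F.2.1]
  · rintro t (rfl | rfl)
    · exact MonoHilbert.counts_A.2.2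
    · exact MonoHilbert.counts_B.2.2
  · rintro t (rfl | rfl | rfl)
    · exact MonoHilbert.counts_C.2.2
    · exact MonoHilbert.counts_E.2.2
    · exact MonoHilbert.counts_F.2.2
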